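/- Write points of $\mathbb{R}^3$ as $(m_1,m_2,m_3)$, with canonical basis $(e_1,e_2,e_3)$. For integers $k\ge 1$, $N\ge1$, let $\mathcal{E}^k(\mathbb{R}^N)$ be the set of measurable maps $v:\mathbb{R}^N\to\mathbb{S}^2$ with $v_1,v_3\in L^2(\mathbb{R}^N)$ and $\nabla v\in H^{k-1}(\mathbb{R}^N)$, with the metric given by the norm $$\|v\|_{Z^k}=\big(\|v_1\|_{H^k}^2+\|v_2\|_{L^\infty}^2+\|\nabla v_2\|_{H^{k-1}}^2+\|v_3\|_{H^k}^2\big)^{1/2}.$$ The Landau-Lifshitz equation with parameters $\lambda_1,\lambda_3$ is $$\partial_t m+m\times\big(\Delta m-\lambda_1m_1e_1-\lambda_3m_3e_3\big)=0. \tag{LL}$$ Put $\|f\|_{\dot H^j}^2=\sum_{|\alpha|=j}\|\partial_x^\alpha f\|_{L^2}^2$ (sum over multi-indices $\alpha\in\mathbb{N}^N$, and over the components of $f$). For a sufficiently smooth solution $m:\mathbb{R}^N\times[0,T]\to\mathbb{S}^2$ let $$E_{\rm LL}^1(t)=\frac12\int_{\mathbb{R}^N}\big(|\nabla m|^2+\lambda_1m_1^2+\lambda_3m_3^2\big)(x,t)\,dx,$$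 and, for integers $\ell\ge2$, $$E_{\rm LL}^\ell(t)=\frac12\Big(\|\partial_tm\|_{\dot H^{\ell-2}}^2+\|\Delta m\|_{\dot H^{\ell-2}}^2+(\lambda_1+\lambda_3)\big(\|\nabla m_1\|_{\dot H^{\ell-2}}^2+\|\nabla m_3\|_{\dot H^{\ell-2}}^2\big)+\lambda_1\lambda_3\big(\|m_1\|_{\dot H^{\ell-2}}^2+\|m_3\|_{\dot H^{\ell-2}}^2\big)\Big)(t).$$ **Proposition.** For every $k\in\mathbb{N}$ there is a number $C_k>0$, depending only on $k$, with the following property. Let $N\ge1$ be an integer with $k>N/2+1$, let $0<\varepsilon<1$, $\lambda_1=\lambda_3=1/\varepsilon$ and $T>0$, and let $m\in\mathcal{C}^0([0,T],\mathcal{E}^{k+4}(\mathbb{R}^N))$ be a solution of (LL) with $\partial_tm\in\mathcal{C}^0([0,T],H^{k+2}(\mathbb{R}^N))$. Then, for every integer $2\le\ell\le k+2$, the function $E_{\rm LL}^\ell$ is of class $\mathcal{C}^1$ on $[0,T]$, and $$\big[E_{\rm LL}^\ell\big]'(t)\le\frac{C_k}{\varepsilon}\Big(\|m_1(\cdot,t)\|_{L^\infty}^2+\|m_3(\cdot,t)\|_{L^\infty}^2+\|\nabla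 m(\cdot,t)\|_{L^\infty}^2\Big)\Big(E_{\rm LL}^\ell(t)+E_{\rm LL}^{\ell-1}(t)\Big)$$ for every $t\in[0,T]$. -/

import Mathlib

open MeasureTheory Set Filter Topology
open scoped ENNReal ContDiff Matrix

noncomputable section

namespace LandauLifshitz

/-- The Euclidean space `ℝ^N`. -/
abbrev Space (N : ℕ) : Type := EuclideanSpace ℝ (Fin N)

/-- The classical partial derivative `∂_i φ`. -/
def partialDeriv {N : ℕ} (i : Fin N) (φ : Space N → ℝ) : Space N → ℝ :=
  fun x => fderiv ℝ φ x (EuclideanSpace.single i 1)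

/-- The classical derivative `∂^α φ = ∂_1^{α_1} ⋯ ∂_N^{α_N} φ`, for a multi-index `α`
(used for smooth `φ` only). -/
def multiDeriv {N : ℕ} (α : Fin N → ℕ) (φ : Space N → ℝ) : Space N → ℝ :=
  (List.finRange N).foldr (fun i ψ => (partialDeriv i)^[α i] ψ) φ

/-- The smooth compactly supported test functions on `ℝ^N`. -/
def IsTest {N : ℕ} (φ : Space N → ℝ) : Prop :=
  ContDiff ℝ ∞ φ ∧ HasCompactSupport φ

/-- `g` is a weak derivative `∂^α f` of the locally integrable function `f`. -/
def HasWeakDeriv {N : ℕ} (α : Fin N → ℕ) (f g : Space N → ℝ) : Prop :=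
  LocallyIntegrable f ∧ LocallyIntegrable g ∧
    ∀ φ : Space N → ℝ, IsTest φ →
      ∫ x, f x * multiDeriv α φ x = (-1 : ℝ) ^ (∑ i, α i) * ∫ x, g x * φ x

open Classical in
/-- The weak derivative `∂^α f` (unique up to a null set when it exists; `0` if there is none). -/
def weakDeriv {N : ℕ} (α : Fin N → ℕ) (f : Space N → ℝ) : Space N → ℝ :=
  if h : ∃ g, HasWeakDeriv α f g then h.choose else 0

/-- The weak first-order partial derivative `∂_i f`. -/
def weakPartial {N : ℕ} (i : Fin N) (f : Space N → ℝ) : Space N → ℝ :=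
  weakDeriv (Pi.single i 1) f

/-- The weak Laplacian `Δ f = ∑_i ∂_i^2 f`. -/
def weakLaplacian {N : ℕ} (f : Space N → ℝ) : Space N → ℝ :=
  fun x => ∑ i, weakDeriv (Pi.single i 2) f x

/-- Membership in the Sobolev space `H^k(ℝ^N)`. -/
def MemH {N : ℕ} (k : ℕ) (f : Space N → ℝ) : Prop :=
  MemLp f 2 volume ∧
    ∀ α : Fin N → ℕ, ∑ i, α i ≤ k → ∃ g, HasWeakDeriv α f g ∧ MemLp g 2 volume

/-- The squared homogeneous norm `‖f‖_{Ḣ^j}^2 = ∑_{|α| = j} ‖∂^α f‖_{L^2}^2`. -/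
def hdotSq {N : ℕ} (j : ℕ) (f : Space N → ℝ) : ℝ :=
  ∑ α ∈ Finset.piAntidiag (Finset.univ : Finset (Fin N)) j, ∫ x, weakDeriv α f x ^ 2

/-- The squared norm `‖f‖_{H^k}^2 = ∑_{|α| ≤ k} ‖∂^α f‖_{L^2}^2`. -/
def sobolevSq {N : ℕ} (k : ℕ) (f : Space N → ℝ) : ℝ :=
  ∑ j ∈ Finset.range (k + 1), hdotSq j f

/-- The uniform norm `‖f‖_{L^∞}` of an essentially bounded function. -/
def supNorm {N : ℕ} (f : Space N → ℝ) : ℝ :=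
  (eLpNorm f ∞ volume).toReal

/-- The component of a map `u : ℝ^N → ℝ^3` with index `a`. The components `u_1`, `u_2`, `u_3`
have the indices `0`, `1`, `2`. -/
def comp {N : ℕ} (u : Space N → Fin 3 → ℝ) (a : Fin 3) : Space N → ℝ :=
  fun x => u x a

/-- `|∇u|^2 = ∑_{i, a} |∂_i u_a|^2`. -/
def gradSq {N : ℕ} (u : Space N → Fin 3 → ℝ) : Space N → ℝ :=
  fun x => ∑ i, ∑ a, weakPartial i (comp u a) x ^ 2

/-- `‖∇u‖_{L^∞}`. -/
def gradSupNorm {N : ℕ} (u : Space N → Fin 3 → ℝ) : ℝ :=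
  supNorm fun x => Real.sqrt (gradSq u x)

/-- Membership in `𝓔^k(ℝ^N)`, `k ≥ 1`: maps `u` with values in the unit sphere `𝕊^2`, with
`u_1, u_3 ∈ L^2(ℝ^N)` and `∇u ∈ H^{k-1}(ℝ^N)`. -/
def MemE {N : ℕ} (k : ℕ) (u : Space N → Fin 3 → ℝ) : Prop :=
  (∀ a, AEStronglyMeasurable (comp u a) volume) ∧
    (∀ᵐ x, ∑ a, u x a ^ 2 = 1) ∧
    MemLp (comp u 0) 2 volume ∧ MemLp (comp u 2) 2 volume ∧
    ∀ (i : Fin N) (a : Fin 3),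
      ∃ g, HasWeakDeriv (Pi.single i 1) (comp u a) g ∧ MemH (k - 1) g

/-- The squared norm of `Z^k(ℝ^N)`, `k ≥ 1`:
`‖u‖_{Z^k}^2 = ‖u_1‖_{H^k}^2 + ‖u_2‖_{L^∞}^2 + ‖∇u_2‖_{H^{k-1}}^2 + ‖u_3‖_{H^k}^2`. -/
def zNormSq {N : ℕ} (k : ℕ) (u : Space N → Fin 3 → ℝ) : ℝ :=
  sobolevSq k (comp u 0) + supNorm (comp u 1) ^ 2
    + ∑ i, sobolevSq (k - 1) (weakPartial i (comp u 1)) + sobolevSq k (comp u 2)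

/-- `m ∈ C^0([0, T], 𝓔^k(ℝ^N))`, for the metric given by the norm of `Z^k(ℝ^N)`. -/
def ContinuousInE {N : ℕ} (k : ℕ) (T : ℝ) (m : ℝ → Space N → Fin 3 → ℝ) : Prop :=
  (∀ t ∈ Icc 0 T, MemE k (m t)) ∧
    ∀ s ∈ Icc 0 T, Tendsto (fun t => zNormSq k (m t - m s)) (𝓝[Icc 0 T] s) (𝓝 0)

/-- `v ∈ C^0([0, T], H^k(ℝ^N))`, for a map `v` with values in `ℝ^3`. -/
def ContinuousInH {N : ℕ} (k : ℕ) (T : ℝ) (v : ℝ → Space N → Fin 3 → ℝ) : Prop :=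
  (∀ t ∈ Icc 0 T, ∀ a, MemH k (comp (v t) a)) ∧
    ∀ s ∈ Icc 0 T,
      Tendsto (fun t => ∑ a, sobolevSq k (comp (v t - v s) a)) (𝓝[Icc 0 T] s) (𝓝 0)

/-- `v = ∂_t m` on `[0, T]` in the sense of distributions on `ℝ^N`: for every test function `φ`,
the function `s ↦ ∫ m(x, s) φ(x) dx` has the derivative `∫ v(x, t) φ(x) dx` at every
`t ∈ [0, T]` (one-sided at the end points). -/
def IsTimeDeriv {N : ℕ} (T : ℝ) (m v : ℝ → Space N → Fin 3 → ℝ) : Prop :=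
  ∀ φ : Space N → ℝ, IsTest φ → ∀ a : Fin 3, ∀ t ∈ Icc 0 T,
    HasDerivWithinAt (fun s => ∫ x, m s x a * φ x) (∫ x, v t x a * φ x) (Icc 0 T) t

/-- The map `m`, with time derivative `v`, solves on `[0, T]` the Landau-Lifshitz equation
`∂_t m + m × (Δm - λ_1 m_1 e_1 - λ_3 m_3 e_3) = 0`. -/
def IsLLSolution {N : ℕ} (lam₁ lam₃ T : ℝ) (m v : ℝ → Space N → Fin 3 → ℝ) : Prop :=
  IsTimeDeriv T m v ∧
    ∀ t ∈ Icc 0 T, ∀ᵐ x,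
      v t x + (m t x) ⨯₃
        ((fun a => weakLaplacian (comp (m t) a) x) - ![lam₁ * m t x 0, 0, lam₃ * m t x 2]) = 0

/-- The Landau-Lifshitz energy
`E_LL(u) = (1/2) ∫ (|∇u|^2 + λ_1 u_1^2 + λ_3 u_3^2)`. -/
def energyLL {N : ℕ} (lam₁ lam₃ : ℝ) (u : Space N → Fin 3 → ℝ) : ℝ :=
  (1 / 2) * ∫ x, (gradSq u x + lam₁ * u x 0 ^ 2 + lam₃ * u x 2 ^ 2)

/-- The energy `E_LL^ℓ` of a map `u = m(·, t)` with time derivative `v = ∂_t m(·, t)`. It is the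
Landau-Lifshitz energy for `ℓ = 1`, and the order `ℓ = 0` is not used. -/
def energyOrder {N : ℕ} (lam₁ lam₃ : ℝ) : ℕ → (u v : Space N → Fin 3 → ℝ) → ℝ
  | 0, u, _ => energyLL lam₁ lam₃ u
  | 1, u, _ => energyLL lam₁ lam₃ u
  | j + 2, u, v =>
    (1 / 2) *
      (∑ a, hdotSq j (comp v a) + ∑ a, hdotSq j (weakLaplacian (comp u a))
        + (lam₁ + lam₃) *
          (∑ i, hdotSq j (weakPartial i (comp u 0)) + ∑ i, hdotSq j (weakPartial i (comp u 2)))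
        + lam₁ * lam₃ * (hdotSq j (comp u 0) + hdotSq j (comp u 2)))

end LandauLifshitz

end

/-! Write λ = 1/ε, F(u) = Δu − λ(u₁e₁ + u₃e₃) and v = ∂ₜm = −m × F(m). A second time derivative
turns the equation into a fourth-order wave equation: ∂ₜ²m + Δ²m − 2λΔ(m₁e₁ + m₃e₃) + λ²(m₁e₁ +
m₃e₃) equals a nonlinearity. The energy of order s + 2 is the natural energy of the linear part,
summed over the derivatives of order s. Its derivative is therefore the sum over |α| = s of ∫ ∂^α v
· ∂^α(nonlinearity) (`SphereMap.rate_eq`, `SphereMap.rate_eq_sum`).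

Let A² be the sum of squared uniform norms in the statement and X² twice the sum of the energies of
orders s + 2 and s + 1. By the algebraic identity `acc_add_eq`, the nonlinearity on the sphere is
`cub` plus `gK` times m. The two pieces are estimated differently.

The terms of `cub` are products of three functions among m₁, m₃, ∂ᵢm, with at most one further
derivative and with weight 1, λ or λ². All these functions are bounded by A, and their derivatives
of orders s and s + 1 by X in L². Moser estimates give λA²X (`cub_le`). The terms of weight λ²
contain no derivative, and the energy bounds m₁ and m₃ by X/λ at order s, which pays for the extra
λ.

The term along m contains third derivatives of m, one more than X controls. But v is orthogonal to
m. Since m · (m × F) = 0, the scalar product m · ∂^α v reduces to commutators and to terms without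
top-order derivatives, and its gradient is bounded by λAX (`Ctrl.normal_le`). One derivative is
moved from the double divergence `gK` onto this product by parts (`Ctrl.integral_normal_term_le`).
Altogether the derivative of the energy is at most CλA²X² (`smooth_estimate`).

The estimate is proved for smooth maps and transferred by mollification in space. Mollified maps
leave the sphere, so `acc_add_eq` is stated for arbitrary smooth maps with an explicit remainder
`errT`. Each of its terms contains |u|² − 1 or a derivative of |u|²/2, and these tend to zero for
mollifications of a sphere-valued map (`SphereMap.hconv_errT`, `weak_estimate`). Differentiability
in time comes from the convergence of difference quotients in Sobolev norm (`hconv_slope`) and the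
product rule (`Flow.td_velo`).

The analytic tools are Gagliardo-Nirenberg by integration by parts and log-convexity, the Moser
product estimate, the Sobolev embedding by Fourier transform, and the existence of weak derivatives
by Riesz duality. -/

noncomputable section

namespace LandauLifshitz

/-! ### Iterated partial derivatives along words, L² bounds, and classes of smooth functions. -/

section Calculus

variable {N : ℕ}

/-- The iterated partial derivative of `f` along a word of coordinate directions. -/
def D (w : List (Fin N)) (f : Space N → ℝ) : Space N → ℝ := w.foldr partialDeriv f

@[simp] lemma D_nil (f : Space N → ℝ) : D [] f = f := rfl

lemma D_cons (i : Fin N) (w : List (Fin N)) (f : Space N → ℝ) :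
    D (i :: w) f = partialDeriv i (D w f) := rfl

lemma D_append (w w' : List (Fin N)) (f : Space N → ℝ) : D (w ++ w') f = D w (D w' f) := by
  simp [D]

lemma D_singleton (i : Fin N) (f : Space N → ℝ) : D [i] f = partialDeriv i f := rfl

/-- Smooth functions. -/
abbrev Smooth (f : Space N → ℝ) : Prop := ContDiff ℝ ∞ f

lemma Smooth.differentiable {f : Space N → ℝ} (hf : Smooth f) : Differentiable ℝ f :=
  ContDiff.differentiable hf (by simp)

lemma Smooth.pd {f : Space N → ℝ} (hf : Smooth f) (i : Fin N) :
    Smooth (partialDeriv i f) := by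
  have : ContDiff ℝ ∞ (fderiv ℝ f) := hf.fderiv_right (by simp)
  exact this.clm_apply contDiff_const

lemma Smooth.word {f : Space N → ℝ} (hf : Smooth f) (w : List (Fin N)) : Smooth (D w f) := by
  induction w with
  | nil => exact hf
  | cons i w ih => exact ih.pd i

lemma Smooth.mul {f g : Space N → ℝ} (hf : Smooth f) (hg : Smooth g) : Smooth (f * g) :=
  ContDiff.mul hf hg

lemma Smooth.add {f g : Space N → ℝ} (hf : Smooth f) (hg : Smooth g) : Smooth (f + g) :=
  ContDiff.add hf hg

lemma Smooth.sub {f g : Space N → ℝ} (hf : Smooth f) (hg : Smooth g) : Smooth (f - g) :=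
  ContDiff.sub hf hg

lemma Smooth.neg {f : Space N → ℝ} (hf : Smooth f) : Smooth (-f) := ContDiff.neg hf

lemma Smooth.smul {f : Space N → ℝ} (hf : Smooth f) (c : ℝ) : Smooth (c • f) :=
  ContDiff.const_smul c hf

lemma partialDeriv_add {f g : Space N → ℝ} (hf : Smooth f) (hg : Smooth g) (i : Fin N) :
    partialDeriv i (f + g) = partialDeriv i f + partialDeriv i g := by
  ext x
  simp [partialDeriv, fderiv_add (hf.differentiable x) (hg.differentiable x)]

lemma partialDeriv_neg (f : Space N → ℝ) (i : Fin N) :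
    partialDeriv i (-f) = -partialDeriv i f := by
  ext x
  simp [partialDeriv, fderiv_neg]

lemma partialDeriv_sub {f g : Space N → ℝ} (hf : Smooth f) (hg : Smooth g) (i : Fin N) :
    partialDeriv i (f - g) = partialDeriv i f - partialDeriv i g := by
  ext x
  simp [partialDeriv, fderiv_sub (hf.differentiable x) (hg.differentiable x)]

lemma partialDeriv_smul (c : ℝ) (f : Space N → ℝ) (i : Fin N) :
    partialDeriv i (c • f) = c • partialDeriv i f := by
  ext x
  simp [partialDeriv, fderiv_const_smul_field]

lemma partialDeriv_mul {f g : Space N → ℝ} (hf : Smooth f) (hg : Smooth g) (i : Fin N) :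
    partialDeriv i (f * g) = partialDeriv i f * g + f * partialDeriv i g := by
  ext x
  simp [partialDeriv, fderiv_mul (hf.differentiable x) (hg.differentiable x)]
  ring

lemma partialDeriv_const (c : ℝ) (i : Fin N) :
    partialDeriv i (fun _ : Space N => c) = 0 := by
  ext x
  simp [partialDeriv]

lemma partialDeriv_comm {f : Space N → ℝ} (hf : Smooth f) (i j : Fin N) :
    partialDeriv i (partialDeriv j f) = partialDeriv j (partialDeriv i f) := by
  ext x
  have h1 : ContDiff ℝ ∞ (fderiv ℝ f) := hf.fderiv_right (by simp)
  have h2 : DifferentiableAt ℝ (fderiv ℝ f) x := (h1.differentiable (by simp)) x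
  have key : ∀ a b : Fin N, partialDeriv a (partialDeriv b f) x =
      fderiv ℝ (fderiv ℝ f) x (EuclideanSpace.single a 1) (EuclideanSpace.single b 1) := by
    intro a b
    unfold partialDeriv
    rw [fderiv_clm_apply h2 (differentiableAt_const _)]
    simp
  rw [key, key]
  have := (hf.contDiffAt (x := x)).isSymmSndFDerivAt
    (by simpa using WithTop.coe_le_coe.2 (OrderTop.le_top (2 : ℕ∞)))
  exact this _ _

lemma D_partialDeriv {f : Space N → ℝ} (hf : Smooth f) (i : Fin N) (w : List (Fin N)) :
    D w (partialDeriv i f) = partialDeriv i (D w f) := by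
  induction w with
  | nil => rfl
  | cons j w ih => rw [D_cons, ih, D_cons, partialDeriv_comm (hf.word w)]

lemma D_cons' {f : Space N → ℝ} (hf : Smooth f) (i : Fin N) (w : List (Fin N)) :
    D (i :: w) f = D w (partialDeriv i f) := by
  rw [D_cons, D_partialDeriv hf]

/-- Mixed partial derivatives commute, so words up to permutation are multi-indices. This links
words with `multiDeriv`. -/
lemma D_perm {f : Space N → ℝ} (hf : Smooth f) {w w' : List (Fin N)} (h : w.Perm w') :
    D w f = D w' f := by
  induction h with
  | nil => rfl
  | cons i _ ih => rw [D_cons, D_cons, ih]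
  | swap i j l => rw [D_cons, D_cons, D_cons, D_cons, partialDeriv_comm (hf.word l)]
  | trans _ _ h1 h2 => rw [h1, h2]

lemma D_add {f g : Space N → ℝ} (hf : Smooth f) (hg : Smooth g) (w : List (Fin N)) :
    D w (f + g) = D w f + D w g := by
  induction w with
  | nil => rfl
  | cons i w ih => rw [D_cons, ih, partialDeriv_add (hf.word w) (hg.word w)]; rfl

lemma D_sub {f g : Space N → ℝ} (hf : Smooth f) (hg : Smooth g) (w : List (Fin N)) :
    D w (f - g) = D w f - D w g := by
  induction w with
  | nil => rfl
  | cons i w ih => rw [D_cons, ih, partialDeriv_sub (hf.word w) (hg.word w)]; rfl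

lemma D_neg (f : Space N → ℝ) (w : List (Fin N)) : D w (-f) = -D w f := by
  induction w with
  | nil => rfl
  | cons i w ih => rw [D_cons, ih, partialDeriv_neg]; rfl

lemma D_smul (c : ℝ) (f : Space N → ℝ) (w : List (Fin N)) : D w (c • f) = c • D w f := by
  induction w with
  | nil => rfl
  | cons i w ih => rw [D_cons, ih, partialDeriv_smul]; rfl

lemma D_zero (w : List (Fin N)) : D w (0 : Space N → ℝ) = 0 := by
  have := D_smul 0 (0 : Space N → ℝ) w
  simpa using this

lemma smooth_zero : Smooth (0 : Space N → ℝ) := contDiff_const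

lemma Smooth.sum {ι : Type*} {s : Finset ι} {f : ι → Space N → ℝ}
    (hf : ∀ i ∈ s, Smooth (f i)) : Smooth (∑ i ∈ s, f i) := by
  have := ContDiff.sum (𝕜 := ℝ) (n := ∞) hf
  convert this using 1
  ext x; simp

lemma D_sum {ι : Type*} (s : Finset ι) (f : ι → Space N → ℝ) (hf : ∀ i ∈ s, Smooth (f i))
    (w : List (Fin N)) : D w (∑ i ∈ s, f i) = ∑ i ∈ s, D w (f i) := by
  classical
  induction s using Finset.induction_on with
  | empty => simp [D_zero]
  | insert a s ha ih =>
    have h1 : ∀ i ∈ s, Smooth (f i) := fun i hi => hf i (Finset.mem_insert_of_mem hi)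
    rw [Finset.sum_insert ha, Finset.sum_insert ha,
      D_add (hf a (Finset.mem_insert_self _ _)) (Smooth.sum h1), ih h1]

lemma D_const (c : ℝ) {w : List (Fin N)} (hw : w ≠ []) :
    D w (fun _ : Space N => c) = 0 := by
  obtain ⟨w', i, rfl⟩ : ∃ w' i, w = w' ++ [i] := ⟨w.dropLast, w.getLast hw,
    (List.dropLast_append_getLast hw).symm⟩
  rw [D_append, D_singleton, partialDeriv_const, D_zero]

/-- The bound `‖f‖_{L²} ≤ S`. -/
def L2le (f : Space N → ℝ) (S : ℝ) : Prop := eLpNorm f 2 volume ≤ ENNReal.ofReal S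

lemma L2le.mono {f : Space N → ℝ} {S S' : ℝ} (h : L2le f S) (hS : S ≤ S') : L2le f S' :=
  h.trans (ENNReal.ofReal_le_ofReal hS)

lemma L2le.memLp {f : Space N → ℝ} {S : ℝ} (h : L2le f S) (hf : AEStronglyMeasurable f volume) :
    MemLp f 2 volume := ⟨hf, h.trans_lt ENNReal.ofReal_lt_top⟩

lemma L2le.add {f g : Space N → ℝ} {S T : ℝ} (hf : L2le f S) (hg : L2le g T)
    (mf : AEStronglyMeasurable f volume) (mg : AEStronglyMeasurable g volume)
    (hS : 0 ≤ S) (hT : 0 ≤ T) : L2le (f + g) (S + T) := by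
  unfold L2le at *
  rw [ENNReal.ofReal_add hS hT]
  exact (eLpNorm_add_le mf mg (by norm_num)).trans (add_le_add hf hg)

lemma L2le.neg {f : Space N → ℝ} {S : ℝ} (hf : L2le f S) : L2le (-f) S := by
  unfold L2le at *
  rwa [eLpNorm_neg]

lemma L2le.sub {f g : Space N → ℝ} {S T : ℝ} (hf : L2le f S) (hg : L2le g T)
    (mf : AEStronglyMeasurable f volume) (mg : AEStronglyMeasurable g volume)
    (hS : 0 ≤ S) (hT : 0 ≤ T) : L2le (f - g) (S + T) := by
  rw [sub_eq_add_neg]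
  exact hf.add hg.neg mf mg.neg hS hT

lemma l2le_zero {S : ℝ} : L2le (0 : Space N → ℝ) S := by simp [L2le]

lemma L2le.sum {ι : Type*} (s : Finset ι) {f : ι → Space N → ℝ} {S : ι → ℝ}
    (hf : ∀ i ∈ s, L2le (f i) (S i)) (mf : ∀ i ∈ s, AEStronglyMeasurable (f i) volume)
    (hS : ∀ i ∈ s, 0 ≤ S i) : L2le (∑ i ∈ s, f i) (∑ i ∈ s, S i) := by
  unfold L2le at *
  rw [ENNReal.ofReal_sum_of_nonneg hS]
  exact (eLpNorm_sum_le mf (by norm_num)).trans (Finset.sum_le_sum hf)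

lemma L2le.smul {f : Space N → ℝ} {S : ℝ} (hf : L2le f S) (c : ℝ) : L2le (c • f) (|c| * S) := by
  unfold L2le at *
  rw [eLpNorm_const_smul, ENNReal.ofReal_mul (abs_nonneg c)]
  gcongr
  rw [← ofReal_norm, Real.norm_eq_abs]

lemma L2le.of_abs_le {f g : Space N → ℝ} {S c : ℝ} (hg : L2le g S)
    (h : ∀ᵐ x, |f x| ≤ c * |g x|) (hc : 0 ≤ c) : L2le f (c * S) := by
  unfold L2le at *
  rw [ENNReal.ofReal_mul hc]
  refine (eLpNorm_le_mul_eLpNorm_of_ae_le_mul (c := c) ?_ 2).trans (by gcongr)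
  simpa using h

lemma L2le.bdd_mul {f g : Space N → ℝ} {S c : ℝ} (hg : L2le g S) (hf : ∀ x, |f x| ≤ c)
    (hc : 0 ≤ c) : L2le (f * g) (c * S) := by
  refine hg.of_abs_le (Eventually.of_forall fun x => ?_) hc
  rw [Pi.mul_apply, abs_mul]
  gcongr
  exact hf x

lemma L2le.mul_bdd {f g : Space N → ℝ} {S c : ℝ} (hg : L2le g S) (hf : ∀ x, |f x| ≤ c)
    (hc : 0 ≤ c) : L2le (g * f) (c * S) := by
  rw [mul_comm]; exact hg.bdd_mul hf hc

lemma MemLp.l2le {f : Space N → ℝ} (hf : MemLp f 2 volume) :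
    L2le f (eLpNorm f 2 volume).toReal := by
  unfold L2le
  rw [ENNReal.ofReal_toReal hf.2.ne]

lemma MemLp.integral_sq_eq {f : Space N → ℝ} (hf : MemLp f 2 volume) :
    ∫ x, f x ^ 2 = (eLpNorm f 2 volume).toReal ^ 2 := by
  have h := hf.eLpNorm_eq_integral_rpow_norm (by norm_num) (by norm_num)
  rw [h, ENNReal.toReal_ofReal (by positivity)]
  simp only [ENNReal.toReal_ofNat, Real.norm_eq_abs]
  rw [← Real.rpow_natCast, ← Real.rpow_mul (by positivity)]
  norm_num

lemma L2le.integral_sq_le {f : Space N → ℝ} {S : ℝ} (hS : 0 ≤ S) (h : L2le f S)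
    (hf : AEStronglyMeasurable f volume) : ∫ x, f x ^ 2 ≤ S ^ 2 := by
  rw [MemLp.integral_sq_eq (h.memLp hf)]
  gcongr
  exact ENNReal.toReal_le_of_le_ofReal hS h

lemma L2le_of_integral_sq_le {f : Space N → ℝ} {S : ℝ} (hS : 0 ≤ S) (hf : MemLp f 2 volume)
    (h : ∫ x, f x ^ 2 ≤ S ^ 2) : L2le f S := by
  rw [MemLp.integral_sq_eq hf] at h
  exact (MemLp.l2le hf).mono (abs_le.1 (abs_le_of_sq_le_sq h hS)).2

lemma integral_mul_le_of_memLp {f g : Space N → ℝ} (hf : MemLp f 2 volume) (hg : MemLp g 2 volume) :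
    |∫ x, f x * g x| ≤ (eLpNorm f 2 volume).toReal * (eLpNorm g 2 volume).toReal := by
  have h := integral_mul_norm_le_Lp_mul_Lq (μ := (volume : Measure (Space N)))
    (f := f) (g := g) (p := 2) (q := 2) Real.HolderConjugate.two_two (by simpa using hf)
    (by simpa using hg)
  have e : ∀ f : Space N → ℝ, MemLp f 2 volume →
      (∫ a, ‖f a‖ ^ (2:ℝ)) ^ (1 / (2:ℝ)) = (eLpNorm f 2 volume).toReal := by
    intro f hf
    have : ∫ a, ‖f a‖ ^ (2:ℝ) = ∫ a, f a ^ 2 := by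
      congr 1; ext a; rw [Real.rpow_two, Real.norm_eq_abs, sq_abs]
    rw [this, MemLp.integral_sq_eq hf, ← Real.sqrt_eq_rpow, Real.sqrt_sq ENNReal.toReal_nonneg]
  rw [e f hf, e g hg] at h
  refine le_trans ?_ h
  rw [← Real.norm_eq_abs]
  refine (norm_integral_le_integral_norm _).trans (le_of_eq ?_)
  simp

lemma L2le.abs_integral_mul_le {f g : Space N → ℝ} {S T : ℝ} (hf : L2le f S) (hg : L2le g T)
    (mf : AEStronglyMeasurable f volume) (mg : AEStronglyMeasurable g volume)
    (hS : 0 ≤ S) (hT : 0 ≤ T) : |∫ x, f x * g x| ≤ S * T := by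
  refine (integral_mul_le_of_memLp (hf.memLp mf) (hg.memLp mg)).trans ?_
  gcongr
  · exact ENNReal.toReal_le_of_le_ofReal hS hf
  · exact ENNReal.toReal_le_of_le_ofReal hT hg

/-- Smooth functions with bounded derivatives of all orders, whose derivatives of order at
least one are square integrable. -/
structure Nice (f : Space N → ℝ) : Prop where
  smooth : Smooth f
  bdd : ∀ w, ∃ C, ∀ x, |D w f x| ≤ C
  memLp : ∀ w, w ≠ [] → MemLp (D w f) 2 volume

/-- Smooth functions whose derivatives of all orders are bounded and square integrable. -/
structure Nice2 (f : Space N → ℝ) : Prop extends Nice f where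
  memLp0 : MemLp f 2 volume

lemma Nice2.memLp_word {f : Space N → ℝ} (hf : Nice2 f) (w : List (Fin N)) :
    MemLp (D w f) 2 volume := by
  by_cases hw : w = []
  · subst hw; exact hf.memLp0
  · exact hf.memLp w hw

lemma Smooth.aesm {f : Space N → ℝ} (hf : Smooth f) : AEStronglyMeasurable f volume :=
  hf.continuous.aestronglyMeasurable

lemma Nice.pd {f : Space N → ℝ} (hf : Nice f) (i : Fin N) :
    Nice2 (partialDeriv i f) where
  smooth := hf.smooth.pd i
  bdd w := by rw [← D_cons' hf.smooth]; exact hf.bdd _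
  memLp w _ := by rw [← D_cons' hf.smooth]; exact hf.memLp _ (by simp)
  memLp0 := hf.memLp [i] (by simp)

lemma Nice2.word {f : Space N → ℝ} (hf : Nice2 f) (w : List (Fin N)) : Nice2 (D w f) := by
  induction w with
  | nil => exact hf
  | cons i w ih => exact ih.toNice.pd i

lemma Nice.word2 {f : Space N → ℝ} (hf : Nice f) {w : List (Fin N)} (hw : w ≠ []) :
    Nice2 (D w f) := by
  cases w with
  | nil => exact absurd rfl hw
  | cons i w => rw [D_cons' hf.smooth]; exact (hf.pd i).word w

lemma Nice.word {f : Space N → ℝ} (hf : Nice f) (w : List (Fin N)) : Nice (D w f) := by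
  by_cases hw : w = []
  · subst hw; exact hf
  · exact (hf.word2 hw).toNice

lemma Nice.add {f g : Space N → ℝ} (hf : Nice f) (hg : Nice g) : Nice (f + g) where
  smooth := hf.smooth.add hg.smooth
  bdd w := by
    obtain ⟨a, ha⟩ := hf.bdd w
    obtain ⟨b, hb⟩ := hg.bdd w
    refine ⟨a + b, fun x => ?_⟩
    rw [D_add hf.smooth hg.smooth]
    exact (abs_add_le _ _).trans (add_le_add (ha x) (hb x))
  memLp w hw := by rw [D_add hf.smooth hg.smooth]; exact (hf.memLp w hw).add (hg.memLp w hw)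

lemma Nice.smul {f : Space N → ℝ} (hf : Nice f) (c : ℝ) : Nice (c • f) where
  smooth := hf.smooth.smul c
  bdd w := by
    obtain ⟨a, ha⟩ := hf.bdd w
    refine ⟨|c| * a, fun x => ?_⟩
    rw [D_smul, Pi.smul_apply, smul_eq_mul, abs_mul]
    gcongr
    exact ha x
  memLp w hw := by rw [D_smul]; exact (hf.memLp w hw).const_smul c

lemma Nice.neg {f : Space N → ℝ} (hf : Nice f) : Nice (-f) := by
  simpa using hf.smul (-1)

lemma Nice.sub {f g : Space N → ℝ} (hf : Nice f) (hg : Nice g) : Nice (f - g) := by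
  rw [sub_eq_add_neg]; exact hf.add hg.neg

lemma Nice2.add {f g : Space N → ℝ} (hf : Nice2 f) (hg : Nice2 g) : Nice2 (f + g) :=
  ⟨hf.toNice.add hg.toNice, hf.memLp0.add hg.memLp0⟩

lemma Nice2.smul {f : Space N → ℝ} (hf : Nice2 f) (c : ℝ) : Nice2 (c • f) :=
  ⟨hf.toNice.smul c, hf.memLp0.const_smul c⟩

lemma Nice2.neg {f : Space N → ℝ} (hf : Nice2 f) : Nice2 (-f) :=
  ⟨hf.toNice.neg, hf.memLp0.neg⟩

lemma Nice2.sub {f g : Space N → ℝ} (hf : Nice2 f) (hg : Nice2 g) : Nice2 (f - g) :=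
  ⟨hf.toNice.sub hg.toNice, hf.memLp0.sub hg.memLp0⟩

lemma nice_const (c : ℝ) : Nice (fun _ : Space N => c) where
  smooth := contDiff_const
  bdd w := by
    by_cases hw : w = []
    · subst hw; exact ⟨|c|, fun x => le_rfl⟩
    · rw [D_const c hw]; exact ⟨0, fun x => by simp⟩
  memLp w hw := by rw [D_const c hw]; exact MemLp.zero

lemma nice2_zero : Nice2 (0 : Space N → ℝ) := ⟨nice_const 0, MemLp.zero⟩

lemma Nice2.sum {ι : Type*} (s : Finset ι) {f : ι → Space N → ℝ} (hf : ∀ i ∈ s, Nice2 (f i)) :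
    Nice2 (∑ i ∈ s, f i) := by
  classical
  induction s using Finset.induction_on with
  | empty => simpa using nice2_zero
  | insert a s ha ih =>
    rw [Finset.sum_insert ha]
    exact (hf a (Finset.mem_insert_self _ _)).add
      (ih fun i hi => hf i (Finset.mem_insert_of_mem hi))

lemma D_concat_mul {f g : Space N → ℝ} (hf : Smooth f) (hg : Smooth g) (i : Fin N)
    (w : List (Fin N)) :
    D (i :: w) (f * g) = D w (partialDeriv i f * g) + D w (f * partialDeriv i g) := by
  rw [D_cons' (hf.mul hg), partialDeriv_mul hf hg,
    D_add ((hf.pd i).mul hg) (hf.mul (hg.pd i))]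

lemma bdd_D_mul {f g : Space N → ℝ} (hf : Nice f) (hg : Nice g) (w : List (Fin N)) :
    ∃ C, ∀ x, |D w (f * g) x| ≤ C := by
  induction w generalizing f g with
  | nil =>
    obtain ⟨a, ha⟩ := hf.bdd []
    obtain ⟨b, hb⟩ := hg.bdd []
    refine ⟨a * b, fun x => ?_⟩
    rw [D_nil, Pi.mul_apply, abs_mul]
    have := (abs_nonneg _).trans (ha x)
    gcongr
    exacts [ha x, hb x]
  | cons i w ih =>
    rw [D_concat_mul hf.smooth hg.smooth]
    obtain ⟨a, ha⟩ := ih (hf.pd i).toNice hg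
    obtain ⟨b, hb⟩ := ih hf (hg.pd i).toNice
    exact ⟨a + b, fun x => (abs_add_le _ _).trans (add_le_add (ha x) (hb x))⟩

lemma memLp_D_mul {f g : Space N → ℝ} (hf : Nice2 f) (hg : Nice g) (w : List (Fin N)) :
    MemLp (D w (f * g)) 2 volume := by
  induction w generalizing f g with
  | nil =>
    obtain ⟨b, hb⟩ := hg.bdd []
    exact ((MemLp.l2le hf.memLp0).mul_bdd hb ((abs_nonneg _).trans (hb 0))).memLp
      (hf.smooth.mul hg.smooth).aesm
  | cons i w ih =>
    rw [D_concat_mul hf.smooth hg.smooth]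
    exact (ih (hf.toNice.pd i) hg).add (ih hf (hg.pd i).toNice)

lemma Nice2.mul {f g : Space N → ℝ} (hf : Nice2 f) (hg : Nice g) : Nice2 (f * g) where
  smooth := hf.smooth.mul hg.smooth
  bdd := bdd_D_mul hf.toNice hg
  memLp w _ := memLp_D_mul hf hg w
  memLp0 := memLp_D_mul hf hg []

lemma Nice.mul2 {f g : Space N → ℝ} (hf : Nice f) (hg : Nice2 g) : Nice2 (f * g) := by
  rw [mul_comm]; exact hg.mul hf

/-- Square integrability makes all three products integrable, which replaces compact support: there
is no boundary term. -/
lemma Nice2.integral_partialDeriv_mul {f g : Space N → ℝ} (hf : Nice2 f) (hg : Nice2 g)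
    (i : Fin N) : ∫ x, partialDeriv i f x * g x = -∫ x, f x * partialDeriv i g x := by
  have h := integral_mul_fderiv_eq_neg_fderiv_mul_of_integrable (μ := (volume : Measure (Space N)))
    (f := f) (g := g) (v := EuclideanSpace.single i 1)
    ((hf.toNice.pd i).memLp0.integrable_mul hg.memLp0)
    (hf.memLp0.integrable_mul (hg.toNice.pd i).memLp0)
    (hf.memLp0.integrable_mul hg.memLp0)
    (fun x _ => hf.smooth.differentiable x) (fun x _ => hg.smooth.differentiable x)
  simp only [partialDeriv]
  rw [h]; simp

end Calculus

/-! ### Gagliardo-Nirenberg interpolation and Moser product estimates. -/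

section GagliardoNirenberg

variable {N : ℕ}

/-- The exponent `2q / j`, equal to `∞` for `j = 0`. -/
def gnExp (q j : ℕ) : ℝ≥0∞ := (2 * q : ℝ≥0∞) / j

lemma gnExp_inv {q : ℕ} (hq : 1 ≤ q) (j : ℕ) : (gnExp q j)⁻¹ = j / (2 * q : ℝ≥0∞) := by
  have : (2 * q : ℝ≥0∞) ≠ 0 := by
    have : q ≠ 0 := by omega
    simp [this]
  unfold gnExp
  rw [ENNReal.inv_div (Or.inl (by finiteness)) (Or.inr this)]

lemma gnExp_zero {q : ℕ} (hq : 1 ≤ q) : gnExp q 0 = (⊤ : ℝ≥0∞) := by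
  have := gnExp_inv hq 0
  simpa using this

lemma gnExp_self {q : ℕ} (hq : 1 ≤ q) : gnExp q q = 2 := by
  unfold gnExp
  exact ENNReal.mul_div_cancel_right (by simp; omega) (by finiteness)

lemma gnExp_two_mul {q : ℕ} (hq : 1 ≤ q) : gnExp q (2 * q) = 1 := by
  unfold gnExp
  push_cast
  refine ENNReal.div_self ?_ (by finiteness)
  have : q ≠ 0 := by omega
  simp [this]

/-- The reciprocal exponents j/(2q) are additive in j, so Hölder's inequality becomes the addition
of derivative orders. -/
lemma gnExp_holder {q : ℕ} (hq : 1 ≤ q) (a b c : ℕ) (h : a + b = c) :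
    ENNReal.HolderTriple (gnExp q a) (gnExp q b) (gnExp q c) := by
  constructor
  rw [gnExp_inv hq, gnExp_inv hq, gnExp_inv hq, ← h, ← ENNReal.add_div]
  push_cast
  rfl

lemma gnExp_eq_ofReal {q j : ℕ} (hj : 1 ≤ j) :
    gnExp q j = ENNReal.ofReal (2 * q / j) := by
  unfold gnExp
  rw [ENNReal.ofReal_div_of_pos (by exact_mod_cast hj), ENNReal.ofReal_natCast,
    ENNReal.ofReal_mul (by norm_num), ENNReal.ofReal_natCast]
  simp

lemma eLpNorm_mul_le_gn {q a b c : ℕ} (hq : 1 ≤ q) (h : a + b = c) {f g : Space N → ℝ}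
    (hf : AEStronglyMeasurable f volume) (hg : AEStronglyMeasurable g volume) :
    eLpNorm (f * g) (gnExp q c) volume ≤
      eLpNorm f (gnExp q a) volume * eLpNorm g (gnExp q b) volume := by
  have := gnExp_holder hq a b c h
  have := eLpNorm_smul_le_mul_eLpNorm (p := gnExp q a) (q := gnExp q b) (r := gnExp q c)
    (μ := (volume : Measure (Space N))) hg hf
  simpa using this

/-- This makes |k|^(r-2) k differentiable also at the zeros of k, so that it can be integrated by
parts for non-integer exponents. -/
lemma hasDerivAt_abs_rpow_mul_self (x : ℝ) {t : ℝ} (ht : 0 < t) :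
    HasDerivAt (fun y : ℝ => |y| ^ t * y) ((t + 1) * |x| ^ t) x := by
  rcases eq_or_ne x 0 with rfl | hx
  · rw [hasDerivAt_iff_tendsto_slope]
    have h0 : (t + 1) * |(0 : ℝ)| ^ t = 0 := by rw [abs_zero, Real.zero_rpow ht.ne', mul_zero]
    rw [h0]
    have h1 : Tendsto (fun y : ℝ => |y| ^ t) (𝓝[≠] 0) (𝓝 0) := by
      have : ContinuousAt (fun y : ℝ => |y| ^ t) 0 :=
        (continuous_abs.continuousAt).rpow_const (Or.inr ht.le)
      have h := this.tendsto
      simp only [abs_zero, Real.zero_rpow ht.ne'] at h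
      exact h.mono_left nhdsWithin_le_nhds
    refine h1.congr' ?_
    filter_upwards [self_mem_nhdsWithin] with y hy
    have hy' : y ≠ 0 := hy
    simp only [slope_def_field, mul_zero, sub_zero]
    field_simp
  -- Away from zero the function equals |y|^(t+2) y⁻¹, and the exponent t + 2 exceeds 1.
  · have h := (hasDerivAt_abs_rpow x (p := t + 2) (by linarith))
    have habs : 0 < |x| := abs_pos.2 hx
    have h2 : HasDerivAt (fun y : ℝ => |y| ^ (t + 2) * y⁻¹)
        ((t + 2) * |x| ^ (t + 2 - 2) * x * x⁻¹ + |x| ^ (t + 2) * (-(x ^ 2)⁻¹)) x :=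
      h.mul (hasDerivAt_inv hx)
    have e1 : ∀ y : ℝ, y ≠ 0 → |y| ^ (t + 2) * y⁻¹ = |y| ^ t * y := by
      intro y hy
      rw [Real.rpow_add (abs_pos.2 hy), Real.rpow_two, sq_abs]
      field_simp
    have h3 := h2.congr_of_eventuallyEq (f₁ := fun y : ℝ => |y| ^ t * y) (by
      filter_upwards [isOpen_ne.mem_nhds hx] with y hy
      exact (e1 y hy).symm)
    have e2 : (t + 2) * |x| ^ (t + 2 - 2) * x * x⁻¹ + |x| ^ (t + 2) * -(x ^ 2)⁻¹ =
        (t + 1) * |x| ^ t := by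
      rw [Real.rpow_add habs, Real.rpow_two, sq_abs, add_sub_cancel_right]
      field_simp
      ring
    rwa [e2] at h3

/-- The surplus power t − b is spent on the uniform bound C; only the power b needs to be
integrable. -/
lemma abs_rpow_le {a b C t : ℝ} (ha : |a| ≤ C) (hb : 0 ≤ b) (ht : b ≤ t) :
    |a| ^ t ≤ C ^ (t - b) * |a| ^ b := by
  rcases eq_or_lt_of_le (abs_nonneg a) with h | h
  · rw [← h]
    rcases eq_or_lt_of_le (hb.trans ht) with h' | h'
    · have : b = 0 := le_antisymm (by linarith) hb
      subst this; rw [← h']; simp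
    · rw [Real.zero_rpow h'.ne']
      have : 0 ≤ C := h ▸ ha
      positivity
  · have : |a| ^ t = |a| ^ (t - b) * |a| ^ b := by rw [← Real.rpow_add h]; ring_nf
    rw [this]
    gcongr

lemma memLp_of_bdd_of_two_le {h : Space N → ℝ} (hh : MemLp h 2 volume) {C : ℝ}
    (hC : ∀ x, |h x| ≤ C) {r : ℝ} (hr : 2 ≤ r) : MemLp h (ENNReal.ofReal r) volume := by
  rw [← integrable_norm_rpow_iff hh.1 (by simp; linarith) ENNReal.ofReal_ne_top,
    ENNReal.toReal_ofReal (by linarith)]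
  have h2 : Integrable (fun x => C ^ (r - 2) * h x ^ 2) := (hh.integrable_sq).const_mul _
  refine h2.mono' (hh.1.norm.aemeasurable.pow_const r).aestronglyMeasurable ?_
  filter_upwards with x
  rw [Real.norm_of_nonneg (by positivity), Real.norm_eq_abs, ← sq_abs (h x), ← Real.rpow_two]
  exact abs_rpow_le (hC x) (by norm_num) hr

lemma Nice.memLp_gn {f : Space N → ℝ} (hf : Nice f) {q : ℕ} (hq : 1 ≤ q) {w : List (Fin N)}
    (hw : w.length ≤ q) : MemLp (D w f) (gnExp q w.length) volume := by
  obtain ⟨C, hC⟩ := hf.bdd w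
  by_cases h0 : w = []
  · subst h0
    rw [List.length_nil, gnExp_zero hq]
    exact memLp_top_of_bound hf.smooth.aesm C (Eventually.of_forall hC)
  · have hl : 1 ≤ w.length := List.length_pos_iff.2 h0
    rw [gnExp_eq_ofReal hl]
    refine memLp_of_bdd_of_two_le (hf.memLp w h0) hC ?_
    rw [le_div_iff₀ (by exact_mod_cast hl)]
    have : (w.length : ℝ) ≤ q := by exact_mod_cast hw
    linarith

/-- Integration by parts behind the Gagliardo-Nirenberg inequality. -/
lemma integral_abs_rpow_partialDeriv {g : Space N → ℝ} (hg : Nice g) (i : Fin N) {r : ℝ}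
    (hr : 2 < r) (h : Nice2 g ∨ 4 ≤ r) :
    ∫ x, |partialDeriv i g x| ^ r =
      -∫ x, (r - 1) * |partialDeriv i g x| ^ (r - 2) * partialDeriv i (partialDeriv i g) x * g x
      ∧ Integrable (fun x => |partialDeriv i g x| ^ (r - 2) *
        partialDeriv i (partialDeriv i g) x * g x) := by
  set k := partialDeriv i g with hk
  have hkn : Nice2 k := hg.pd i
  obtain ⟨C, hC⟩ := hkn.bdd []
  obtain ⟨B, hB⟩ := hg.bdd []
  simp only [D_nil] at hC hB
  have hB0 : 0 ≤ B := (abs_nonneg _).trans (hB 0)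
  have hC0 : 0 ≤ C := (abs_nonneg _).trans (hC 0)
  set ψ : Space N → ℝ := fun x => |k x| ^ (r - 2) * k x with hψ
  have hd : ∀ x, HasFDerivAt ψ (((r - 2 + 1) * |k x| ^ (r - 2)) • fderiv ℝ k x) x := fun x =>
    (hasDerivAt_abs_rpow_mul_self (k x) (by linarith)).comp_hasFDerivAt x
      (hkn.smooth.differentiable x).hasFDerivAt
  have hfd : ∀ x, fderiv ℝ ψ x (EuclideanSpace.single i 1) =
      (r - 1) * |k x| ^ (r - 2) * partialDeriv i k x := by
    intro x
    rw [(hd x).fderiv]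
    simp [partialDeriv]
    left; left; ring
  have hcont : Continuous fun x => |k x| ^ (r - 2) :=
    hkn.smooth.continuous.abs.rpow_const fun x => Or.inr (by linarith)
  have hkc := hkn.smooth.continuous
  have hgc := hg.smooth.continuous
  have hk2 := (hkn.toNice.pd i)
  have hk2c := hk2.smooth.continuous
  have i1 : Integrable (fun x => ψ x * partialDeriv i g x) := by
    refine ((hkn.memLp0.integrable_sq).const_mul (C ^ (r - 2))).mono'
      ((hcont.mul hkc).mul hkc).aestronglyMeasurable (Eventually.of_forall fun x => ?_)
    rw [hψ, Real.norm_eq_abs, abs_mul, abs_mul, abs_of_nonneg (by positivity), mul_assoc,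
      ← sq_abs (k x), sq]
    gcongr
    exact hC x
  have i2 : Integrable (fun x => ψ x * g x) := by
    -- Either g is square integrable and all powers |k|^(r-2) go to the uniform bound, or g is
    -- merely bounded and r ≥ 4 leaves one more factor k, so that the product of two L² functions
    -- remains.
    rcases h with h | h
    · refine (((hkn.memLp0.integrable_mul h.memLp0).norm).const_mul (C ^ (r - 2))).mono'
        ((hcont.mul hkc).mul hgc).aestronglyMeasurable (Eventually.of_forall fun x => ?_)
      rw [hψ, Real.norm_eq_abs, abs_mul, abs_mul, abs_of_nonneg (by positivity), mul_assoc,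
        Pi.mul_apply, Real.norm_eq_abs, abs_mul]
      gcongr
      exact hC x
    · refine ((hkn.memLp0.integrable_sq).const_mul (C ^ (r - 2 - 1) * B)).mono'
        ((hcont.mul hkc).mul hgc).aestronglyMeasurable (Eventually.of_forall fun x => ?_)
      rw [hψ, Real.norm_eq_abs, abs_mul, abs_mul, abs_of_nonneg (by positivity)]
      have h1 := abs_rpow_le (hC x) zero_le_one (show (1 : ℝ) ≤ r - 2 by linarith)
      rw [Real.rpow_one] at h1
      calc |k x| ^ (r - 2) * |k x| * |g x| ≤ C ^ (r - 2 - 1) * |k x| * |k x| * B := by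
            gcongr; exact hB x
        _ = C ^ (r - 2 - 1) * B * k x ^ 2 := by rw [← sq_abs (k x)]; ring
  have i3 : Integrable (fun x => |k x| ^ (r - 2) * partialDeriv i k x * g x) := by
    rcases h with h | h
    · refine (((hk2.memLp0.integrable_mul h.memLp0).norm).const_mul (C ^ (r - 2))).mono'
        ((hcont.mul hk2c).mul hgc).aestronglyMeasurable (Eventually.of_forall fun x => ?_)
      rw [Real.norm_eq_abs, abs_mul, abs_mul, abs_of_nonneg (by positivity), mul_assoc,
        Pi.mul_apply, Real.norm_eq_abs, abs_mul]
      gcongr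
      exact hC x
    · refine (((hkn.memLp0.integrable_mul hk2.memLp0).norm).const_mul
        (C ^ (r - 2 - 1) * B)).mono'
        ((hcont.mul hk2c).mul hgc).aestronglyMeasurable (Eventually.of_forall fun x => ?_)
      rw [Real.norm_eq_abs, abs_mul, abs_mul, abs_of_nonneg (by positivity)]
      have h1 := abs_rpow_le (hC x) zero_le_one (show (1 : ℝ) ≤ r - 2 by linarith)
      rw [Real.rpow_one] at h1
      calc |k x| ^ (r - 2) * |partialDeriv i k x| * |g x|
          ≤ C ^ (r - 2 - 1) * |k x| * |partialDeriv i k x| * B := by gcongr; exact hB x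
        _ = C ^ (r - 2 - 1) * B * ‖(k * partialDeriv i k) x‖ := by
            rw [Pi.mul_apply, Real.norm_eq_abs, abs_mul]; ring
  refine ⟨?_, i3⟩
  have hp := integral_mul_fderiv_eq_neg_fderiv_mul_of_integrable
    (μ := (volume : Measure (Space N))) (f := ψ) (g := g) (v := EuclideanSpace.single i 1)
    (by simp only [hfd]; convert i3.const_mul (r - 1) using 1; ext x; ring) i1 i2
    (fun x _ => (hd x).differentiableAt) (fun x _ => hg.smooth.differentiable x)
  simp only [hfd] at hp
  rw [← hp]
  congr 1
  ext x
  have hx : fderiv ℝ g x (EuclideanSpace.single i 1) = k x := rfl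
  rw [hx]
  simp only [hψ]
  rcases eq_or_lt_of_le (abs_nonneg (k x)) with h0 | h0
  · have : k x = 0 := abs_eq_zero.1 h0.symm
    rw [this, abs_zero, Real.zero_rpow (by linarith)]; simp
  · rw [mul_assoc, ← sq, ← sq_abs (k x), ← Real.rpow_two, ← Real.rpow_add h0]
    ring_nf

/-- One step of the Gagliardo-Nirenberg inequality. -/
lemma gn_step {g : Space N → ℝ} (hg : Nice g) (i : Fin N) {q j : ℕ} (hj : j + 2 ≤ q)
    (h : Nice2 g ∨ j = 0) (hgm : MemLp g (gnExp q j) volume) :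
    (eLpNorm (partialDeriv i g) (gnExp q (j + 1)) volume).toReal ^ 2 ≤
      2 * q * ((eLpNorm g (gnExp q j) volume).toReal *
        (eLpNorm (partialDeriv i (partialDeriv i g)) (gnExp q (j + 2)) volume).toReal) := by
  set k := partialDeriv i g with hk
  have hkn : Nice2 k := hg.pd i
  have hk2 := (hkn.toNice.pd i)
  set r : ℝ := 2 * q / (j + 1 : ℕ) with hr
  have hj0 : (0 : ℝ) < (j + 1 : ℕ) := by positivity
  have hr2 : 2 < r := by
    rw [hr, lt_div_iff₀ hj0]
    have : ((j + 2 : ℕ) : ℝ) ≤ q := by exact_mod_cast hj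
    push_cast at *; linarith
  have hr4 : Nice2 g ∨ 4 ≤ r := by
    -- For j = 0 the function g is only known to be bounded; then r = 2q ≥ 4 because 2 ≤ q.
    rcases h with h | h
    · exact Or.inl h
    · right
      have : ((j + 2 : ℕ) : ℝ) ≤ q := by exact_mod_cast hj
      rw [hr, h]; push_cast; rw [h] at this; push_cast at this; linarith
  obtain ⟨hI, hint⟩ := integral_abs_rpow_partialDeriv hg i hr2 hr4
  rw [← hk] at hI hint
  have hek : gnExp q (j + 1) = ENNReal.ofReal r := gnExp_eq_ofReal (by omega)
  obtain ⟨C, hC⟩ := hkn.bdd []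
  obtain ⟨C2, hC2⟩ := hk2.bdd []
  have hkm : MemLp k (gnExp q (j + 1)) volume := by
    rw [hek]; exact memLp_of_bdd_of_two_le hkn.memLp0 hC hr2.le
  have hk2m : MemLp (partialDeriv i k) (gnExp q (j + 2)) volume := by
    rw [gnExp_eq_ofReal (by omega)]
    refine memLp_of_bdd_of_two_le hk2.memLp0 hC2 ?_
    rw [le_div_iff₀ (by positivity)]
    have : ((j + 2 : ℕ) : ℝ) ≤ q := by exact_mod_cast hj
    linarith
  set n := (eLpNorm k (gnExp q (j + 1)) volume).toReal with hn
  set a := (eLpNorm g (gnExp q j) volume).toReal with ha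
  set b := (eLpNorm (partialDeriv i k) (gnExp q (j + 2)) volume).toReal with hb
  have hn0 : 0 ≤ n := ENNReal.toReal_nonneg
  have ha0 : 0 ≤ a := ENNReal.toReal_nonneg
  have hb0 : 0 ≤ b := ENNReal.toReal_nonneg
  have e1 : ∫ x, |k x| ^ r = n ^ r := by
    have h := hkm.eLpNorm_eq_integral_rpow_norm (by rw [hek]; simp; linarith)
      (by rw [hek]; exact ENNReal.ofReal_ne_top)
    rw [hek, ENNReal.toReal_ofReal (by linarith)] at h
    rw [hn, hek, h, ENNReal.toReal_ofReal (by positivity), ← Real.rpow_mul (by positivity),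
      inv_mul_cancel₀ (by linarith), Real.rpow_one]
    rfl
  -- Hölder
  have hq0 : (0 : ℝ) < q := by
    have : 0 < q := by omega
    exact_mod_cast this
  -- The power |k|^(r-2) is given the index 2(q − (j+1)), since (r − 2) times its exponent is
  -- 2q/(j+1). The indices 2(q − (j+1)), j + 2 and j add up to 2q, the index of L¹.
  have hmid : eLpNorm (fun x => |k x| ^ (r - 2)) (gnExp q (2 * (q - (j + 1)))) volume =
      eLpNorm k (gnExp q (j + 1)) volume ^ (r - 2) := by
    have h := eLpNorm_norm_rpow (μ := (volume : Measure (Space N))) k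
      (p := gnExp q (2 * (q - (j + 1)))) (q := r - 2) (by linarith)
    simp only [Real.norm_eq_abs] at h
    rw [h]
    congr 2
    rw [gnExp_eq_ofReal (by omega), hek, ← ENNReal.ofReal_mul (by positivity)]
    congr 1
    rw [hr]
    have h1 : ((2 * (q - (j + 1)) : ℕ) : ℝ) = 2 * (q - (j + 1 : ℕ)) := by
      rw [Nat.cast_mul, Nat.cast_sub (by omega)]; norm_num
    rw [h1]
    have h2 : (q : ℝ) - (j + 1 : ℕ) ≠ 0 := by
      have : ((j + 2 : ℕ) : ℝ) ≤ q := by exact_mod_cast hj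
      push_cast at *; intro h; linarith
    field_simp
  have hcont : Continuous fun x => |k x| ^ (r - 2) :=
    hkn.smooth.continuous.abs.rpow_const fun x => Or.inr (by linarith)
  have hold : eLpNorm ((fun x => |k x| ^ (r - 2)) * partialDeriv i k * g) 1 volume ≤
      eLpNorm k (gnExp q (j + 1)) volume ^ (r - 2) *
        eLpNorm (partialDeriv i k) (gnExp q (j + 2)) volume * eLpNorm g (gnExp q j) volume := by
    rw [← gnExp_two_mul (q := q) (by omega), ← hmid]
    refine (eLpNorm_mul_le_gn (by omega) (a := 2 * q - j) (b := j) (by omega)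
      (hcont.mul hk2.smooth.continuous).aestronglyMeasurable hg.smooth.aesm).trans ?_
    gcongr
    exact eLpNorm_mul_le_gn (by omega) (by omega) hcont.aestronglyMeasurable hk2.smooth.aesm
  have hI1 : |∫ x, |k x| ^ (r - 2) * partialDeriv i k x * g x| ≤ n ^ (r - 2) * b * a := by
    have h1 : (eLpNorm ((fun x => |k x| ^ (r - 2)) * partialDeriv i k * g) 1 volume).toReal ≤
        n ^ (r - 2) * b * a := by
      rw [hn, ha, hb, ENNReal.toReal_rpow, ← ENNReal.toReal_mul, ← ENNReal.toReal_mul]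
      refine ENNReal.toReal_mono ?_ hold
      have := hkm.2.ne; have := hk2m.2.ne; have := hgm.2.ne
      have h3 : eLpNorm k (gnExp q (j + 1)) volume ^ (r - 2) ≠ ⊤ :=
        ENNReal.rpow_ne_top_of_nonneg (by linarith [hr2]) hkm.2.ne
      finiteness
    refine le_trans ?_ h1
    rw [eLpNorm_one_eq_lintegral_enorm, ← Real.norm_eq_abs]
    refine (norm_integral_le_integral_norm _).trans (le_of_eq ?_)
    rw [integral_norm_eq_lintegral_enorm hint.1]
    rfl
  have hmain : n ^ r ≤ (r - 1) * (n ^ (r - 2) * b * a) := by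
    rw [← e1, hI]
    have : ∀ x, (r - 1) * |k x| ^ (r - 2) * partialDeriv i k x * g x =
      (r - 1) * (|k x| ^ (r - 2) * partialDeriv i k x * g x) := fun x => by ring
    simp only [this]
    rw [integral_const_mul, ← mul_neg]
    exact mul_le_mul_of_nonneg_left ((neg_le_abs _).trans hI1) (by linarith)
  -- The constant must not depend on j, since the log-convexity lemma uses one constant for all
  -- levels.
  have hr1 : r - 1 ≤ 2 * q := by
    have : r ≤ 2 * q := by
      rw [hr]; apply div_le_self (by positivity); push_cast; linarith [(Nat.cast_nonneg j : (0:ℝ) ≤ j)]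
    linarith
  -- The conclusion follows on dividing by n^(r-2), which requires n > 0.
  rcases eq_or_lt_of_le hn0 with h0 | h0
  · calc n ^ 2 = 0 := by rw [← h0]; ring
      _ ≤ _ := by positivity
  · have hs : n ^ r = n ^ (r - 2) * n ^ 2 := by
      rw [← Real.rpow_two, ← Real.rpow_add h0]; ring_nf
    rw [hs] at hmain
    have hp : 0 < n ^ (r - 2) := by positivity
    have : n ^ 2 ≤ (r - 1) * (b * a) := by
      refine le_of_mul_le_mul_left ?_ hp
      calc n ^ (r - 2) * n ^ 2 ≤ _ := hmain
        _ = _ := by ring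
    calc n ^ 2 ≤ (r - 1) * (b * a) := this
      _ ≤ 2 * q * (b * a) := by gcongr
      _ = _ := by ring

/-- Log-convexity puts the value at j below the chord between 0 and j + 1. In the induction the
hypothesis is raised to the power j + 1, the previous case is inserted, and the surplus factor `a (j
+ 1) ^ j` is cancelled; if it vanishes there is nothing to prove. -/
lemma pow_le_of_logConvex {q : ℕ} {c : ℝ} (hc : 1 ≤ c) {a : ℕ → ℝ} (ha : ∀ j, 0 ≤ a j)
    (h : ∀ j, j + 2 ≤ q → a (j + 1) ^ 2 ≤ c * (a j * a (j + 2))) :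
    ∀ j, j + 1 ≤ q → a j ^ (j + 1) ≤ c ^ ((j + 1) ^ 2) * (a 0 * a (j + 1) ^ j) := by
  intro j
  induction j with
  | zero =>
    intro _
    simp only [zero_add, pow_one, pow_zero, mul_one, one_pow]
    nlinarith [ha 0]
  | succ j ih =>
    intro hj
    have h1 := ih (by omega)
    have h2 := h j (by omega)
    rcases eq_or_lt_of_le (ha (j + 1)) with h0 | h0
    · rw [← h0, zero_pow (by omega)]
      have := ha 0; have := ha (j + 1 + 1)
      positivity
    · have hp : 0 < a (j + 1) ^ j := by positivity
      refine le_of_mul_le_mul_left ?_ hp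
      have h00 := ha 0; have hj0 := ha j; have hj2 := ha (j + 1 + 1)
      calc a (j + 1) ^ j * a (j + 1) ^ (j + 1 + 1) = (a (j + 1) ^ 2) ^ (j + 1) := by ring
        _ ≤ (c * (a j * a (j + 2))) ^ (j + 1) := by gcongr
        _ = c ^ (j + 1) * a (j + 2) ^ (j + 1) * a j ^ (j + 1) := by ring
        _ ≤ c ^ (j + 1) * a (j + 2) ^ (j + 1) * (c ^ ((j + 1) ^ 2) * (a 0 * a (j + 1) ^ j)) := by
            have := ha (j + 2)
            gcongr
        _ = c ^ (j + 1 + (j + 1) ^ 2) * (a (j + 1) ^ j * (a 0 * a (j + 2) ^ (j + 1))) := by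
            rw [pow_add]; ring
        _ ≤ c ^ ((j + 1 + 1) ^ 2) * (a (j + 1) ^ j * (a 0 * a (j + 2) ^ (j + 1))) := by
            have := ha (j + 2)
            gcongr
            nlinarith
        _ = _ := by ring

/-- Descending induction from j = q, with d = q − j: the chord to j + 1 of the preceding lemma is
combined with the bound already known at j + 1. The exponent of c is deliberately crude. -/
lemma pow_le_of_logConvex' {q : ℕ} {c : ℝ} (hc : 1 ≤ c) {a : ℕ → ℝ} (ha : ∀ j, 0 ≤ a j)
    (h : ∀ j, j + 2 ≤ q → a (j + 1) ^ 2 ≤ c * (a j * a (j + 2))) :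
    ∀ d j, j + d = q → a j ^ q ≤ c ^ (d * q ^ 3) * (a 0 ^ d * a q ^ j) := by
  intro d
  induction d with
  | zero =>
    rintro j rfl
    simp
  | succ d ih =>
    intro j hj
    have h1 := ih (j + 1) (by omega)
    have h2 := pow_le_of_logConvex hc ha h j (by omega)
    have h00 := ha 0; have hq0 := ha q; have hj0 := ha j; have hj1 := ha (j + 1)
    refine le_of_pow_le_pow_left₀ (n := j + 1) (by omega) (by positivity) ?_
    calc (a j ^ q) ^ (j + 1) = (a j ^ (j + 1)) ^ q := by ring
      _ ≤ (c ^ ((j + 1) ^ 2) * (a 0 * a (j + 1) ^ j)) ^ q := by gcongr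
      _ = c ^ ((j + 1) ^ 2 * q) * a 0 ^ q * (a (j + 1) ^ q) ^ j := by
          rw [mul_pow, mul_pow, ← pow_mul, ← pow_mul, ← pow_mul, mul_comm j q, mul_assoc]
      _ ≤ c ^ ((j + 1) ^ 2 * q) * a 0 ^ q * (c ^ (d * q ^ 3) * (a 0 ^ d * a q ^ (j + 1))) ^ j := by
          gcongr
      _ = c ^ ((j + 1) ^ 2 * q + d * q ^ 3 * j) * (a 0 ^ (q + d * j) * a q ^ ((j + 1) * j)) := by
          rw [mul_pow, mul_pow, ← pow_mul, ← pow_mul, ← pow_mul, pow_add, pow_add]; ring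
      _ ≤ c ^ ((d + 1) * q ^ 3 * (j + 1)) * (a 0 ^ (q + d * j) * a q ^ ((j + 1) * j)) := by
          gcongr
          have hjq : j + 1 ≤ q := by omega
          have : (j + 1) ^ 2 * q ≤ q ^ 2 * q := by gcongr
          nlinarith [Nat.zero_le (d * q ^ 3), Nat.zero_le (q ^ 3 * j)]
      _ = (c ^ ((d + 1) * q ^ 3) * (a 0 ^ (d + 1) * a q ^ j)) ^ (j + 1) := by
          have : q + d * j = (d + 1) * (j + 1) := by rw [← hj]; ring
          rw [this, mul_pow, mul_pow, ← pow_mul, ← pow_mul, ← pow_mul, mul_comm (j + 1) j]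

/-- The largest norm `‖∂^w f‖_{L^{2q/j}}` over the words `w` of length `j`. -/
def gnSup (q j : ℕ) (f : Space N → ℝ) : ℝ :=
  ⨆ v : List.Vector (Fin N) j, (eLpNorm (D v.1 f) (gnExp q j) volume).toReal

lemma gnSup_nonneg (q j : ℕ) (f : Space N → ℝ) : 0 ≤ gnSup q j f :=
  Real.iSup_nonneg fun _ => ENNReal.toReal_nonneg

lemma le_gnSup (q : ℕ) (f : Space N → ℝ) (w : List (Fin N)) :
    (eLpNorm (D w f) (gnExp q w.length) volume).toReal ≤ gnSup q w.length f :=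
  le_ciSup (f := fun v : List.Vector (Fin N) w.length =>
    (eLpNorm (D v.1 f) (gnExp q w.length) volume).toReal) (Set.finite_range _).bddAbove ⟨w, rfl⟩

/-- A word of length j + 1 is `i :: w`, and `gn_step` compares it with `w` and `i :: i :: w`; only
the repeated direction is needed. The suprema run over finitely many words, so they are attained
bounds. -/
lemma gnSup_logConvex {f : Space N → ℝ} (hf : Nice f) {q j : ℕ} (hj : j + 2 ≤ q) :
    gnSup q (j + 1) f ^ 2 ≤ 2 * q * (gnSup q j f * gnSup q (j + 2) f) := by
  have h0 := gnSup_nonneg q j f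
  have h2 := gnSup_nonneg q (j + 2) f
  have : gnSup q (j + 1) f ≤ √(2 * q * (gnSup q j f * gnSup q (j + 2) f)) := by
    refine Real.iSup_le ?_ (Real.sqrt_nonneg _)
    rintro ⟨w, hw⟩
    apply Real.le_sqrt_of_sq_le
    match w, hw with
    | i :: w, hw =>
      have hl : w.length = j := by simpa using hw
      subst hl
      refine (gn_step (hf.word w) i hj ?_ (hf.memLp_gn (by omega) (by omega))).trans ?_
      -- Only the undifferentiated function may fail to be square integrable, and it occurs only at
      -- j = 0.
      · by_cases h : w = []
        · right; simp [h]
        · left; exact hf.word2 h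
      · gcongr
        · exact le_gnSup q f w
        · exact le_gnSup q f (i :: i :: w)
  calc gnSup q (j + 1) f ^ 2 ≤ √(2 * q * (gnSup q j f * gnSup q (j + 2) f)) ^ 2 := by
        have := gnSup_nonneg q (j + 1) f
        gcongr
    _ = _ := Real.sq_sqrt (by positivity)

/-- The **Gagliardo-Nirenberg inequality** between `L^∞` and the homogeneous Sobolev space of
order `q`. -/
lemma gagliardo_nirenberg {f : Space N → ℝ} (hf : Nice f) {q : ℕ} (hq : 1 ≤ q) {M S : ℝ}
    (hM : ∀ x, |f x| ≤ M) (hS0 : 0 ≤ S) (hS : ∀ w, w.length = q → L2le (D w f) S)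
    {w : List (Fin N)} (hw : w.length ≤ q) :
    (eLpNorm (D w f) (gnExp q w.length) volume).toReal ^ q ≤
      (2 * q : ℝ) ^ (q * q ^ 3) * (M ^ (q - w.length) * S ^ w.length) := by
  have hM0 : 0 ≤ M := (abs_nonneg _).trans (hM 0)
  have hq1 : (1 : ℝ) ≤ 2 * q := by
    have : (1 : ℝ) ≤ q := by exact_mod_cast hq
    linarith
  have h := pow_le_of_logConvex' hq1 (fun j => gnSup_nonneg q j f)
    (fun j hj => gnSup_logConvex hf hj) (q - w.length) w.length (by omega)
  have e0 : gnSup q 0 f ≤ M := by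
    refine Real.iSup_le ?_ hM0
    rintro ⟨w, hw⟩
    have : w = [] := List.length_eq_zero_iff.1 hw
    subst this
    simp only [D_nil, gnExp_zero hq]
    refine ENNReal.toReal_le_of_le_ofReal hM0 ?_
    rw [eLpNorm_exponent_top]
    exact eLpNormEssSup_le_of_ae_bound (Eventually.of_forall hM)
  have eq : gnSup q q f ≤ S := by
    refine Real.iSup_le ?_ hS0
    rintro ⟨w, hw⟩
    rw [gnExp_self hq]
    exact ENNReal.toReal_le_of_le_ofReal hS0 (hS w hw)
  have h00 := gnSup_nonneg q 0 f
  have hqq := gnSup_nonneg q q f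
  calc (eLpNorm (D w f) (gnExp q w.length) volume).toReal ^ q ≤ gnSup q w.length f ^ q := by
        gcongr; exact le_gnSup q f w
    _ ≤ _ := h
    _ ≤ (2 * q : ℝ) ^ (q * q ^ 3) * (M ^ (q - w.length) * S ^ w.length) := by
        gcongr
        omega

/-- A constant for the product estimates of order `q`. -/
def moserConst (q : ℕ) : ℝ := ((2 * q : ℝ) ^ (q * q ^ 3)) ^ 3 + 1

lemma moserConst_pos (q : ℕ) : 0 < moserConst q := by unfold moserConst; positivity

/-- **Moser estimate** for the product of derivatives of three functions. -/
lemma moser {q : ℕ} {f g h : Space N → ℝ} (hf : Nice f) (hg : Nice g) (hh : Nice h)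
    {Mf Mg Mh Sf Sg Sh : ℝ} (bf : ∀ x, |f x| ≤ Mf) (bg : ∀ x, |g x| ≤ Mg) (bh : ∀ x, |h x| ≤ Mh)
    (pf : 0 ≤ Sf) (pg : 0 ≤ Sg) (ph : 0 ≤ Sh)
    (sf : ∀ w, w.length = q → L2le (D w f) Sf) (sg : ∀ w, w.length = q → L2le (D w g) Sg)
    (sh : ∀ w, w.length = q → L2le (D w h) Sh) (w₁ w₂ w₃ : List (Fin N))
    (hw : w₁.length + w₂.length + w₃.length = q) :
    L2le (D w₁ f * D w₂ g * D w₃ h)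
      (moserConst q * (Sf * Mg * Mh + Mf * Sg * Mh + Mf * Mg * Sh)) := by
  have hMf : 0 ≤ Mf := (abs_nonneg _).trans (bf 0)
  have hMg : 0 ≤ Mg := (abs_nonneg _).trans (bg 0)
  have hMh : 0 ≤ Mh := (abs_nonneg _).trans (bh 0)
  set Y := Sf * Mg * Mh + Mf * Sg * Mh + Mf * Mg * Sh with hY
  have hY0 : 0 ≤ Y := by positivity
  rcases Nat.eq_zero_or_pos q with rfl | hq
  · have h1 : w₁ = [] := List.length_eq_zero_iff.1 (by omega)
    have h2 : w₂ = [] := List.length_eq_zero_iff.1 (by omega)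
    have h3 : w₃ = [] := List.length_eq_zero_iff.1 (by omega)
    subst h1; subst h2; subst h3
    simp only [D_nil]
    refine (((sf [] rfl).mul_bdd bg hMg).mul_bdd bh hMh).mono ?_
    have : (1 : ℝ) ≤ moserConst 0 := by unfold moserConst; norm_num
    calc Mh * (Mg * Sf) = 1 * (Sf * Mg * Mh) := by ring
      _ ≤ moserConst 0 * Y := by
        gcongr
        rw [hY]
        have : 0 ≤ Mf * Sg * Mh + Mf * Mg * Sh := by positivity
        linarith
  · have m1 := (hf.memLp_gn hq (w := w₁) (by omega))
    have m2 := (hg.memLp_gn hq (w := w₂) (by omega))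
    have m3 := (hh.memLp_gn hq (w := w₃) (by omega))
    have g1 := gagliardo_nirenberg hf hq bf pf sf (w := w₁) (by omega)
    have g2 := gagliardo_nirenberg hg hq bg pg sg (w := w₂) (by omega)
    have g3 := gagliardo_nirenberg hh hq bh ph sh (w := w₃) (by omega)
    set n1 := (eLpNorm (D w₁ f) (gnExp q w₁.length) volume).toReal with hn1
    set n2 := (eLpNorm (D w₂ g) (gnExp q w₂.length) volume).toReal with hn2
    set n3 := (eLpNorm (D w₃ h) (gnExp q w₃.length) volume).toReal with hn3
    have p1 : 0 ≤ n1 := ENNReal.toReal_nonneg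
    have p2 : 0 ≤ n2 := ENNReal.toReal_nonneg
    have p3 : 0 ≤ n3 := ENNReal.toReal_nonneg
    have hH : L2le (D w₁ f * D w₂ g * D w₃ h) (n1 * n2 * n3) := by
      unfold L2le
      rw [ENNReal.ofReal_mul (by positivity), ENNReal.ofReal_mul p1,
        ENNReal.ofReal_toReal m1.2.ne, ENNReal.ofReal_toReal m2.2.ne,
        ENNReal.ofReal_toReal m3.2.ne]
      have hol := eLpNorm_mul_le_gn hq hw ((hf.smooth.word w₁).mul (hg.smooth.word w₂)).aesm
        (hh.smooth.word w₃).aesm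
      rw [gnExp_self hq] at hol
      refine hol.trans ?_
      gcongr
      exact eLpNorm_mul_le_gn hq rfl (hf.smooth.word _).aesm (hg.smooth.word _).aesm
    refine hH.mono ?_
    set K : ℝ := (2 * q : ℝ) ^ (q * q ^ 3) with hK
    have hq1 : (1 : ℝ) ≤ 2 * q := by
      have : (1 : ℝ) ≤ q := by exact_mod_cast hq
      linarith
    have hK1 : 1 ≤ K := one_le_pow₀ hq1
    have hprod : (n1 * n2 * n3) ^ q ≤ (K ^ 3 * Y) ^ q := by
      -- Writing each complementary exponent as the sum of the two other lengths regroups the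
      -- product of the three interpolation bounds: the mixed product with Sf carries the power
      -- |w₁|, the one with Sg the power |w₂|, the one with Sh the power |w₃|. Each mixed product is
      -- at most Y.
      have e1 : q - w₁.length = w₂.length + w₃.length := by omega
      have e2 : q - w₂.length = w₁.length + w₃.length := by omega
      have e3 : q - w₃.length = w₁.length + w₂.length := by omega
      rw [e1] at g1; rw [e2] at g2; rw [e3] at g3
      calc (n1 * n2 * n3) ^ q = n1 ^ q * n2 ^ q * n3 ^ q := by rw [mul_pow, mul_pow]
        _ ≤ (K * (Mf ^ (w₂.length + w₃.length) * Sf ^ w₁.length)) *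
            (K * (Mg ^ (w₁.length + w₃.length) * Sg ^ w₂.length)) *
            (K * (Mh ^ (w₁.length + w₂.length) * Sh ^ w₃.length)) := by gcongr
        _ = K ^ 3 * ((Sf * Mg * Mh) ^ w₁.length * (Mf * Sg * Mh) ^ w₂.length *
            (Mf * Mg * Sh) ^ w₃.length) := by
            simp only [pow_add, mul_pow]; ring
        _ ≤ K ^ 3 * (Y ^ w₁.length * Y ^ w₂.length * Y ^ w₃.length) := by
            have a1 : 0 ≤ Sf * Mg * Mh := by positivity
            have a2 : 0 ≤ Mf * Sg * Mh := by positivity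
            have a3 : 0 ≤ Mf * Mg * Sh := by positivity
            gcongr <;> linarith
        _ = K ^ 3 * Y ^ q := by rw [← pow_add, ← pow_add, hw]
        _ ≤ (K ^ 3) ^ q * Y ^ q := by
            gcongr
            exact le_self_pow₀ (one_le_pow₀ hK1) (by omega)
        _ = _ := by rw [mul_pow]
    have := le_of_pow_le_pow_left₀ (by omega) (by positivity) hprod
    refine this.trans ?_
    gcongr
    unfold moserConst
    rw [← hK]; linarith

/-- Moser estimate for the product of derivatives of two functions. -/
lemma moser_two {q : ℕ} {f g : Space N → ℝ} (hf : Nice f) (hg : Nice g)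
    {Mf Mg Sf Sg : ℝ} (bf : ∀ x, |f x| ≤ Mf) (bg : ∀ x, |g x| ≤ Mg)
    (pf : 0 ≤ Sf) (pg : 0 ≤ Sg) (hq : 1 ≤ q)
    (sf : ∀ w, w.length = q → L2le (D w f) Sf) (sg : ∀ w, w.length = q → L2le (D w g) Sg)
    (w₁ w₂ : List (Fin N)) (hw : w₁.length + w₂.length = q) :
    L2le (D w₁ f * D w₂ g) (moserConst q * (Sf * Mg + Mf * Sg)) := by
  -- The third factor is the constant 1, whose derivatives of order q ≥ 1 vanish, so its L² bound is
  -- 0.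
  have h := moser hf hg (nice_const 1) bf bg (Mh := 1) (fun x => by simp) pf pg le_rfl sf sg
    (fun w hw => by
      rw [D_const 1 (by rintro rfl; simp at hw; omega)]; exact l2le_zero) w₁ w₂ [] (by simpa)
  have e : D w₁ f * D w₂ g * D [] (fun _ => (1 : ℝ)) = D w₁ f * D w₂ g := by
    ext x; simp
  rw [e] at h
  simpa using h

end GagliardoNirenberg

/-! ### Leibniz bounds, commutators, and functions controlled at a fixed order. -/

section Products

variable {N : ℕ}

/-- Each derivative of a triple product produces three products of the same type, and the total
order stays n. After |w| derivatives there are 3^|w| terms, all covered by the bound T. -/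
lemma D_mul3_le {f g h : Space N → ℝ} (hf : Smooth f) (hg : Smooth g) (hh : Smooth h) {n : ℕ}
    {T : ℝ} (hT0 : 0 ≤ T) (hT : ∀ w₁ w₂ w₃ : List (Fin N), w₁.length + w₂.length + w₃.length = n →
      L2le (D w₁ f * D w₂ g * D w₃ h) T) (w w₁ w₂ w₃ : List (Fin N))
    (hw : w.length + w₁.length + w₂.length + w₃.length = n) :
    L2le (D w (D w₁ f * D w₂ g * D w₃ h)) (3 ^ w.length * T) := by
  induction w generalizing w₁ w₂ w₃ with
  | nil => simpa using hT w₁ w₂ w₃ (by simpa using hw)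
  | cons i w ih =>
    have s1 := hf.word w₁; have s2 := hg.word w₂; have s3 := hh.word w₃
    have t1 := hf.word (i :: w₁); have t2 := hg.word (i :: w₂); have t3 := hh.word (i :: w₃)
    have e : partialDeriv i (D w₁ f * D w₂ g * D w₃ h) = D (i :: w₁) f * D w₂ g * D w₃ h +
        D w₁ f * D (i :: w₂) g * D w₃ h + D w₁ f * D w₂ g * D (i :: w₃) h := by
      rw [partialDeriv_mul (s1.mul s2) s3, partialDeriv_mul s1 s2]
      simp only [D_cons]; ring
    have m1 := (t1.mul s2).mul s3
    have m2 := (s1.mul t2).mul s3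
    have m3 := (s1.mul s2).mul t3
    rw [D_cons' ((s1.mul s2).mul s3), e, D_add (m1.add m2) m3, D_add m1 m2]
    simp only [List.length_cons] at hw ⊢
    have b1 := ih (i :: w₁) w₂ w₃ (by simp; omega)
    have b2 := ih w₁ (i :: w₂) w₃ (by simp; omega)
    have b3 := ih w₁ w₂ (i :: w₃) (by simp; omega)
    have p : 0 ≤ 3 ^ w.length * T := by positivity
    refine ((b1.add b2 (m1.word w).aesm (m2.word w).aesm p p).add b3
      ((m1.word w).add (m2.word w)).aesm (m3.word w).aesm (by positivity) p).mono (le_of_eq ?_)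
    ring

/-- The factor e stays outside the derivative. This version is needed when e is itself a derivative
whose order counts in the Moser estimate. -/
lemma mul_D_mul_le {e f g : Space N → ℝ} (he : Smooth e) (hf : Smooth f) (hg : Smooth g) {n : ℕ}
    {T : ℝ} (hT0 : 0 ≤ T) (hT : ∀ w₁ w₂ : List (Fin N), w₁.length + w₂.length = n →
      L2le (e * (D w₁ f * D w₂ g)) T) (w w₁ w₂ : List (Fin N))
    (hw : w.length + w₁.length + w₂.length = n) :
    L2le (e * D w (D w₁ f * D w₂ g)) (2 ^ w.length * T) := by
  induction w generalizing w₁ w₂ with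
  | nil => simpa using hT w₁ w₂ (by simpa using hw)
  | cons i w ih =>
    have s1 := hf.word w₁; have s2 := hg.word w₂
    have t1 := hf.word (i :: w₁); have t2 := hg.word (i :: w₂)
    have e : partialDeriv i (D w₁ f * D w₂ g) = D (i :: w₁) f * D w₂ g +
        D w₁ f * D (i :: w₂) g := by
      rw [partialDeriv_mul s1 s2]
      simp only [D_cons]
    have m1 := t1.mul s2
    have m2 := s1.mul t2
    rw [D_cons' (s1.mul s2), e, D_add m1 m2, mul_add]
    simp only [List.length_cons] at hw ⊢
    have b1 := ih (i :: w₁) w₂ (by simp; omega)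
    have b2 := ih w₁ (i :: w₂) (by simp; omega)
    have p : 0 ≤ 2 ^ w.length * T := by positivity
    refine (b1.add b2 (he.mul (m1.word w)).aesm (he.mul (m2.word w)).aesm p p).mono (le_of_eq ?_)
    ring

lemma D_mul2_le {f g : Space N → ℝ} (hf : Smooth f) (hg : Smooth g) {n : ℕ}
    {T : ℝ} (hT0 : 0 ≤ T) (hT : ∀ w₁ w₂ : List (Fin N), w₁.length + w₂.length = n →
      L2le (D w₁ f * D w₂ g) T) (w w₁ w₂ : List (Fin N))
    (hw : w.length + w₁.length + w₂.length = n) :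
    L2le (D w (D w₁ f * D w₂ g)) (2 ^ w.length * T) := by
  have h := mul_D_mul_le (e := fun _ => 1) contDiff_const hf hg hT0
    (fun w₁ w₂ h => by
      have : (fun _ => (1 : ℝ)) * (D w₁ f * D w₂ g) = D w₁ f * D w₂ g := by ext x; simp
      rw [this]; exact hT w₁ w₂ h) w w₁ w₂ hw
  have e : (fun _ => (1 : ℝ)) * D w (D w₁ f * D w₂ g) = D w (D w₁ f * D w₂ g) := by ext x; simp
  rwa [e] at h

/-- The commutator of the derivative `∂^w` and of the multiplication by `f`. -/
def comm (w : List (Fin N)) (f G : Space N → ℝ) : Space N → ℝ := D w (f * G) - f * D w G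

lemma Smooth.comm {f G : Space N → ℝ} (hf : Smooth f) (hG : Smooth G) (w : List (Fin N)) :
    Smooth (comm w f G) := ((hf.mul hG).word w).sub (hf.mul (hG.word w))

lemma Nice.comm {f G : Space N → ℝ} (hf : Nice f) (hG : Nice2 G) (w : List (Fin N)) :
    Nice2 (comm w f G) := ((hf.mul2 hG).word w).sub (hf.mul2 (hG.word w))

/-- In a commutator at least one derivative falls on f, which is why only products with ∂ⱼf need a
bound. The recursion is [∂ᵢ∂^w, f]G = ∂^w(∂ᵢf · G) + [∂^w, f]∂ᵢG. -/
lemma comm_le {f G : Space N → ℝ} (hf : Smooth f) (hG : Smooth G) {T : ℝ} (hT0 : 0 ≤ T)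
    (w : List (Fin N)) (hT : ∀ (j : Fin N) (w₁ w₂ : List (Fin N)),
      w₁.length + w₂.length + 1 = w.length → L2le (D w₁ (partialDeriv j f) * D w₂ G) T) :
    L2le (comm w f G) (2 ^ w.length * T) := by
  induction w generalizing G with
  | nil => unfold comm; simpa using l2le_zero
  | cons i w ih =>
    have e : comm (i :: w) f G = D w (D [] (partialDeriv i f) * D [] G) +
        comm w f (partialDeriv i G) := by
      unfold comm
      rw [D_concat_mul hf hG, D_cons' hG, D_nil, D_nil]
      ring
    rw [e]
    have b1 := D_mul2_le (hf.pd i) hG hT0 (n := w.length)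
      (fun w₁ w₂ h => hT i w₁ w₂ (by simp; omega)) w [] [] (by simp)
    have b2 := ih (hG.pd i) (fun j w₁ w₂ h => by
      rw [← D_cons' hG]
      exact hT j w₁ (i :: w₂) (by simp; omega))
    have p : 0 ≤ 2 ^ w.length * T := by positivity
    refine (b1.add b2 (((hf.pd i).mul hG).word w).aesm
      (hf.comm (hG.pd i) w).aesm p p).mono (le_of_eq ?_)
    simp only [List.length_cons]; ring

/-- Differentiating a commutator gives a commutator of one order more, up to a product in which f
carries exactly one derivative. -/
lemma partialDeriv_comm_eq {f G : Space N → ℝ} (hf : Smooth f) (hG : Smooth G) (i : Fin N)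
    (w : List (Fin N)) :
    partialDeriv i (comm w f G) = comm (i :: w) f G - partialDeriv i f * D w G := by
  unfold comm
  rw [partialDeriv_sub ((hf.mul hG).word w) (hf.mul (hG.word w)), partialDeriv_mul hf (hG.word w)]
  simp only [D_cons]
  ring

/-- The Laplacian of a smooth function. -/
def lap (f : Space N → ℝ) : Space N → ℝ := ∑ i, partialDeriv i (partialDeriv i f)

lemma Smooth.lap {f : Space N → ℝ} (hf : Smooth f) : Smooth (lap f) :=
  Smooth.sum fun i _ => (hf.pd i).pd i

lemma Nice.lap {f : Space N → ℝ} (hf : Nice f) : Nice2 (lap f) :=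
  Nice2.sum _ fun i _ => ((hf.pd i).toNice.pd i)

lemma comm_lap {f g : Space N → ℝ} (hf : Smooth f) (hg : Smooth g) (w : List (Fin N)) :
    comm w f (lap g) = ∑ l, comm w f (partialDeriv l (partialDeriv l g)) := by
  unfold comm lap
  rw [Finset.mul_sum, D_sum _ _ fun l _ => hf.mul ((hg.pd l).pd l),
    D_sum _ _ fun l _ => (hg.pd l).pd l, Finset.mul_sum, Finset.sum_sub_distrib]

/-- `F` is smooth and its derivatives of order `s` are bounded by `c Z` in `L²`. -/
structure CB (s : ℕ) (Z c : ℝ) (F : Space N → ℝ) : Prop where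
  smooth : Smooth F
  Z_nonneg : 0 ≤ Z
  c_nonneg : 0 ≤ c
  le : ∀ w, w.length = s → L2le (D w F) (c * Z)

lemma CB.add {s : ℕ} {Z c c' : ℝ} {F G : Space N → ℝ} (hF : CB s Z c F) (hG : CB s Z c' G) :
    CB s Z (c + c') (F + G) where
  smooth := hF.smooth.add hG.smooth
  Z_nonneg := hF.Z_nonneg
  c_nonneg := add_nonneg hF.c_nonneg hG.c_nonneg
  le w hw := by
    rw [D_add hF.smooth hG.smooth, add_mul]
    exact (hF.le w hw).add (hG.le w hw) (hF.smooth.word w).aesm (hG.smooth.word w).aesm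
      (mul_nonneg hF.c_nonneg hF.Z_nonneg) (mul_nonneg hG.c_nonneg hG.Z_nonneg)

lemma CB.smul {s : ℕ} {Z c : ℝ} {F : Space N → ℝ} (hF : CB s Z c F) (a : ℝ) :
    CB s Z (|a| * c) (a • F) where
  smooth := hF.smooth.smul a
  Z_nonneg := hF.Z_nonneg
  c_nonneg := mul_nonneg (abs_nonneg a) hF.c_nonneg
  le w hw := by
    rw [D_smul, mul_assoc]
    exact (hF.le w hw).smul a

lemma CB.neg {s : ℕ} {Z c : ℝ} {F : Space N → ℝ} (hF : CB s Z c F) : CB s Z c (-F) where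
  smooth := hF.smooth.neg
  Z_nonneg := hF.Z_nonneg
  c_nonneg := hF.c_nonneg
  le w hw := by rw [D_neg]; exact (hF.le w hw).neg

lemma CB.sub {s : ℕ} {Z c c' : ℝ} {F G : Space N → ℝ} (hF : CB s Z c F) (hG : CB s Z c' G) :
    CB s Z (c + c') (F - G) := by
  rw [sub_eq_add_neg]; exact hF.add hG.neg

lemma CB.zero {s : ℕ} {Z : ℝ} (hZ : 0 ≤ Z) : CB s Z 0 (0 : Space N → ℝ) where
  smooth := smooth_zero
  Z_nonneg := hZ
  c_nonneg := le_rfl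
  le w _ := by rw [D_zero]; exact l2le_zero

lemma CB.sum {s : ℕ} {Z c : ℝ} {ι : Type*} [Fintype ι] {F : ι → Space N → ℝ} (hZ : 0 ≤ Z)
    (hc : 0 ≤ c) (hF : ∀ i, CB s Z c (F i)) : CB s Z (Fintype.card ι * c) (∑ i, F i) where
  smooth := Smooth.sum fun i _ => (hF i).smooth
  Z_nonneg := hZ
  c_nonneg := by positivity
  le w hw := by
    rw [D_sum _ _ fun i _ => (hF i).smooth]
    refine (L2le.sum _ (fun i _ => (hF i).le w hw) (fun i _ => ((hF i).smooth.word w).aesm)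
      (fun _ _ => by positivity)).mono (le_of_eq ?_)
    simp
    ring

end Products

/-! ### The velocity, the control quantities, and the cubic terms. -/

section SmoothEstimate

variable {N : ℕ}

/-- The pointwise cross product of two maps, given by their components. -/
def crs (f g : Fin 3 → Space N → ℝ) : Fin 3 → Space N → ℝ :=
  ![f 1 * g 2 - f 2 * g 1, f 2 * g 0 - f 0 * g 2, f 0 * g 1 - f 1 * g 0]

/-- The projection `u ↦ u_1 e_1 + u_3 e_3`. -/
def pr (u : Fin 3 → Space N → ℝ) : Fin 3 → Space N → ℝ := ![u 0, 0, u 2]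

/-- The effective field `Δu - λ (u_1 e_1 + u_3 e_3)`. -/
def field (lam : ℝ) (u : Fin 3 → Space N → ℝ) : Fin 3 → Space N → ℝ :=
  fun a => lap (u a) - lam • pr u a

/-- The velocity `-u × (Δu - λ (u_1 e_1 + u_3 e_3))`. -/
def velo (lam : ℝ) (u : Fin 3 → Space N → ℝ) : Fin 3 → Space N → ℝ :=
  fun a => -crs u (field lam u) a

/-- This separates the second-order part, where commutators appear, from the part with weight λ,
which contains no derivative and always has a small factor. -/
lemma velo_eq (lam : ℝ) (u : Fin 3 → Space N → ℝ) (a : Fin 3) :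
    velo lam u a = -crs u (fun b => lap (u b)) a + lam • (![u 1 * u 2, 0, -(u 1 * u 0)] : _) a := by
  fin_cases a <;> ext x <;> simp [velo, crs, field, pr] <;> ring

/-- A smooth map `u` with the bounds entering in the energy estimate of order `s + 2`. -/
structure Ctrl (s : ℕ) (lam A X : ℝ) (u : Fin 3 → Space N → ℝ) : Prop where
  nice : ∀ a, Nice (u a)
  nice2 : ∀ a, a ≠ 1 → Nice2 (u a)
  A_nonneg : 0 ≤ A
  X_nonneg : 0 ≤ X
  one_le : 1 ≤ lam
  sup : ∀ a x, |u a x| ≤ 1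
  supA : ∀ a, a ≠ 1 → ∀ x, |u a x| ≤ A
  supd : ∀ a i x, |partialDeriv i (u a) x| ≤ A
  dX : ∀ a i w, w.length = s ∨ w.length = s + 1 → L2le (D w (partialDeriv i (u a))) X
  pX : ∀ a, a ≠ 1 → ∀ w, w.length = s ∨ w.length = s + 1 → L2le (D w (u a)) X
  pX' : ∀ a, a ≠ 1 → ∀ w, w.length = s → L2le (D w (u a)) (X / lam)

/-- A small function in the energy estimate of order `s + 2`. -/
structure IsU (s : ℕ) (A X : ℝ) (f : Space N → ℝ) : Prop where
  nice : Nice2 f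
  X_nonneg : 0 ≤ X
  sup : ∀ x, |f x| ≤ A
  le : ∀ w, w.length = s ∨ w.length = s + 1 → L2le (D w f) X

namespace Ctrl

variable {s : ℕ} {lam A X : ℝ} {u : Fin 3 → Space N → ℝ}

lemma isU (h : Ctrl s lam A X u) {a : Fin 3} (ha : a ≠ 1) : IsU s A X (u a) :=
  ⟨h.nice2 a ha, h.X_nonneg, h.supA a ha, h.pX a ha⟩

lemma isU_pd (h : Ctrl s lam A X u) (a : Fin 3) (i : Fin N) : IsU s A X (partialDeriv i (u a)) :=
  ⟨(h.nice a).pd i, h.X_nonneg, h.supd a i, h.dX a i⟩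

end Ctrl

lemma IsU.A_nonneg {s : ℕ} {A X : ℝ} {f : Space N → ℝ} (h : IsU s A X f) : 0 ≤ A :=
  (abs_nonneg _).trans (h.sup 0)

/-- The constant for cubic terms of order `s`. -/
def cubConst (s : ℕ) : ℝ := 3 ^ s * (3 * (moserConst s + moserConst (s + 1)))

lemma cubConst_nonneg (s : ℕ) : 0 ≤ cubConst s := by
  have := (moserConst_pos s).le
  have := (moserConst_pos (s + 1)).le
  unfold cubConst; positivity

/-- Small functions are bounded by A and controlled by X at both orders s and s + 1, so the total
order may be either. The constant adds up the two cases. -/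
lemma IsU.moser {s : ℕ} {A X : ℝ} {f g h : Space N → ℝ} (hf : IsU s A X f) (hg : IsU s A X g)
    (hh : IsU s A X h) (w₁ w₂ w₃ : List (Fin N))
    (hr : w₁.length + w₂.length + w₃.length = s ∨ w₁.length + w₂.length + w₃.length = s + 1) :
    L2le (D w₁ f * D w₂ g * D w₃ h)
      (3 * (moserConst s + moserConst (s + 1)) * (A ^ 2 * X)) := by
  have h0 := (moserConst_pos s).le
  have h1 := (moserConst_pos (s + 1)).le
  have hA := hf.A_nonneg
  have hX := hf.X_nonneg
  rcases hr with hr | hr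
  · refine (LandauLifshitz.moser hf.nice.toNice hg.nice.toNice hh.nice.toNice hf.sup hg.sup hh.sup
      hX hX hX (fun w hw => hf.le w (Or.inl hw)) (fun w hw => hg.le w (Or.inl hw))
      (fun w hw => hh.le w (Or.inl hw)) w₁ w₂ w₃ hr).mono ?_
    have : 0 ≤ moserConst (s + 1) * (A ^ 2 * X) := by positivity
    nlinarith
  · refine (LandauLifshitz.moser hf.nice.toNice hg.nice.toNice hh.nice.toNice hf.sup hg.sup hh.sup
      hX hX hX (fun w hw => hf.le w (Or.inr hw)) (fun w hw => hg.le w (Or.inr hw))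
      (fun w hw => hh.le w (Or.inr hw)) w₁ w₂ w₃ hr).mono ?_
    have : 0 ≤ moserConst s * (A ^ 2 * X) := by positivity
    nlinarith

/-- With at most one derivative already present in the product, s further derivatives give total
order s or s + 1, exactly the two orders that X controls. -/
lemma IsU.cb {s : ℕ} {A X : ℝ} {f g h : Space N → ℝ} (hf : IsU s A X f) (hg : IsU s A X g)
    (hh : IsU s A X h) (w₁ w₂ w₃ : List (Fin N))
    (hr : w₁.length + w₂.length + w₃.length ≤ 1) :
    CB s (A ^ 2 * X) (cubConst s) (D w₁ f * D w₂ g * D w₃ h) where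
  smooth := ((hf.nice.smooth.word _).mul (hg.nice.smooth.word _)).mul (hh.nice.smooth.word _)
  Z_nonneg := by
    have := hf.A_nonneg
    have := hf.X_nonneg
    positivity
  c_nonneg := cubConst_nonneg s
  le w hw := by
    have h0 := (moserConst_pos s).le
    have h1 := (moserConst_pos (s + 1)).le
    have hA := hf.A_nonneg
    have hX := hf.X_nonneg
    have := D_mul3_le hf.nice.smooth hg.nice.smooth hh.nice.smooth
      (n := s + (w₁.length + w₂.length + w₃.length))
      (T := 3 * (moserConst s + moserConst (s + 1)) * (A ^ 2 * X)) (by positivity)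
      (fun v₁ v₂ v₃ hv => hf.moser hg hh v₁ v₂ v₃ (by omega)) w w₁ w₂ w₃ (by omega)
    rw [hw] at this
    refine this.mono (le_of_eq ?_)
    unfold cubConst; ring

/-- The product of three small functions, the last one differentiated once. -/
lemma IsU.cb1 {s : ℕ} {A X : ℝ} {f g h : Space N → ℝ} (hf : IsU s A X f) (hg : IsU s A X g)
    (hh : IsU s A X h) (i : Fin N) :
    CB s (A ^ 2 * X) (cubConst s) (f * g * partialDeriv i h) := hf.cb hg hh [] [] [i] (by simp)

lemma IsU.cb0 {s : ℕ} {A X : ℝ} {f g h : Space N → ℝ} (hf : IsU s A X f) (hg : IsU s A X g)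
    (hh : IsU s A X h) : CB s (A ^ 2 * X) (cubConst s) (f * g * h) := hf.cb hg hh [] [] [] (by simp)

/-- The cubic terms without factor `λ`. -/
def cubZero (u : Fin 3 → Space N → ℝ) (a : Fin 3) : Space N → ℝ :=
  ∑ i, ∑ b, ∑ j, (-(partialDeriv j (u b) * partialDeriv j (u b) *
      partialDeriv i (partialDeriv i (u a)))
    - (4 : ℝ) • (partialDeriv i (u a) * partialDeriv j (u b) *
      partialDeriv i (partialDeriv j (u b)))
    - (2 : ℝ) • (partialDeriv i (u a) * partialDeriv i (u b) *
      partialDeriv j (partialDeriv j (u b))))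

/-- The cubic terms with factor `λ`. -/
def cubOne (u : Fin 3 → Space N → ℝ) : Fin 3 → Space N → ℝ := fun a =>
  ∑ i, (-((2 : ℝ) • (u 0 * u 0 * partialDeriv i (partialDeriv i (u a))))
    - (2 : ℝ) • (u 2 * u 2 * partialDeriv i (partialDeriv i (u a)))
    - (2 : ℝ) • (u 0 * partialDeriv i (u 0) * partialDeriv i (u a))
    - (2 : ℝ) • (u 2 * partialDeriv i (u 2) * partialDeriv i (u a)))
  + (![∑ i, (u 0 * partialDeriv i (u 0) * partialDeriv i (u 0)
        + u 0 * u 0 * partialDeriv i (partialDeriv i (u 0))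
        + u 0 * partialDeriv i (u 2) * partialDeriv i (u 2)
        + u 0 * u 2 * partialDeriv i (partialDeriv i (u 2))
        + u 0 * partialDeriv i (u 1) * partialDeriv i (u 1)
        - u 2 * u 2 * partialDeriv i (partialDeriv i (u 0))
        + u 2 * u 0 * partialDeriv i (partialDeriv i (u 2))),
      ∑ i, (u 0 * u 0 * partialDeriv i (partialDeriv i (u 1))
        + u 2 * u 2 * partialDeriv i (partialDeriv i (u 1))),
      ∑ i, (u 2 * partialDeriv i (u 0) * partialDeriv i (u 0)
        + u 2 * u 0 * partialDeriv i (partialDeriv i (u 0))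
        + u 2 * partialDeriv i (u 2) * partialDeriv i (u 2)
        + u 2 * u 2 * partialDeriv i (partialDeriv i (u 2))
        + u 2 * partialDeriv i (u 1) * partialDeriv i (u 1)
        + u 0 * u 2 * partialDeriv i (partialDeriv i (u 0))
        - u 0 * u 0 * partialDeriv i (partialDeriv i (u 2)))] : Fin 3 → Space N → ℝ) a

/-- The cubic terms with factor `λ²`. -/
def cubTwo (u : Fin 3 → Space N → ℝ) : Fin 3 → Space N → ℝ :=
  ![u 0 * u 0 * u 0 + u 2 * u 2 * u 0, 0, u 0 * u 0 * u 2 + u 2 * u 2 * u 2]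

/-- The cubic part of the nonlinearity. -/
def cub (lam : ℝ) (u : Fin 3 → Space N → ℝ) (a : Fin 3) : Space N → ℝ :=
  lam ^ 2 • cubTwo u a + lam • cubOne u a + cubZero u a

lemma cubZero_cb (N s : ℕ) : ∃ c, ∀ (lam A X : ℝ) (u : Fin 3 → Space N → ℝ),
    Ctrl s lam A X u → ∀ a, CB s (A ^ 2 * X) c (cubZero u a) := by
  have h0 := cubConst_nonneg s
  refine ⟨Fintype.card (Fin N) * (Fintype.card (Fin 3) * (Fintype.card (Fin N) *
    (cubConst s + |4| * cubConst s + |2| * cubConst s))), fun lam A X u h a => ?_⟩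
  have hZ : 0 ≤ A ^ 2 * X := mul_nonneg (sq_nonneg _) h.X_nonneg
  exact CB.sum hZ (by positivity) fun i => CB.sum hZ (by positivity) fun b =>
    CB.sum hZ (by positivity) fun j =>
    (((h.isU_pd b j).cb1 (h.isU_pd b j) (h.isU_pd a i) i).neg.sub
      (((h.isU_pd a i).cb1 (h.isU_pd b j) (h.isU_pd b j) i).smul 4)).sub
      (((h.isU_pd a i).cb1 (h.isU_pd b i) (h.isU_pd b j) j).smul 2)

lemma cubOne_cb (N s : ℕ) : ∃ c, ∀ (lam A X : ℝ) (u : Fin 3 → Space N → ℝ),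
    Ctrl s lam A X u → ∀ a, CB s (A ^ 2 * X) c (cubOne u a) := by
  have h0 := cubConst_nonneg s
  suffices ∀ a, ∃ c, ∀ (lam A X : ℝ) (u : Fin 3 → Space N → ℝ),
      Ctrl s lam A X u → CB s (A ^ 2 * X) c (cubOne u a) by
    choose c hc using this
    refine ⟨∑ a, |c a|, fun lam A X u h a => ?_⟩
    have := hc a lam A X u h
    refine ⟨this.smooth, this.Z_nonneg, by positivity, fun w hw => (this.le w hw).mono ?_⟩
    refine mul_le_mul_of_nonneg_right ?_ this.Z_nonneg
    exact (le_abs_self _).trans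
      (Finset.single_le_sum (f := fun a => |c a|) (fun i _ => abs_nonneg _) (Finset.mem_univ a))
  intro a
  have n02 : (2 : Fin 3) ≠ 1 := by decide
  have n01 : (0 : Fin 3) ≠ 1 := by decide
  have key : ∀ (lam A X : ℝ) (u : Fin 3 → Space N → ℝ) (h : Ctrl s lam A X u) (i : Fin N), CB s (A ^ 2 * X) _
    (-((2 : ℝ) • (u 0 * u 0 * partialDeriv i (partialDeriv i (u a))))
    - (2 : ℝ) • (u 2 * u 2 * partialDeriv i (partialDeriv i (u a)))
    - (2 : ℝ) • (u 0 * partialDeriv i (u 0) * partialDeriv i (u a))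
    - (2 : ℝ) • (u 2 * partialDeriv i (u 2) * partialDeriv i (u a))) := fun lam A X u h i =>
    (((((h.isU n01).cb1 (h.isU n01) (h.isU_pd a i) i).smul 2).neg.sub
      (((h.isU n02).cb1 (h.isU n02) (h.isU_pd a i) i).smul 2)).sub
      (((h.isU n01).cb0 (h.isU_pd 0 i) (h.isU_pd a i)).smul 2)).sub
      (((h.isU n02).cb0 (h.isU_pd 2 i) (h.isU_pd a i)).smul 2)
  -- The longest component of the vector part has seven terms for each direction; the middle one has
  -- two, and its bound is weakened to the same constant.
  refine ⟨N * (|2| * cubConst s + |2| * cubConst s + |2| * cubConst s + |2| * cubConst s)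
    + N * (7 * cubConst s), fun lam A X u h => ?_⟩
  have hZ : 0 ≤ A ^ 2 * X := mul_nonneg (sq_nonneg _) h.X_nonneg
  have h1 := CB.sum (s := s) hZ (by positivity) (key lam A X u h)
  simp only [Fintype.card_fin] at h1
  refine h1.add ?_
  have U0 := h.isU n01
  have U2 := h.isU n02
  have wk : ∀ {F : Space N → ℝ} {c c' : ℝ}, CB s (A ^ 2 * X) c F → c ≤ c' →
      CB s (A ^ 2 * X) c' F := fun hF hcc => ⟨hF.smooth, hF.Z_nonneg, hF.c_nonneg.trans hcc,
        fun w hw => (hF.le w hw).mono (mul_le_mul_of_nonneg_right hcc hF.Z_nonneg)⟩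
  fin_cases a
  · refine wk (CB.sum hZ (by positivity) fun i => ((((((U0.cb0 (h.isU_pd 0 i) (h.isU_pd 0 i)).add
      (U0.cb1 U0 (h.isU_pd 0 i) i)).add (U0.cb0 (h.isU_pd 2 i) (h.isU_pd 2 i))).add
      (U0.cb1 U2 (h.isU_pd 2 i) i)).add (U0.cb0 (h.isU_pd 1 i) (h.isU_pd 1 i))).sub
      (U2.cb1 U2 (h.isU_pd 0 i) i)).add (U2.cb1 U0 (h.isU_pd 2 i) i)) (le_of_eq ?_)
    rw [Fintype.card_fin]; ring
  · refine wk (CB.sum hZ (by positivity) fun i => (U0.cb1 U0 (h.isU_pd 1 i) i).add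
      (U2.cb1 U2 (h.isU_pd 1 i) i)) ?_
    rw [Fintype.card_fin]
    gcongr
    linarith
  · refine wk (CB.sum hZ (by positivity) fun i => ((((((U2.cb0 (h.isU_pd 0 i) (h.isU_pd 0 i)).add
      (U2.cb1 U0 (h.isU_pd 0 i) i)).add (U2.cb0 (h.isU_pd 2 i) (h.isU_pd 2 i))).add
      (U2.cb1 U2 (h.isU_pd 2 i) i)).add (U2.cb0 (h.isU_pd 1 i) (h.isU_pd 1 i))).add
      (U0.cb1 U2 (h.isU_pd 0 i) i)).sub (U0.cb1 U0 (h.isU_pd 2 i) i)) (le_of_eq ?_)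
    rw [Fintype.card_fin]; ring

/-- These terms contain no derivative, so only order s is used, where the small components satisfy
the better bound X/λ. This gain reduces their weight λ² to λ. -/
lemma cubTwo_cb (s : ℕ) {lam A X : ℝ} {u : Fin 3 → Space N → ℝ} (h : Ctrl s lam A X u)
    (a : Fin 3) : CB s (A ^ 2 * (X / lam)) (2 * (3 ^ s * (3 * moserConst s))) (cubTwo u a) := by
  have hm := (moserConst_pos s).le
  have n02 : (2 : Fin 3) ≠ 1 := by decide
  have n01 : (0 : Fin 3) ≠ 1 := by decide
  have hlam : 0 < lam := lt_of_lt_of_le one_pos h.one_le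
  have hA := h.A_nonneg
  have hXl : 0 ≤ X / lam := div_nonneg h.X_nonneg hlam.le
  have key : ∀ a b, a ≠ 1 → b ≠ 1 → CB s (A ^ 2 * (X / lam)) (3 ^ s * (3 * moserConst s))
      (u a * u a * u b) := by
    intro a b ha hb
    refine ⟨(((h.nice a).smooth).mul (h.nice a).smooth).mul (h.nice b).smooth, by positivity,
      by positivity, fun w hw => ?_⟩
    have := D_mul3_le (h.nice a).smooth (h.nice a).smooth (h.nice b).smooth (n := s)
      (T := moserConst s * ((X / lam) * A * A + A * (X / lam) * A + A * A * (X / lam)))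
      (by positivity) (fun w₁ w₂ w₃ hw => moser (h.nice a) (h.nice a) (h.nice b) (h.supA a ha)
        (h.supA a ha) (h.supA b hb) hXl hXl hXl (h.pX' a ha) (h.pX' a ha) (h.pX' b hb)
        w₁ w₂ w₃ hw) w [] [] [] (by simpa using hw)
    rw [hw] at this
    refine this.mono (le_of_eq ?_)
    ring
  fin_cases a
  · rw [two_mul]; exact (key 0 0 n01 n01).add (key 2 0 n02 n01)
  · have := CB.zero (N := N) (s := s) (Z := A ^ 2 * (X / lam)) (by positivity)
    exact ⟨this.smooth, this.Z_nonneg, by positivity, fun w hw => by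
      change L2le (D w 0) _
      rw [D_zero]; exact l2le_zero⟩
  · rw [two_mul]; exact (key 0 2 n01 n02).add (key 2 2 n02 n02)

/-- The three weights are brought to λ: the λ² terms through X/λ, the λ terms directly, and the
terms without weight through 1 ≤ λ. -/
lemma cub_le (N s : ℕ) : ∃ c, 0 ≤ c ∧ ∀ (lam A X : ℝ) (u : Fin 3 → Space N → ℝ),
    Ctrl s lam A X u → ∀ a, CB s (lam * (A ^ 2 * X)) c (cub lam u a) := by
  obtain ⟨c0, hc0⟩ := cubZero_cb N s
  obtain ⟨c1, hc1⟩ := cubOne_cb N s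
  have hm := (moserConst_pos s).le
  refine ⟨2 * (3 ^ s * (3 * moserConst s)) + |c1| + |c0|, by positivity,
    fun lam A X u h a => ?_⟩
  have hlam : 0 < lam := lt_of_lt_of_le one_pos h.one_le
  have hA := h.A_nonneg
  have hX := h.X_nonneg
  have f0 := hc0 lam A X u h a
  have f1 := hc1 lam A X u h a
  have f2 := cubTwo_cb s h a
  refine CB.add (CB.add ?_ ?_) ?_
  · have := f2.smul (lam ^ 2)
    refine ⟨this.smooth, by positivity, by positivity, fun w hw => (this.le w hw).mono
      (le_of_eq ?_)⟩
    rw [abs_of_nonneg (by positivity)]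
    field_simp
  · have := f1.smul lam
    refine ⟨this.smooth, by positivity, by positivity, fun w hw => (this.le w hw).mono ?_⟩
    rw [abs_of_nonneg hlam.le]
    have := le_abs_self c1
    calc lam * c1 * (A ^ 2 * X) ≤ lam * |c1| * (A ^ 2 * X) := by gcongr
      _ = _ := by ring
  · refine ⟨f0.smooth, by positivity, by positivity, fun w hw => (f0.le w hw).mono ?_⟩
    calc c0 * (A ^ 2 * X) ≤ |c0| * (A ^ 2 * X) := by gcongr; exact le_abs_self c0
      _ = |c0| * (1 * (A ^ 2 * X)) := by ring
      _ ≤ _ := by gcongr; exact h.one_le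

end SmoothEstimate

/-! ### The term along u: orthogonality of the velocity and one integration by parts. -/

section NormalPart

variable {N : ℕ}

lemma MemLp.int_mul {f g : Space N → ℝ} (hf : MemLp f 2 volume) (hg : MemLp g 2 volume) :
    Integrable (fun x => f x * g x) := hf.integrable_mul hg

namespace Ctrl

variable {s : ℕ} {lam A X : ℝ} {u : Fin 3 → Space N → ℝ}

lemma l2le_word (h : Ctrl s lam A X u) (a : Fin 3) {w : List (Fin N)}
    (hw : w.length = s + 1 ∨ w.length = s + 2) : L2le (D w (u a)) X := by
  match w, hw with
  | i :: w, hw =>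
    rw [D_cons' (h.nice a).smooth]
    exact h.dX a i w (by simpa using hw)

/-- Counted on u itself, the total order is s + 2, so Moser is applied with the uniform bound 1 and
yields X without a factor A. The factor A comes later from a derivative of the coefficient. -/
lemma comm_lap_le (h : Ctrl s lam A X u) (a b : Fin 3) (w : List (Fin N)) (hw : w.length = s) :
    L2le (comm w (u a) (lap (u b))) (N * (2 ^ s * (moserConst (s + 2) * (2 * X)))) := by
  have hm := (moserConst_pos (s + 2)).le
  have hX := h.X_nonneg
  have sa := (h.nice a).smooth
  have sb := (h.nice b).smooth
  rw [comm_lap sa sb]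
  refine (L2le.sum _ (S := fun _ => 2 ^ s * (moserConst (s + 2) * (2 * X))) (fun l _ => ?_)
    (fun l _ => (sa.comm ((sb.pd l).pd l) w).aesm) (fun _ _ => by positivity)).mono
    (le_of_eq (by simp))
  have m' := (moserConst_pos (w.length + 2)).le
  rw [← hw]
  refine comm_le (T := moserConst (w.length + 2) * (2 * X)) sa ((sb.pd l).pd l) (by positivity) w fun j w₁ w₂ hl => ?_
  have e1 : D w₁ (partialDeriv j (u a)) = D (w₁ ++ [j]) (u a) := by rw [D_append]; rfl
  have e2 : D w₂ (partialDeriv l (partialDeriv l (u b))) = D (w₂ ++ [l, l]) (u b) := by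
    rw [D_append]; rfl
  rw [e1, e2]
  refine (moser_two (q := s + 2) (h.nice a) (h.nice b) (h.sup a) (h.sup b) hX hX (by omega)
    (fun w hw => h.l2le_word a (Or.inr hw)) (fun w hw => h.l2le_word b (Or.inr hw)) _ _
    (by simp; omega)).mono (le_of_eq ?_)
  rw [hw]; ring

lemma moser_pd (h : Ctrl s lam A X u) (a b : Fin 3) (i j : Fin N) (w₁ w₂ : List (Fin N))
    (hw : w₁.length + w₂.length = s + 1) :
    L2le (D w₁ (partialDeriv i (u a)) * D w₂ (partialDeriv j (u b)))
      (moserConst (s + 1) * (2 * (A * X))) := by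
  have hX := h.X_nonneg
  refine (moser_two (q := s + 1) ((h.nice a).pd i).toNice ((h.nice b).pd j).toNice (h.supd a i)
    (h.supd b j) hX hX (by omega) (fun w hw => h.dX a i w (Or.inr hw))
    (fun w hw => h.dX b j w (Or.inr hw)) w₁ w₂ hw).mono (le_of_eq ?_)
  ring

/-- With one more derivative the total order on u is s + 3, beyond X. Every term, however, has a
derivative on each factor, so Moser is applied to the gradients, which are bounded by A, at order s
+ 1. -/
lemma pd_comm_lap_le (h : Ctrl s lam A X u) (a b : Fin 3) (i : Fin N) (w : List (Fin N))
    (hw : w.length = s) : L2le (partialDeriv i (comm w (u a) (lap (u b))))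
      (N * ((2 ^ (s + 1) + 1) * (moserConst (s + 1) * (2 * (A * X))))) := by
  have hm := (moserConst_pos (s + 1)).le
  have hX := h.X_nonneg
  have hA := h.A_nonneg
  have sa := (h.nice a).smooth
  have sb := (h.nice b).smooth
  rw [comm_lap sa sb]
  have e : partialDeriv i (∑ l, comm w (u a) (partialDeriv l (partialDeriv l (u b)))) =
      ∑ l, partialDeriv i (comm w (u a) (partialDeriv l (partialDeriv l (u b)))) :=
    D_sum _ _ (fun l _ => sa.comm ((sb.pd l).pd l) w) [i]
  rw [e]
  refine (L2le.sum _ (S := fun _ => (2 ^ (s + 1) + 1) * (moserConst (s + 1) * (2 * (A * X))))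
    (fun l _ => ?_) (fun l _ => ((sa.comm ((sb.pd l).pd l) w).pd i).aesm)
    (fun _ _ => by positivity)).mono (le_of_eq (by simp))
  have sl := (sb.pd l).pd l
  rw [partialDeriv_comm_eq sa sl, add_mul]
  refine L2le.sub ?_ ?_ (sa.comm sl _).aesm ((sa.pd i).mul (sl.word w)).aesm (by positivity)
    (by positivity)
  · have hl : (i :: w).length = s + 1 := by simp [hw]
    rw [← hl]
    refine comm_le (T := moserConst (i :: w).length * (2 * (A * X))) sa sl
      (by rw [hl]; positivity) (i :: w) fun j w₁ w₂ hl2 => ?_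
    have e2 : D w₂ (partialDeriv l (partialDeriv l (u b))) =
        D (w₂ ++ [l]) (partialDeriv l (u b)) := by rw [D_append]; rfl
    rw [e2, hl]
    exact h.moser_pd a b j l w₁ (w₂ ++ [l]) (by simp; omega)
  · have e2 : D w (partialDeriv l (partialDeriv l (u b))) =
        D (w ++ [l]) (partialDeriv l (u b)) := by rw [D_append]; rfl
    rw [e2, one_mul]
    exact h.moser_pd a b i l [] (w ++ [l]) (by simp; omega)

/-- The constant in the estimate of `∂_i (u_a [∂^w, u_b] Δu_c)`. -/
def _root_.LandauLifshitz.commConst (N s : ℕ) : ℝ :=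
  N * (2 ^ s * (moserConst (s + 2) * 2)) + N * ((2 ^ (s + 1) + 1) * (moserConst (s + 1) * 2))

lemma _root_.LandauLifshitz.commConst_nonneg (N s : ℕ) : 0 ≤ commConst N s := by
  have := (moserConst_pos (s + 1)).le
  have := (moserConst_pos (s + 2)).le
  unfold commConst; positivity

/-- If the derivative falls on `u a` it gives A times a commutator of size X; if it falls on the
commutator, the coefficient is at most 1 and the commutator gives AX. -/
lemma cb_mul_comm (h : Ctrl s lam A X u) (a b c : Fin 3) (w : List (Fin N)) (hw : w.length = s) :
    CB 1 (A * X) (commConst N s) (u a * comm w (u b) (lap (u c))) := by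
  have hX := h.X_nonneg
  have hA := h.A_nonneg
  have sa := (h.nice a).smooth
  have sb := (h.nice b).smooth
  have sc := (h.nice c).smooth
  have scm := sb.comm sc.lap w
  have m1 := (moserConst_pos (s + 1)).le
  have m2 := (moserConst_pos (s + 2)).le
  refine ⟨sa.mul scm, by positivity, commConst_nonneg N s, fun v hv => ?_⟩
  obtain ⟨i, rfl⟩ := List.length_eq_one_iff.1 hv
  rw [D_singleton, partialDeriv_mul sa scm]
  refine (((h.comm_lap_le b c w hw).bdd_mul (h.supd a i) hA).add
    ((h.pd_comm_lap_le b c i w hw).bdd_mul (h.sup a) zero_le_one)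
    ((sa.pd i).mul scm).aesm (sa.mul (scm.pd i)).aesm (by positivity) (by positivity)).mono
    (le_of_eq ?_)
  unfold commConst
  ring

/-- The component of index 1 is not small, only bounded by 1. The two small factors leave at least
one bound A wherever the derivatives are counted. -/
lemma moser_ppu (h : Ctrl s lam A X u) {a b : Fin 3} (ha : a ≠ 1) (hb : b ≠ 1)
    (w₁ w₂ w₃ : List (Fin N)) (hw : w₁.length + w₂.length + w₃.length = s + 1) :
    L2le (D w₁ (u a) * (D w₂ (u 1) * D w₃ (u b))) (moserConst (s + 1) * (3 * (A * X))) := by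
  have hX := h.X_nonneg
  have hA := h.A_nonneg
  have hm := (moserConst_pos (s + 1)).le
  -- When the derivatives are charged to the component of index 1, Moser gives B · X · B. Taking the
  -- minimum with 1 makes this linear in A.
  set B := min A 1 with hB
  have hB0 : 0 ≤ B := le_min hA zero_le_one
  have hBA : B ≤ A := min_le_left _ _
  have hB1 : B ≤ 1 := min_le_right _ _
  have := moser (q := s + 1) (h.nice a) (h.nice 1) (h.nice b)
    (fun x => le_min (h.supA a ha x) (h.sup a x)) (h.sup 1)
    (fun x => le_min (h.supA b hb x) (h.sup b x)) hX hX hX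
    (fun w hw => h.l2le_word a (Or.inl hw)) (fun w hw => h.l2le_word 1 (Or.inl hw))
    (fun w hw => h.l2le_word b (Or.inl hw)) w₁ w₂ w₃ hw
  rw [mul_assoc (D w₁ (u a))] at this
  refine this.mono ?_
  gcongr
  rw [← hB]
  have : B * X * B ≤ A * X * 1 := by gcongr
  have : B * X ≤ A * X := by gcongr
  nlinarith

/-- This is the λ part of the product with u. It is not a commutator, but its total order after one
more derivative is only s + 1, which X controls, and two of its factors are small. -/
lemma cb_mul_D_mul (h : Ctrl s lam A X u) {a b : Fin 3} (ha : a ≠ 1) (hb : b ≠ 1)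
    (w : List (Fin N)) (hw : w.length = s) :
    CB 1 (A * X) (3 * 2 ^ (s + 1) * 2 * moserConst (s + 1)) (u a * D w (u 1 * u b)) := by
  have hX := h.X_nonneg
  have hA := h.A_nonneg
  have hm := (moserConst_pos (s + 1)).le
  have sa := (h.nice a).smooth
  have s1 := (h.nice 1).smooth
  have sb := (h.nice b).smooth
  refine ⟨sa.mul ((s1.mul sb).word w), by positivity, by positivity, fun v hv => ?_⟩
  obtain ⟨i, rfl⟩ := List.length_eq_one_iff.1 hv
  rw [D_singleton, partialDeriv_mul sa ((s1.mul sb).word w)]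
  set T := moserConst (s + 1) * (3 * (A * X)) with hT
  have hT0 : 0 ≤ T := by positivity
  have b1 : L2le (partialDeriv i (u a) * D w (u 1 * u b)) (2 ^ s * T) := by
    have := mul_D_mul_le (sa.pd i) s1 sb hT0 (n := s)
      (fun w₁ w₂ hl => h.moser_ppu ha hb [i] w₁ w₂ (by simp; omega)) w [] [] (by simpa using hw)
    rwa [hw] at this
  have b2 : L2le (u a * partialDeriv i (D w (u 1 * u b))) (2 ^ (s + 1) * T) := by
    have := mul_D_mul_le sa s1 sb hT0 (n := s + 1)
      (fun w₁ w₂ hl => h.moser_ppu ha hb [] w₁ w₂ (by simpa using hl)) (i :: w) [] []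
      (by simpa using hw)
    rwa [List.length_cons, hw] at this
  refine (b1.add b2 ((sa.pd i).mul ((s1.mul sb).word w)).aesm
    (sa.mul (((s1.mul sb).word w).pd i)).aesm (by positivity) (by positivity)).mono ?_
  rw [hT]
  have : (2 : ℝ) ^ s ≤ 2 ^ (s + 1) := pow_le_pow_right₀ (by norm_num) (by omega)
  have h3 : 0 ≤ moserConst (s + 1) * (3 * (A * X)) := by positivity
  nlinarith

/-- Since u · (u × G) = 0 pointwise, also for G = ∂^w Δu, the terms in which all derivatives fall on
the Laplacian cancel, and only commutators remain. The λ part is kept as it is, being of lower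
order. -/
lemma sum_mul_velo (h : Ctrl s lam A X u) (w : List (Fin N)) :
    ∑ a, u a * D w (velo lam u a) =
      -((u 0 * comm w (u 1) (lap (u 2)) - u 0 * comm w (u 2) (lap (u 1)))
        + (u 1 * comm w (u 2) (lap (u 0)) - u 1 * comm w (u 0) (lap (u 2)))
        + (u 2 * comm w (u 0) (lap (u 1)) - u 2 * comm w (u 1) (lap (u 0))))
      + lam • (u 0 * D w (u 1 * u 2) - u 2 * D w (u 1 * u 0)) := by
  have s0 := (h.nice 0).smooth
  have s1 := (h.nice 1).smooth
  have s2 := (h.nice 2).smooth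
  rw [Fin.sum_univ_three]
  simp only [velo_eq, crs, Matrix.cons_val_zero, Matrix.cons_val_one, Matrix.cons_val]
  rw [D_add ((s1.mul s2.lap).sub (s2.mul s1.lap)).neg ((s1.mul s2).smul lam),
    D_add ((s2.mul s0.lap).sub (s0.mul s2.lap)).neg ((smooth_zero (N := N)).smul lam),
    D_add ((s0.mul s1.lap).sub (s1.mul s0.lap)).neg ((s1.mul s0).neg.smul lam)]
  simp only [D_neg, D_smul, D_zero]
  rw [D_sub (s1.mul s2.lap) (s2.mul s1.lap), D_sub (s2.mul s0.lap) (s0.mul s2.lap),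
    D_sub (s0.mul s1.lap) (s1.mul s0.lap)]
  unfold comm
  ext x
  simp only [Pi.add_apply, Pi.mul_apply, Pi.neg_apply, Pi.sub_apply, Pi.smul_apply, smul_eq_mul,
    Pi.zero_apply]
  ring

/-- The constant in the estimate of `∂_i (u · ∂^w v)`. -/
def _root_.LandauLifshitz.normalConst (N s : ℕ) : ℝ :=
  6 * commConst N s + 2 * (3 * 2 ^ (s + 1) * 2 * moserConst (s + 1))

lemma _root_.LandauLifshitz.normalConst_nonneg (N s : ℕ) : 0 ≤ normalConst N s := by
  have := (moserConst_pos (s + 1)).le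
  have := commConst_nonneg N s
  unfold normalConst; positivity

/-- The derivative of the velocity has a small component along u: after a further derivative it is
still bounded by λAX, although ∂ᵢ∂^w of the velocity alone is not controlled by X. -/
lemma normal_le (h : Ctrl s lam A X u) (w : List (Fin N)) (hw : w.length = s) (i : Fin N) :
    L2le (partialDeriv i (∑ a, u a * D w (velo lam u a)))
      (normalConst N s * (lam * (A * X))) := by
  have hX := h.X_nonneg
  have hA := h.A_nonneg
  have hl := h.one_le
  have hc := commConst_nonneg N s
  have hm := (moserConst_pos (s + 1)).le
  have n02 : (2 : Fin 3) ≠ 1 := by decide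
  have n01 : (0 : Fin 3) ≠ 1 := by decide
  rw [h.sum_mul_velo w, ← D_singleton]
  have c1 := ((((h.cb_mul_comm 0 1 2 w hw).sub (h.cb_mul_comm 0 2 1 w hw)).add
    ((h.cb_mul_comm 1 2 0 w hw).sub (h.cb_mul_comm 1 0 2 w hw))).add
    ((h.cb_mul_comm 2 0 1 w hw).sub (h.cb_mul_comm 2 1 0 w hw))).neg
  have c2 := ((h.cb_mul_D_mul n01 n02 w hw).sub (h.cb_mul_D_mul n02 n01 w hw)).smul lam
  refine ((c1.add c2).le [i] rfl).mono ?_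
  rw [abs_of_nonneg (by linarith)]
  unfold normalConst
  have h6 : 6 * commConst N s * (A * X) ≤ 6 * commConst N s * (lam * (A * X)) := by
    have h0 : 0 ≤ A * X := by positivity
    have : A * X ≤ lam * (A * X) := by nlinarith
    gcongr
  nlinarith

end Ctrl

/-- The amplitude of the component along `u` of the nonlinearity. -/
def gK (u : Fin 3 → Space N → ℝ) : Space N → ℝ :=
  (-2 : ℝ) • ∑ i, ∑ j, ∑ b,
    partialDeriv i (partialDeriv j (partialDeriv i (u b) * partialDeriv j (u b)))

lemma Ctrl.nice2_velo {s : ℕ} {lam A X : ℝ} {u : Fin 3 → Space N → ℝ} (h : Ctrl s lam A X u)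
    (a : Fin 3) : Nice2 (velo lam u a) := by
  have n02 : (2 : Fin 3) ≠ 1 := by decide
  have n01 : (0 : Fin 3) ≠ 1 := by decide
  have hf : ∀ a, Nice2 (field lam u a) := by
    intro a
    refine (h.nice a).lap.sub (Nice2.smul ?_ lam)
    fin_cases a
    · exact h.nice2 0 n01
    · exact nice2_zero
    · exact h.nice2 2 n02
  refine Nice2.neg ?_
  fin_cases a
  · exact ((h.nice 1).mul2 (hf 2)).sub ((h.nice 2).mul2 (hf 1))
  · exact ((h.nice 2).mul2 (hf 0)).sub ((h.nice 0).mul2 (hf 2))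
  · exact ((h.nice 0).mul2 (hf 1)).sub ((h.nice 1).mul2 (hf 0))

/-- The estimate of the component along `u` of the nonlinearity, one term at a time. -/
lemma Ctrl.integral_normal_term_le {s : ℕ} {lam A X : ℝ} {u : Fin 3 → Space N → ℝ}
    (h : Ctrl s lam A X u) (w : List (Fin N)) (hw : w.length = s)
    (hv : ∀ a, L2le (D w (velo lam u a)) X) (i j : Fin N) (b : Fin 3) :
    |∑ a, ∫ x, D w (velo lam u a) x *
      D w (u a * partialDeriv i (partialDeriv j (partialDeriv i (u b) * partialDeriv j (u b)))) x|
      ≤ (3 * (2 ^ s * (2 ^ (s + 1) * (3 * (moserConst s + moserConst (s + 1)))))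
        + normalConst N s * (2 ^ (s + 1) * (moserConst (s + 1) * 2))) * (lam * (A ^ 2 * X ^ 2)) := by
  have hX := h.X_nonneg
  have hA := h.A_nonneg
  have hl := h.one_le
  have m0 := (moserConst_pos s).le
  have m1 := (moserConst_pos (s + 1)).le
  set P := partialDeriv i (u b) with hP
  set Q := partialDeriv j (u b) with hQ
  have uP : IsU s A X P := h.isU_pd b i
  have uQ : IsU s A X Q := h.isU_pd b j
  set G := P * Q with hG
  have nG : Nice2 G := uP.nice.mul uQ.nice.toNice
  set H := partialDeriv i (partialDeriv j G) with hH
  have nH : Nice2 H := (nG.toNice.pd j).toNice.pd i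
  have nv := fun a => (h.nice2_velo a)
  -- split into the commutator and the main term
  have hsplit : ∀ a, ∫ x, D w (velo lam u a) x * D w (u a * H) x =
      (∫ x, D w (velo lam u a) x * comm w (u a) H x) +
        ∫ x, (u a * D w (velo lam u a)) x * D w H x := by
    intro a
    rw [← integral_add (MemLp.int_mul ((nv a).memLp_word w) ((h.nice a).comm nH w).memLp0)
      (MemLp.int_mul ((h.nice a).mul2 ((nv a).word w)).memLp0 (nH.memLp_word w))]
    congr 1
    ext x
    simp only [comm, Pi.sub_apply, Pi.mul_apply]
    ring
  -- The derivative ∂ᵢ is moved from H onto the scalar product with u. What remains, ∂^w∂ⱼ of a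
  -- product of gradients, has order s + 1 in those gradients.
  have hmain : ∑ a, ∫ x, (u a * D w (velo lam u a)) x * D w H x =
      -∫ x, partialDeriv i (∑ a, u a * D w (velo lam u a)) x * D w (partialDeriv j G) x := by
    rw [← integral_finsetSum _ fun a _ =>
      (MemLp.int_mul ((h.nice a).mul2 ((nv a).word w)).memLp0 (nH.memLp_word w))]
    have ns : Nice2 (∑ a, u a * D w (velo lam u a)) :=
      Nice2.sum _ fun a _ => (h.nice a).mul2 ((nv a).word w)
    rw [ns.integral_partialDeriv_mul ((nG.toNice.pd j).word w), neg_neg]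
    congr 1
    ext x
    rw [hH, D_partialDeriv (nG.smooth.pd j), Finset.sum_apply, Finset.sum_mul]
  -- The commutator puts at least one derivative on `u a`. Its terms are thus cubic in gradients, of
  -- total order (s − 1) + 2 = s + 1, and bounded by A²X.
  have hcomm : ∀ a, L2le (comm w (u a) H)
      (2 ^ s * (2 ^ (s + 1) * (3 * (moserConst s + moserConst (s + 1)) * (A ^ 2 * X)))) := by
    intro a
    rw [← hw]
    refine comm_le (T := 2 ^ (w.length + 1) * (3 * (moserConst w.length + moserConst (w.length + 1))
      * (A ^ 2 * X))) (h.nice a).smooth nH.smooth (by rw [hw]; positivity) w fun l w₁ w₂ hl2 => ?_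
    rw [hw] at hl2 ⊢
    have e : D w₂ H = D (w₂ ++ [i, j]) (D [] P * D [] Q) := by rw [D_append]; rfl
    rw [e]
    have sl := ((h.nice a).smooth.pd l).word w₁
    refine (mul_D_mul_le sl uP.nice.smooth uQ.nice.smooth
      (T := 3 * (moserConst s + moserConst (s + 1)) * (A ^ 2 * X)) (by positivity)
      (n := w₂.length + 2) (fun v₁ v₂ hv => ?_) (w₂ ++ [i, j]) [] [] (by simp)).mono ?_
    · rw [← mul_assoc]
      exact (h.isU_pd a l).moser uP uQ w₁ v₁ v₂ (by omega)
    · gcongr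
      · norm_num
      · simp; omega
  have hG2 : L2le (D w (partialDeriv j G)) (2 ^ (s + 1) * (moserConst (s + 1) * (2 * (A * X)))) := by
    rw [← D_cons' nG.smooth]
    have := D_mul2_le uP.nice.smooth uQ.nice.smooth (n := s + 1)
      (T := moserConst (s + 1) * (2 * (A * X))) (by positivity)
      (fun w₁ w₂ hl => h.moser_pd b b i j w₁ w₂ hl) (j :: w) [] [] (by simpa using hw)
    simpa [hw] using this
  simp only [hsplit]
  rw [Finset.sum_add_distrib, hmain]
  refine (abs_add_le _ _).trans ?_
  rw [add_mul, abs_neg]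
  have hn0 := normalConst_nonneg N s
  refine add_le_add ?_ ?_
  · refine (Finset.abs_sum_le_sum_abs _ _).trans ((Finset.sum_le_sum fun a _ =>
      (hv a).abs_integral_mul_le (hcomm a) ((nv a).smooth.word w).aesm
        ((h.nice a).smooth.comm nH.smooth w).aesm hX (by positivity)).trans ?_)
    simp only [Finset.sum_const, Finset.card_univ, Fintype.card_fin, nsmul_eq_mul]
    set K : ℝ := 2 ^ s * (2 ^ (s + 1) * (3 * (moserConst s + moserConst (s + 1)))) with hK
    have hK0 : 0 ≤ K := by positivity
    have h0 : 0 ≤ 3 * K * (A ^ 2 * X ^ 2) := by positivity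
    -- This part carries no λ; the factor is inserted through 1 ≤ λ.
    calc _ = 3 * K * (A ^ 2 * X ^ 2) * 1 := by rw [hK]; push_cast; ring
      _ ≤ 3 * K * (A ^ 2 * X ^ 2) * lam := by gcongr
      _ = _ := by ring
  · refine ((h.normal_le w hw i).abs_integral_mul_le hG2 ?_ ((nG.smooth.pd j).word w).aesm
      (by positivity) (by positivity)).trans (le_of_eq ?_)
    · exact ((Smooth.sum fun a _ => ((h.nice a).smooth.mul ((nv a).smooth.word w))).pd i).aesm
    · ring

/-- The **energy estimate** for smooth maps. -/
theorem smooth_estimate (N s : ℕ) : ∃ C, 0 ≤ C ∧ ∀ (lam A X : ℝ) (u : Fin 3 → Space N → ℝ),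
    Ctrl s lam A X u → ∀ w : List (Fin N), w.length = s →
    (∀ a, L2le (D w (velo lam u a)) X) →
    ∑ a, ∫ x, D w (velo lam u a) x * D w (cub lam u a + u a * gK u) x ≤
      C * (lam * (A ^ 2 * X ^ 2)) := by
  obtain ⟨c, hc0, hc⟩ := cub_le N s
  set K := 3 * (2 ^ s * (2 ^ (s + 1) * (3 * (moserConst s + moserConst (s + 1)))))
        + normalConst N s * (2 ^ (s + 1) * (moserConst (s + 1) * 2)) with hK
  have m0 := (moserConst_pos s).le
  have m1 := (moserConst_pos (s + 1)).le
  have hn0 := normalConst_nonneg N s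
  have hK0 : 0 ≤ K := by positivity
  refine ⟨3 * c + 2 * (N * (N * (3 * K))), by positivity, fun lam A X u h w hw hv => ?_⟩
  have hX := h.X_nonneg
  have hA := h.A_nonneg
  have hl := h.one_le
  have nv := fun a => (h.nice2_velo a)
  have hcub := fun a => hc lam A X u h a
  let H : Fin N → Fin N → Fin 3 → Space N → ℝ := fun i j b =>
    partialDeriv i (partialDeriv j (partialDeriv i (u b) * partialDeriv j (u b)))
  have nH : ∀ i j b, Nice2 (H i j b) := fun i j b =>
    (((((h.nice b).pd i).mul ((h.nice b).pd j).toNice).toNice.pd j).toNice.pd i)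
  have ng : Nice2 (gK u) := by
    refine Nice2.smul ?_ _
    exact Nice2.sum _ fun i _ => Nice2.sum _ fun j _ => Nice2.sum _ fun b _ => nH i j b
  have eg : ∀ a, D w (u a * gK u) = (-2 : ℝ) • ∑ i, ∑ j, ∑ b, D w (u a * H i j b) := by
    intro a
    have sm : ∀ i j b, Smooth (u a * H i j b) := fun i j b =>
      (h.nice a).smooth.mul (nH i j b).smooth
    have : u a * gK u = (-2 : ℝ) • ∑ i, ∑ j, ∑ b, u a * H i j b := by
      unfold gK
      rw [mul_smul_comm]
      simp only [Finset.mul_sum, H]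
    rw [this, D_smul, D_sum _ _ fun i _ => Smooth.sum fun j _ => Smooth.sum fun b _ => sm i j b]
    congr 1
    refine Finset.sum_congr rfl fun i _ => ?_
    rw [D_sum _ _ fun j _ => Smooth.sum fun b _ => sm i j b]
    refine Finset.sum_congr rfl fun j _ => ?_
    rw [D_sum _ _ fun b _ => sm i j b]
  have iH : ∀ a i j b, Integrable (fun x => D w (velo lam u a) x * D w (u a * H i j b) x) :=
    fun a i j b => ((nv a).memLp_word w).integrable_mul
      (((h.nice a).mul2 (nH i j b)).memLp_word w)
  have n02 : (2 : Fin 3) ≠ 1 := by decide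
  have n01 : (0 : Fin 3) ≠ 1 := by decide
  have mc : ∀ a, MemLp (D w (cub lam u a)) 2 volume := fun a =>
    ((hcub a).le w hw).memLp ((hcub a).smooth.word w).aesm
  have e1 : ∀ a, ∫ x, D w (velo lam u a) x * D w (cub lam u a + u a * gK u) x =
      (∫ x, D w (velo lam u a) x * D w (cub lam u a) x) +
      (-2) * ∑ i, ∑ j, ∑ b, ∫ x, D w (velo lam u a) x * D w (u a * H i j b) x := by
    intro a
    rw [D_add (hcub a).smooth ((h.nice a).smooth.mul ng.smooth)]
    have : ∀ x, D w (velo lam u a) x * (D w (cub lam u a) + D w (u a * gK u)) x =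
        D w (velo lam u a) x * D w (cub lam u a) x +
        (-2) * ∑ i, ∑ j, ∑ b, D w (velo lam u a) x * D w (u a * H i j b) x := by
      intro x
      rw [Pi.add_apply, mul_add, eg a]
      simp only [Pi.smul_apply, Finset.sum_apply, smul_eq_mul, Finset.mul_sum]
      congr 1
      refine Finset.sum_congr rfl fun i _ => Finset.sum_congr rfl fun j _ =>
        Finset.sum_congr rfl fun b _ => ?_
      ring
    simp only [this]
    rw [integral_add (MemLp.int_mul ((nv a).memLp_word w) (mc a))
      (Integrable.const_mul (integrable_finsetSum _ fun i _ => integrable_finsetSum _ fun j _ =>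
        integrable_finsetSum _ fun b _ => iH a i j b) _), integral_const_mul,
      integral_finsetSum _ fun i _ => integrable_finsetSum _ fun j _ =>
        integrable_finsetSum _ fun b _ => iH a i j b]
    congr 2
    refine Finset.sum_congr rfl fun i _ => ?_
    rw [integral_finsetSum _ fun j _ => integrable_finsetSum _ fun b _ => iH a i j b]
    refine Finset.sum_congr rfl fun j _ => ?_
    rw [integral_finsetSum _ fun b _ => iH a i j b]
  simp only [e1]
  rw [Finset.sum_add_distrib, ← Finset.mul_sum, add_mul]
  refine add_le_add ?_ ?_
  · refine (Finset.sum_le_sum fun a _ => (le_abs_self _).trans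
      ((hv a).abs_integral_mul_le ((hcub a).le w hw) ((nv a).smooth.word w).aesm
        ((hcub a).smooth.word w).aesm hX (by positivity))).trans (le_of_eq ?_)
    simp only [Finset.sum_const, Finset.card_univ, Fintype.card_fin, nsmul_eq_mul]
    push_cast; ring
  -- The sum over the components a is made innermost: the cancellation in the product of u with the
  -- derivative of the velocity is visible only after this summation.
  · have e2 : ∑ a, ∑ i, ∑ j, ∑ b, ∫ x, D w (velo lam u a) x * D w (u a * H i j b) x =
        ∑ i, ∑ j, ∑ b, ∑ a, ∫ x, D w (velo lam u a) x * D w (u a * H i j b) x := by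
      rw [Finset.sum_comm]
      refine Finset.sum_congr rfl fun i _ => ?_
      rw [Finset.sum_comm]
      refine Finset.sum_congr rfl fun j _ => ?_
      rw [Finset.sum_comm]
    rw [e2]
    have hb : |∑ i, ∑ j, ∑ b, ∑ a, ∫ x, D w (velo lam u a) x * D w (u a * H i j b) x| ≤
        N * (N * (3 * (K * (lam * (A ^ 2 * X ^ 2))))) := by
      refine (Finset.abs_sum_le_sum_abs _ _).trans ((Finset.sum_le_sum fun i _ =>
        (Finset.abs_sum_le_sum_abs _ _).trans (Finset.sum_le_sum fun j _ =>
        (Finset.abs_sum_le_sum_abs _ _).trans (Finset.sum_le_sum fun b _ =>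
        h.integral_normal_term_le w hw hv i j b))).trans (le_of_eq ?_))
      simp [← hK]
    have := neg_le_of_abs_le hb
    linarith

end NormalPart

/-! ### Weak derivatives along words, and their link with multi-indices. -/

section WeakDerivatives

variable {N : ℕ}

lemma IsTest.word {φ : Space N → ℝ} (hφ : IsTest φ) (w : List (Fin N)) : IsTest (D w φ) := by
  induction w with
  | nil => exact hφ
  | cons i w ih =>
    refine ⟨Smooth.pd ih.1 i, ?_⟩
    have := ih.2.fderiv (𝕜 := ℝ)
    exact this.comp_left (g := fun L : Space N →L[ℝ] ℝ => L (EuclideanSpace.single i 1)) rfl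

lemma IsTest.smooth {φ : Space N → ℝ} (hφ : IsTest φ) : Smooth φ := hφ.1

lemma IsTest.smooth_mul {φ f : Space N → ℝ} (hf : Smooth f) (hφ : IsTest φ) : IsTest (f * φ) :=
  ⟨hf.mul hφ.1, hφ.2.mul_left⟩

lemma IsTest.add {φ ψ : Space N → ℝ} (hφ : IsTest φ) (hψ : IsTest ψ) : IsTest (φ + ψ) :=
  ⟨hφ.smooth.add hψ.smooth, hφ.2.add hψ.2⟩

lemma IsTest.smul {φ : Space N → ℝ} (hφ : IsTest φ) (c : ℝ) : IsTest (c • φ) :=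
  ⟨hφ.smooth.smul c, hφ.2.comp_left (g := fun y : ℝ => c • y) (by simp)⟩

lemma isTest_zero : IsTest (0 : Space N → ℝ) := ⟨contDiff_const, HasCompactSupport.zero⟩

lemma IsTest.bdd {φ : Space N → ℝ} (hφ : IsTest φ) : ∃ C, ∀ x, |φ x| ≤ C :=
  hφ.2.exists_bound_of_continuous hφ.smooth.continuous

lemma IsTest.memLp {φ : Space N → ℝ} (hφ : IsTest φ) (p : ℝ≥0∞) : MemLp φ p volume :=
  hφ.smooth.continuous.memLp_of_hasCompactSupport hφ.2

lemma LocallyIntegrable.int_mul_test {f φ : Space N → ℝ} (hf : LocallyIntegrable f)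
    (hφ : IsTest φ) : Integrable (fun x => f x * φ x) := by
  have := hf.integrable_smul_right_of_hasCompactSupport hφ.smooth.continuous hφ.2
  simpa using this

lemma integral_mul_D_test {F φ : Space N → ℝ} (hF : Smooth F) (hφ : IsTest φ)
    (w : List (Fin N)) : ∫ x, F x * D w φ x = (-1) ^ w.length * ∫ x, D w F x * φ x := by
  induction w generalizing φ with
  | nil => simp
  | cons i w ih =>
    have hl : ∀ {G : Space N → ℝ}, Smooth G → LocallyIntegrable G := fun hG =>
      hG.continuous.locallyIntegrable
    have h1 : ∫ x, D w F x * partialDeriv i φ x = -∫ x, partialDeriv i (D w F) x * φ x := by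
      have h := integral_mul_fderiv_eq_neg_fderiv_mul_of_integrable
        (μ := (volume : Measure (Space N)))
        (f := D w F) (g := φ) (v := EuclideanSpace.single i 1)
        (LocallyIntegrable.int_mul_test (hl (hF.word (i :: w))) hφ)
        (LocallyIntegrable.int_mul_test (hl (hF.word w)) (hφ.word [i]))
        (LocallyIntegrable.int_mul_test (hl (hF.word w)) hφ)
        (fun x _ => (hF.word w).differentiable x) (fun x _ => hφ.smooth.differentiable x)
      exact h
    have h2 := ih (hφ.word [i])
    rw [D_singleton] at h2
    rw [D_cons' hφ.smooth, h2, h1, D_cons]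
    simp only [List.length_cons, pow_succ]
    ring

/-- `g` is the weak derivative of `f` along the word `w`. -/
def WD (w : List (Fin N)) (f g : Space N → ℝ) : Prop :=
  LocallyIntegrable f ∧ LocallyIntegrable g ∧
    ∀ φ : Space N → ℝ, IsTest φ → ∫ x, f x * D w φ x = (-1) ^ w.length * ∫ x, g x * φ x

lemma WD.perm {w w' : List (Fin N)} {f g : Space N → ℝ} (h : WD w f g) (hw : w.Perm w') :
    WD w' f g := by
  refine ⟨h.1, h.2.1, fun φ hφ => ?_⟩
  rw [← D_perm hφ.smooth hw, h.2.2 φ hφ, hw.length_eq]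

lemma Smooth.wd {F : Space N → ℝ} (hF : Smooth F) (w : List (Fin N)) : WD w F (D w F) :=
  ⟨hF.continuous.locallyIntegrable, (hF.word w).continuous.locallyIntegrable,
    fun _ hφ => integral_mul_D_test hF hφ w⟩

lemma ae_eq_of_test {f g : Space N → ℝ} (hf : LocallyIntegrable f) (hg : LocallyIntegrable g)
    (h : ∀ φ, IsTest φ → ∫ x, f x * φ x = ∫ x, g x * φ x) : f =ᵐ[volume] g := by
  refine ae_eq_of_integral_contDiff_smul_eq hf hg fun φ h1 h2 => ?_
  have := h φ ⟨h1, h2⟩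
  simpa [mul_comm] using this

lemma WD.unique {w : List (Fin N)} {f g g' : Space N → ℝ} (h : WD w f g) (h' : WD w f g') :
    g =ᵐ[volume] g' := by
  refine ae_eq_of_test h.2.1 h'.2.1 fun φ hφ => ?_
  have e := (h.2.2 φ hφ).symm.trans (h'.2.2 φ hφ)
  exact mul_left_cancel₀ (pow_ne_zero _ (by norm_num)) e

lemma integral_mul_congr {f f' φ : Space N → ℝ} (h : f =ᵐ[volume] f') :
    ∫ x, f x * φ x = ∫ x, f' x * φ x :=
  integral_congr_ae (h.mono fun x hx => by simp only [hx])

lemma WD.congr {w : List (Fin N)} {f f' g g' : Space N → ℝ} (h : WD w f g)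
    (hf : f =ᵐ[volume] f') (hg : g =ᵐ[volume] g') : WD w f' g' := by
  refine ⟨h.1.congr hf, h.2.1.congr hg, fun φ hφ => ?_⟩
  rw [← integral_mul_congr hf, ← integral_mul_congr hg, h.2.2 φ hφ]

lemma WD.append {w w' : List (Fin N)} {f g k : Space N → ℝ} (h : WD w f g) (h' : WD w' g k) :
    WD (w ++ w') f k := by
  refine ⟨h.1, h'.2.1, fun φ hφ => ?_⟩
  rw [D_append, h.2.2 _ (hφ.word w'), h'.2.2 φ hφ, List.length_append, pow_add, mul_assoc]

lemma WD.nil {f : Space N → ℝ} (hf : LocallyIntegrable f) : WD [] f f :=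
  ⟨hf, hf, fun φ _ => by simp⟩

/-- The derivative ∂^w' of a test function is again a test function, so the identity for f along `w
++ w'` is one for g along `w'`. In this way regularity of f passes to its weak derivatives. -/
lemma WD.of_append {w w' : List (Fin N)} {f g k : Space N → ℝ} (h : WD w f g)
    (h' : WD (w ++ w') f k) : WD w' g k := by
  refine ⟨h.2.1, h'.2.1, fun φ hφ => ?_⟩
  have e := h'.2.2 φ hφ
  rw [D_append, h.2.2 _ (hφ.word w'), List.length_append, pow_add, mul_assoc] at e
  exact mul_left_cancel₀ (pow_ne_zero _ (by norm_num)) e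

lemma WD.smul {w : List (Fin N)} {f g : Space N → ℝ} (h : WD w f g) (c : ℝ) :
    WD w (c • f) (c • g) := by
  refine ⟨h.1.smul c, h.2.1.smul c, fun φ hφ => ?_⟩
  simp only [Pi.smul_apply, smul_eq_mul, mul_assoc, integral_const_mul]
  rw [h.2.2 φ hφ]; ring

lemma WD.add {w : List (Fin N)} {f g f' g' : Space N → ℝ} (h : WD w f g) (h' : WD w f' g') :
    WD w (f + f') (g + g') := by
  refine ⟨h.1.add h'.1, h.2.1.add h'.2.1, fun φ hφ => ?_⟩
  simp only [Pi.add_apply, add_mul]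
  rw [integral_add (LocallyIntegrable.int_mul_test h.1 (hφ.word w))
    (LocallyIntegrable.int_mul_test h'.1 (hφ.word w)),
    integral_add (LocallyIntegrable.int_mul_test h.2.1 hφ)
    (LocallyIntegrable.int_mul_test h'.2.1 hφ), h.2.2 φ hφ, h'.2.2 φ hφ]
  ring

lemma WD.sub {w : List (Fin N)} {f g f' g' : Space N → ℝ} (h : WD w f g) (h' : WD w f' g') :
    WD w (f - f') (g - g') := by
  have := h.add (h'.smul (-1))
  simpa [sub_eq_add_neg] using this

lemma WD.zero (w : List (Fin N)) : WD w (0 : Space N → ℝ) 0 := by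
  have := (smooth_zero (N := N)).wd w
  rwa [D_zero] at this

lemma WD.sum {ι : Type*} (s : Finset ι) {w : List (Fin N)} {f g : ι → Space N → ℝ}
    (h : ∀ i ∈ s, WD w (f i) (g i)) : WD w (∑ i ∈ s, f i) (∑ i ∈ s, g i) := by
  classical
  induction s using Finset.induction_on with
  | empty => simpa using WD.zero w
  | insert a s ha ih =>
    rw [Finset.sum_insert ha, Finset.sum_insert ha]
    exact (h a (Finset.mem_insert_self _ _)).add
      (ih fun i hi => h i (Finset.mem_insert_of_mem hi))

/-- The ordered word of a multi-index. -/
def wordOf (α : Fin N → ℕ) : List (Fin N) :=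
  (List.finRange N).flatMap fun i => List.replicate (α i) i

lemma iterate_partialDeriv (i : Fin N) (n : ℕ) (φ : Space N → ℝ) :
    (partialDeriv i)^[n] φ = D (List.replicate n i) φ := by
  induction n with
  | zero => rfl
  | succ n ih => rw [Function.iterate_succ_apply', ih, List.replicate_succ, D_cons]

lemma multiDeriv_eq (α : Fin N → ℕ) (φ : Space N → ℝ) : multiDeriv α φ = D (wordOf α) φ := by
  unfold multiDeriv wordOf
  induction List.finRange N with
  | nil => rfl
  | cons i l ih => rw [List.foldr_cons, ih, List.flatMap_cons, D_append, iterate_partialDeriv]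

lemma count_wordOf (α : Fin N → ℕ) (j : Fin N) : (wordOf α).count j = α j := by
  unfold wordOf
  rw [List.count_flatMap]
  have : (List.count j ∘ fun i => List.replicate (α i) i) = fun i => if i = j then α j else 0 := by
    ext i
    simp only [Function.comp, List.count_replicate, beq_iff_eq]
    split_ifs with h
    · rw [h]
    · rfl
  rw [this, ← List.ofFn_eq_map, List.sum_ofFn]
  simp

lemma length_wordOf (α : Fin N → ℕ) : (wordOf α).length = ∑ i, α i := by
  unfold wordOf
  rw [List.length_flatMap]
  simp [← List.ofFn_eq_map, List.sum_ofFn]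

/-- The bridge between the multi-indices of the statement and the words of the proof. -/
lemma hasWeakDeriv_iff {α : Fin N → ℕ} {f g : Space N → ℝ} :
    HasWeakDeriv α f g ↔ WD (wordOf α) f g := by
  unfold HasWeakDeriv WD
  simp only [multiDeriv_eq, length_wordOf]

/-- The multi-index of a word. -/
def cnt (w : List (Fin N)) : Fin N → ℕ := fun i => w.count i

lemma wordOf_cnt (w : List (Fin N)) : (wordOf (cnt w)).Perm w := by
  rw [List.perm_iff_count]
  intro i
  rw [count_wordOf]; rfl

lemma sum_cnt (w : List (Fin N)) : ∑ i, cnt w i = w.length := by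
  rw [← length_wordOf, (wordOf_cnt w).length_eq]

lemma cnt_wordOf (α : Fin N → ℕ) : cnt (wordOf α) = α := by
  ext i; exact count_wordOf α i

/-- The weak derivative along a word. -/
def W (w : List (Fin N)) (f : Space N → ℝ) : Space N → ℝ := weakDeriv (cnt w) f

lemma W_wordOf (α : Fin N → ℕ) (f : Space N → ℝ) : W (wordOf α) f = weakDeriv α f := by
  unfold W; rw [cnt_wordOf]

/-- As soon as some weak derivative exists, the chosen one is genuine and not the default value 0.
-/
lemma WD.wd_W {w : List (Fin N)} {f g : Space N → ℝ} (h : WD w f g) : WD w f (W w f) := by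
  have h1 : ∃ g, HasWeakDeriv (cnt w) f g := ⟨g, hasWeakDeriv_iff.2 (h.perm (wordOf_cnt w).symm)⟩
  have h2 : HasWeakDeriv (cnt w) f (W w f) := by
    unfold W weakDeriv
    rw [dif_pos h1]
    exact h1.choose_spec
  exact (hasWeakDeriv_iff.1 h2).perm (wordOf_cnt w)

lemma WD.W_ae {w : List (Fin N)} {f g : Space N → ℝ} (h : WD w f g) : W w f =ᵐ[volume] g :=
  h.wd_W.unique h

end WeakDerivatives

/-! ### Mollification: smoothness, Young's inequality, convergence. -/

section Mollifier

variable {N : ℕ}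

/-- The convolution of a kernel with a function. -/
def conv (κ f : Space N → ℝ) : Space N → ℝ :=
  convolution κ f (ContinuousLinearMap.lsmul ℝ ℝ) volume

lemma conv_apply (κ f : Space N → ℝ) (x : Space N) : conv κ f x = ∫ t, κ t * f (x - t) := rfl

lemma conv_apply_swap (κ f : Space N → ℝ) (x : Space N) :
    conv κ f x = ∫ t, f t * κ (x - t) := by
  unfold conv
  rw [convolution_eq_swap]
  simp [mul_comm]

lemma smooth_conv {κ f : Space N → ℝ} (hκ : IsTest κ) (hf : LocallyIntegrable f) :
    Smooth (conv κ f) := hκ.2.contDiff_convolution_left _ hκ.1 hf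

lemma partialDeriv_conv {κ f : Space N → ℝ} (hκ : IsTest κ) (hf : LocallyIntegrable f)
    (i : Fin N) : partialDeriv i (conv κ f) = conv (partialDeriv i κ) f := by
  have e : ∀ κ : Space N → ℝ,
      conv κ f = convolution f κ (ContinuousLinearMap.lsmul ℝ ℝ) volume := fun κ => by
    ext x; rw [conv_apply_swap]; rfl
  ext x
  rw [e, e]
  have h := hκ.2.hasFDerivAt_convolution_right (𝕜 := ℝ) (ContinuousLinearMap.lsmul ℝ ℝ) hf
    (hκ.1.of_le (by exact_mod_cast le_top)) x
  unfold partialDeriv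
  rw [h.fderiv]
  exact convolution_precompR_apply (ContinuousLinearMap.lsmul ℝ ℝ) hf (hκ.2.fderiv (𝕜 := ℝ))
    (hκ.1.continuous_fderiv (by simp)) x _

lemma D_conv {κ f : Space N → ℝ} (hκ : IsTest κ) (hf : LocallyIntegrable f)
    (w : List (Fin N)) : D w (conv κ f) = conv (D w κ) f := by
  induction w with
  | nil => rfl
  | cons i w ih => rw [D_cons, ih, partialDeriv_conv (hκ.word w) hf, D_cons]

lemma partialDeriv_comp_sub {κ : Space N → ℝ} (hκ : Smooth κ) (x : Space N) (i : Fin N) :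
    partialDeriv i (fun y => κ (x - y)) = fun y => -partialDeriv i κ (x - y) := by
  ext y
  unfold partialDeriv
  have h1 : HasFDerivAt (fun y : Space N => x - y) (-ContinuousLinearMap.id ℝ (Space N)) y := by
    simpa using (hasFDerivAt_id y).const_sub x
  have h2 := ((hκ.differentiable (x - y)).hasFDerivAt).comp y h1
  have h3 : fderiv ℝ (fun y => κ (x - y)) y =
      (fderiv ℝ κ (x - y)).comp (-ContinuousLinearMap.id ℝ (Space N)) := h2.fderiv
  rw [h3]
  simp

lemma D_comp_sub {κ : Space N → ℝ} (hκ : Smooth κ) (x : Space N) (w : List (Fin N)) :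
    D w (fun y => κ (x - y)) = fun y => (-1) ^ w.length * D w κ (x - y) := by
  induction w with
  | nil => simp
  | cons i w ih =>
    rw [D_cons, ih]
    have : (fun y => (-1 : ℝ) ^ w.length * D w κ (x - y)) =
      ((-1 : ℝ) ^ w.length) • fun y => D w κ (x - y) := by ext y; simp
    rw [this, partialDeriv_smul, partialDeriv_comp_sub (hκ.word w)]
    ext y
    simp only [Pi.smul_apply, smul_eq_mul, D_cons, List.length_cons, pow_succ]
    ring

lemma IsTest.comp_sub {κ : Space N → ℝ} (hκ : IsTest κ) (x : Space N) :
    IsTest (fun y => κ (x - y)) :=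
  ⟨hκ.1.comp (contDiff_const.sub contDiff_id),
    hκ.2.comp_homeomorph (Homeomorph.subLeft x)⟩

/-- For fixed x, the function y ↦ κ(x − y) is a test function. The weak derivative moves the
derivatives off the kernel, and the two signs (−1)^|w| cancel. -/
lemma conv_of_wd {κ f g : Space N → ℝ} (hκ : IsTest κ) {w : List (Fin N)} (h : WD w f g) :
    D w (conv κ f) = conv κ g := by
  rw [D_conv hκ h.1]
  ext x
  rw [conv_apply_swap, conv_apply_swap]
  have := h.2.2 _ (hκ.comp_sub x)
  rw [D_comp_sub hκ.smooth] at this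
  have e : ∀ y, f y * ((-1) ^ w.length * D w κ (x - y)) =
      (-1) ^ w.length * (f y * D w κ (x - y)) := fun y => by ring
  simp only [e] at this
  rw [integral_const_mul] at this
  exact mul_left_cancel₀ (pow_ne_zero _ (by norm_num)) this

lemma abs_conv_le {κ f : Space N → ℝ} (hκ : IsTest κ) {c : ℝ} (hf : ∀ᵐ x, |f x| ≤ c)
    (x : Space N) : |conv κ f x| ≤ (∫ t, |κ t|) * c := by
  rw [conv_apply_swap, ← Real.norm_eq_abs]
  have hi : Integrable κ := memLp_one_iff_integrable.1 (hκ.memLp 1)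
  have h2 : Integrable (fun t => c * |κ (x - t)|) := ((hi.comp_sub_left x).abs).const_mul c
  refine (norm_integral_le_of_norm_le h2 ?_).trans (le_of_eq ?_)
  · filter_upwards [hf] with t ht
    rw [norm_mul, Real.norm_eq_abs, Real.norm_eq_abs]
    gcongr
  · rw [integral_const_mul, integral_sub_left_eq_self (fun t => |κ t|), mul_comm]

/-- Young's inequality for L¹ and L²: |κ| is split into two square roots, Cauchy-Schwarz is applied
at each point, and Tonelli and translation invariance give the integral. -/
lemma eLpNorm_conv_le {κ f : Space N → ℝ} (hκ : IsTest κ) (hf : AEStronglyMeasurable f volume) :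
    eLpNorm (conv κ f) 2 volume ≤ ENNReal.ofReal (∫ t, |κ t|) * eLpNorm f 2 volume := by
  -- reduce to a measurable function
  wlog hfm : StronglyMeasurable f generalizing f
  · have h := this hf.stronglyMeasurable_mk.aestronglyMeasurable hf.stronglyMeasurable_mk
    have e : conv κ f = conv κ (hf.mk f) :=
      convolution_congr _ (Filter.EventuallyEq.refl _ κ) hf.ae_eq_mk
    rw [e, eLpNorm_congr_ae hf.ae_eq_mk]
    exact h
  have hi : Integrable κ := memLp_one_iff_integrable.1 (hκ.memLp 1)
  set k : Space N → ℝ≥0∞ := fun t => ‖κ t‖ₑ with hk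
  set K : ℝ≥0∞ := ∫⁻ t, k t with hK
  have hKe : ENNReal.ofReal (∫ t, |κ t|) = K := by
    have := ofReal_integral_norm_eq_lintegral_enorm hi
    simpa using this
  have hkm : Measurable k := hκ.smooth.continuous.measurable.enorm
  have hfe : Measurable fun x => ‖f x‖ₑ := hfm.measurable.enorm
  have hpt : ∀ x, ‖conv κ f x‖ₑ ^ 2 ≤ K * ∫⁻ t, k t * ‖f (x - t)‖ₑ ^ 2 := by
    intro x
    have h1 : ‖conv κ f x‖ₑ ≤ ∫⁻ t, (k t) ^ (1 / 2 : ℝ) * ((k t) ^ (1 / 2 : ℝ) * ‖f (x - t)‖ₑ) := by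
      rw [conv_apply]
      refine (enorm_integral_le_lintegral_enorm _).trans (le_of_eq ?_)
      congr 1
      ext t
      rw [enorm_mul, ← mul_assoc, ← ENNReal.rpow_add_of_nonneg _ _ (by norm_num) (by norm_num)]
      norm_num [hk]
    have hm1 : AEMeasurable (fun t => (k t) ^ (1 / 2 : ℝ)) volume := (hkm.pow_const _).aemeasurable
    have hm2 : AEMeasurable (fun t => (k t) ^ (1 / 2 : ℝ) * ‖f (x - t)‖ₑ) volume :=
      ((hkm.pow_const _).mul (hfe.comp (measurable_const.sub measurable_id))).aemeasurable
    have h2 := ENNReal.lintegral_mul_le_Lp_mul_Lq volume Real.HolderConjugate.two_two hm1 hm2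
    have h3 := h1.trans h2
    have e1 : ∀ t, ((k t) ^ (1 / 2 : ℝ)) ^ (2 : ℝ) = k t := fun t => by
      rw [← ENNReal.rpow_mul]; norm_num
    have e2 : ∀ t, ((k t) ^ (1 / 2 : ℝ) * ‖f (x - t)‖ₑ) ^ (2 : ℝ) = k t * ‖f (x - t)‖ₑ ^ 2 :=
      fun t => by rw [ENNReal.mul_rpow_of_nonneg _ _ (by norm_num), e1, ENNReal.rpow_two]
    simp only [e1, e2] at h3
    calc ‖conv κ f x‖ₑ ^ 2 ≤ ((∫⁻ t, k t) ^ (1 / 2 : ℝ) *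
          (∫⁻ t, k t * ‖f (x - t)‖ₑ ^ 2) ^ (1 / 2 : ℝ)) ^ 2 := by gcongr
      _ = _ := by
        rw [← ENNReal.rpow_two, ENNReal.mul_rpow_of_nonneg _ _ (by norm_num), ← ENNReal.rpow_mul,
          ← ENNReal.rpow_mul]
        norm_num [hK]
  have h2n : ∀ g : Space N → ℝ, eLpNorm g 2 volume = (∫⁻ x, ‖g x‖ₑ ^ 2) ^ (1 / 2 : ℝ) := by
    intro g
    rw [eLpNorm_eq_lintegral_rpow_enorm_toReal (by norm_num) (by norm_num)]
    simp
  rw [h2n, h2n, hKe]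
  have hI : ∫⁻ x, ‖conv κ f x‖ₑ ^ 2 ≤ K ^ 2 * ∫⁻ x, ‖f x‖ₑ ^ 2 := by
    calc ∫⁻ x, ‖conv κ f x‖ₑ ^ 2 ≤ ∫⁻ x, K * ∫⁻ t, k t * ‖f (x - t)‖ₑ ^ 2 :=
          lintegral_mono hpt
      _ = K * ∫⁻ x, ∫⁻ t, k t * ‖f (x - t)‖ₑ ^ 2 := by
          refine lintegral_const_mul _ ?_
          exact ((hkm.comp measurable_snd).mul ((hfe.comp
            (measurable_fst.sub measurable_snd)).pow_const 2)).lintegral_prod_right'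
      _ = K * ∫⁻ t, ∫⁻ x, k t * ‖f (x - t)‖ₑ ^ 2 := by
          rw [lintegral_lintegral_swap]
          exact ((hkm.comp measurable_snd).mul ((hfe.comp
            (measurable_fst.sub measurable_snd)).pow_const 2)).aemeasurable
      _ = K * ∫⁻ t, k t * ∫⁻ x, ‖f x‖ₑ ^ 2 := by
          congr 1
          refine lintegral_congr fun t => ?_
          have hm : Measurable fun x => ‖f (x - t)‖ₑ ^ 2 :=
            (hfe.comp (measurable_id.sub_const t)).pow_const 2
          rw [lintegral_const_mul _ hm]
          congr 1
          exact lintegral_sub_right_eq_self (fun x => ‖f x‖ₑ ^ 2) t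
      _ = K ^ 2 * ∫⁻ x, ‖f x‖ₑ ^ 2 := by
          rw [lintegral_mul_const _ hkm, sq, mul_assoc]
  calc (∫⁻ x, ‖conv κ f x‖ₑ ^ 2) ^ (1 / 2 : ℝ) ≤ (K ^ 2 * ∫⁻ x, ‖f x‖ₑ ^ 2) ^ (1 / 2 : ℝ) := by
        gcongr
    _ = _ := by
        rw [ENNReal.mul_rpow_of_nonneg _ _ (by norm_num), ← ENNReal.rpow_two, ← ENNReal.rpow_mul]
        norm_num

/-- A sequence of bump functions with supports shrinking to the origin. -/
def bumpSeq (N n : ℕ) : ContDiffBump (0 : Space N) where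
  rIn := 1 / (n + 1) / 2
  rOut := 1 / (n + 1)
  rIn_pos := by positivity
  rIn_lt_rOut := half_lt_self (by positivity)

/-- The mollifiers. -/
def mol (N n : ℕ) : Space N → ℝ := (bumpSeq N n).normed volume

lemma isTest_mol (n : ℕ) : IsTest (mol N n) :=
  ⟨(bumpSeq N n).contDiff_normed, (bumpSeq N n).hasCompactSupport_normed⟩

lemma integral_abs_mol (n : ℕ) : ∫ t, |mol N n t| = 1 := by
  have : ∀ t, |mol N n t| = mol N n t := fun t =>
    abs_of_nonneg ((bumpSeq N n).nonneg_normed t)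
  simp only [this]
  exact (bumpSeq N n).integral_normed

/-- The mollification of `f`. -/
def mf (n : ℕ) (f : Space N → ℝ) : Space N → ℝ := conv (mol N n) f

lemma smooth_mf {f : Space N → ℝ} (n : ℕ) (hf : LocallyIntegrable f) : Smooth (mf n f) :=
  smooth_conv (isTest_mol n) hf

lemma D_mf {f g : Space N → ℝ} (n : ℕ) {w : List (Fin N)} (h : WD w f g) :
    D w (mf n f) = mf n g := conv_of_wd (isTest_mol n) h

lemma mf_congr {f g : Space N → ℝ} (n : ℕ) (h : f =ᵐ[volume] g) : mf n f = mf n g :=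
  convolution_congr _ (Filter.EventuallyEq.refl _ _) h

lemma abs_mf_le {f : Space N → ℝ} (n : ℕ) {c : ℝ} (hf : ∀ᵐ x, |f x| ≤ c) (x : Space N) :
    |mf n f x| ≤ c := by
  have := abs_conv_le (isTest_mol n) hf x
  rwa [integral_abs_mol, one_mul] at this

lemma eLpNorm_mf_le {f : Space N → ℝ} (n : ℕ) (hf : AEStronglyMeasurable f volume) :
    eLpNorm (mf n f) 2 volume ≤ eLpNorm f 2 volume := by
  have := eLpNorm_conv_le (isTest_mol n) hf
  rwa [integral_abs_mol, ENNReal.ofReal_one, one_mul] at this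

lemma tendsto_mf {f : Space N → ℝ} (hf : LocallyIntegrable f) :
    ∀ᵐ x, Tendsto (fun n => mf n f x) atTop (𝓝 (f x)) := by
  -- The constant 2 is the fixed ratio of the outer to the inner radius of the bumps.
  refine ContDiffBump.ae_convolution_tendsto_right_of_locallyIntegrable (K := 2)
    (φ := fun n => bumpSeq N n) tendsto_one_div_add_atTop_nhds_zero_nat
    (Eventually.of_forall fun n => ?_) hf
  change (1 : ℝ) / (n + 1) ≤ 2 * (1 / (n + 1) / 2)
  linarith

/-- A sequence converging almost everywhere, with norms bounded by the norm of its limit, converges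
in `L²`. -/
lemma tendsto_eLpNorm_sub_of_le {F : ℕ → Space N → ℝ} {f : Space N → ℝ}
    (hF : ∀ n, MemLp (F n) 2 volume) (hf : MemLp f 2 volume)
    (hle : ∀ n, eLpNorm (F n) 2 volume ≤ eLpNorm f 2 volume)
    (hlim : ∀ᵐ x, Tendsto (fun n => F n x) atTop (𝓝 (f x))) :
    Tendsto (fun n => eLpNorm (F n - f) 2 volume) atTop (𝓝 0) := by
  have h2n : ∀ g : Space N → ℝ, eLpNorm g 2 volume ^ 2 = ∫⁻ x, ‖g x‖ₑ ^ 2 := by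
    intro g
    rw [eLpNorm_eq_lintegral_rpow_enorm_toReal (by norm_num) (by norm_num), ← ENNReal.rpow_two,
      ← ENNReal.rpow_mul]
    simp
  set S : ℝ≥0∞ := ∫⁻ x, ‖f x‖ₑ ^ 2 with hS
  have hSfin : S ≠ ⊤ := by
    rw [hS, ← h2n]; exact ENNReal.pow_ne_top hf.2.ne
  -- The integrand 2F² + 2f² − (F − f)² is (F + f)², hence nonnegative. With the parallelogram
  -- identity and the bound on the norms, this controls the sum.
  have hsum : ∀ n, (∫⁻ x, ENNReal.ofReal (2 * F n x ^ 2 + 2 * f x ^ 2 - (F n x - f x) ^ 2)) +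
      eLpNorm (F n - f) 2 volume ^ 2 ≤ 4 * S := by
    intro n
    rw [h2n, ← lintegral_add_right']
    · calc _ = ∫⁻ x, (2 * ‖F n x‖ₑ ^ 2 + 2 * ‖f x‖ₑ ^ 2) := by
            refine lintegral_congr fun x => ?_
            have e : ∀ y : ℝ, ‖y‖ₑ ^ 2 = ENNReal.ofReal (y ^ 2) := fun y => by
              rw [Real.enorm_eq_ofReal_abs, ← ENNReal.ofReal_pow (abs_nonneg _), sq_abs]
            rw [e, e, e, Pi.sub_apply, ← ENNReal.ofReal_add (by nlinarith [sq_nonneg (F n x + f x)])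
              (sq_nonneg _)]
            have e2 : (2 : ℝ≥0∞) = ENNReal.ofReal 2 := by simp
            rw [e2, ← ENNReal.ofReal_mul (by norm_num), ← ENNReal.ofReal_mul (by norm_num),
              ← ENNReal.ofReal_add (by positivity) (by positivity)]
            congr 1; ring
        _ = 2 * (∫⁻ x, ‖F n x‖ₑ ^ 2) + 2 * S := by
            rw [lintegral_add_right', lintegral_const_mul' _ _ (by norm_num),
              lintegral_const_mul' _ _ (by norm_num)]
            exact ((hf.1.enorm.pow_const 2).const_mul 2)
        _ ≤ 2 * S + 2 * S := by
            gcongr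
            rw [← h2n, hS, ← h2n]
            gcongr
            exact hle n
        _ = 4 * S := by rw [← add_mul]; norm_num
    · exact ((hF n).1.sub hf.1).enorm.pow_const 2
  -- Fatou: the integrands tend to 4f² almost everywhere. In the sum above nothing is left for the
  -- norm of F − f in the limit.
  have hfatou : 4 * S ≤ liminf (fun n => ∫⁻ x, ENNReal.ofReal
      (2 * F n x ^ 2 + 2 * f x ^ 2 - (F n x - f x) ^ 2)) atTop := by
    refine le_trans (le_of_eq ?_) (lintegral_liminf_le' fun n => ?_)
    · rw [hS, ← lintegral_const_mul' _ _ (by norm_num)]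
      refine lintegral_congr_ae ?_
      filter_upwards [hlim] with x hx
      have ht : Tendsto (fun n => ENNReal.ofReal (2 * F n x ^ 2 + 2 * f x ^ 2 - (F n x - f x) ^ 2))
          atTop (𝓝 (ENNReal.ofReal (2 * f x ^ 2 + 2 * f x ^ 2 - (f x - f x) ^ 2))) := by
        refine ENNReal.tendsto_ofReal ?_
        exact (((hx.pow 2).const_mul 2).add tendsto_const_nhds).sub
          ((hx.sub tendsto_const_nhds).pow 2)
      rw [ht.liminf_eq]
      have e2 : (4 : ℝ≥0∞) = ENNReal.ofReal 4 := by simp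
      rw [Real.enorm_eq_ofReal_abs, ← ENNReal.ofReal_pow (abs_nonneg _), sq_abs, e2,
        ← ENNReal.ofReal_mul (by norm_num)]
      congr 1; ring
    · exact (((((hF n).1.aemeasurable.pow_const 2).const_mul 2).add
        ((hf.1.aemeasurable.pow_const 2).const_mul 2)).sub
        (((hF n).1.aemeasurable.sub hf.1.aemeasurable).pow_const 2)).ennreal_ofReal
  set a : ℕ → ℝ≥0∞ := fun n => ∫⁻ x, ENNReal.ofReal
      (2 * F n x ^ 2 + 2 * f x ^ 2 - (F n x - f x) ^ 2) with ha
  have h4 : 4 * S ≠ ⊤ := ENNReal.mul_ne_top (by norm_num) hSfin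
  have hsq : Tendsto (fun n => eLpNorm (F n - f) 2 volume ^ 2) atTop (𝓝 0) := by
    rw [ENNReal.tendsto_nhds_zero]
    intro ε hε
    -- For S = 0 the strict inequality below the lower limit is not available, but then the norm of
    -- the difference is already zero.
    rcases eq_or_ne S 0 with h0 | h0
    · refine Eventually.of_forall fun n => ?_
      have := hsum n
      rw [h0, mul_zero] at this
      exact (le_add_self.trans this).trans hε.le
    have h40 : 4 * S ≠ 0 := mul_ne_zero (by norm_num) h0
    have hlt : 4 * S - min ε (4 * S) < liminf a atTop :=
      lt_of_lt_of_le (ENNReal.sub_lt_self h4 h40 (ne_of_gt (lt_min hε (pos_iff_ne_zero.2 h40))))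
        hfatou
    filter_upwards [eventually_lt_of_lt_liminf hlt] with n hn
    have h5 := hsum n
    have h6 : 4 * S ≤ a n + min ε (4 * S) := tsub_le_iff_right.1 hn.le
    have h7 : a n ≠ ⊤ := ne_top_of_le_ne_top h4 (le_self_add.trans h5)
    have h8 : a n + eLpNorm (F n - f) 2 volume ^ 2 ≤ a n + min ε (4 * S) := h5.trans h6
    exact ((ENNReal.add_le_add_iff_left h7).1 h8).trans (min_le_left _ _)
  have := hsq.ennrpow_const (1 / 2 : ℝ)
  simp only [← ENNReal.rpow_two, ← ENNReal.rpow_mul] at this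
  norm_num at this
  exact this

lemma tendsto_mf_L2 {f : Space N → ℝ} (hf : MemLp f 2 volume) :
    Tendsto (fun n => eLpNorm (mf n f - f) 2 volume) atTop (𝓝 0) := by
  have hl : LocallyIntegrable f := hf.locallyIntegrable (by norm_num)
  exact tendsto_eLpNorm_sub_of_le
    (fun n => ⟨(smooth_mf n hl).aesm, (eLpNorm_mf_le n hf.1).trans_lt hf.2⟩) hf
    (fun n => eLpNorm_mf_le n hf.1) (tendsto_mf hl)

end Mollifier

/-! ### Weak derivatives in L² obtained by duality. -/

section Duality

variable {N : ℕ}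

/-- The space of test functions. -/
def testSubmodule (N : ℕ) : Submodule ℝ (Space N → ℝ) where
  carrier := {φ | IsTest φ}
  add_mem' := IsTest.add
  zero_mem' := isTest_zero
  smul_mem' c _ h := IsTest.smul h c

/-- The inclusion of the test functions in `L²`. -/
def testToLp (N : ℕ) : testSubmodule N →ₗ[ℝ] Lp ℝ 2 (volume : Measure (Space N)) where
  toFun φ := MemLp.toLp φ.1 (IsTest.memLp φ.2 2)
  map_add' _ _ := rfl
  map_smul' _ _ := rfl

lemma denseRange_testToLp (N : ℕ) : DenseRange (testToLp N) := by
  have h := Lp.dense_hasCompactSupport_contDiff (E := Space N) (F := ℝ) (μ := volume) (p := 2)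
    (by norm_num)
  refine h.mono ?_
  rintro f ⟨g, hfg, h1, h2⟩
  refine ⟨⟨g, ⟨h2, h1⟩⟩, ?_⟩
  refine Lp.ext ?_
  exact (MemLp.coeFn_toLp (IsTest.memLp (φ := g) ⟨h2, h1⟩ 2)).trans hfg.symm

/-- A function which is bounded, as a functional on the derivatives of the test functions, by the
norm of `L²`, has a weak derivative in `L²`. -/
lemma exists_wd_of_dual {f : Space N → ℝ} (hf : LocallyIntegrable f) (w : List (Fin N)) {M : ℝ}
    (hM : 0 ≤ M)
    (h : ∀ φ, IsTest φ → |∫ x, f x * D w φ x| ≤ M * (eLpNorm φ 2 volume).toReal) :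
    ∃ G, WD w f G ∧ L2le G M := by
  have hD : ∀ φ : testSubmodule N, Integrable fun x => f x * D w φ.1 x := fun φ =>
    LocallyIntegrable.int_mul_test hf (IsTest.word φ.2 w)
  let ℓ : testSubmodule N →ₗ[ℝ] ℝ :=
    { toFun := fun φ => (-1) ^ w.length * ∫ x, f x * D w φ.1 x
      map_add' := fun φ ψ => by
        rw [← mul_add, ← integral_add (hD φ) (hD ψ)]
        simp only [Submodule.coe_add]
        rw [D_add (IsTest.smooth φ.2) (IsTest.smooth ψ.2)]
        simp only [Pi.add_apply, mul_add]
      map_smul' := fun c φ => by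
        simp only [Submodule.coe_smul, D_smul, Pi.smul_apply, smul_eq_mul, RingHom.id_apply]
        have : ∀ x, f x * (c * D w φ.1 x) = c * (f x * D w φ.1 x) := fun x => by ring
        simp only [this, integral_const_mul]
        ring }
  have hb : ∀ φ, ‖ℓ φ‖ ≤ M * ‖testToLp N φ‖ := fun φ => by
    have e : ‖testToLp N φ‖ = (eLpNorm φ.1 2 volume).toReal :=
      Lp.norm_toLp φ.1 (IsTest.memLp φ.2 2)
    rw [e]
    change ‖(-1 : ℝ) ^ w.length * ∫ x, f x * D w φ.1 x‖ ≤ _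
    rw [norm_mul, norm_pow, norm_neg, norm_one, one_pow, one_mul]
    exact h φ.1 φ.2
  -- The functional is bounded for the L² norm on a dense subspace. It extends with the same bound
  -- M, and Riesz representation yields the derivative.
  set L := ℓ.extendOfNorm (testToLp N) with hL
  have hLe : ∀ φ, L (testToLp N φ) = ℓ φ :=
    LinearMap.extendOfNorm_eq (denseRange_testToLp N) ⟨M, hb⟩
  have hLn : ‖L‖ ≤ M := ContinuousLinearMap.opNorm_le_bound _ hM fun x =>
    LinearMap.norm_extendOfNorm_apply_le (denseRange_testToLp N) M hb x
  set G := (InnerProductSpace.toDual ℝ (Lp ℝ 2 (volume : Measure (Space N)))).symm L with hG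
  have hGm : MemLp G 2 volume := Lp.memLp G
  refine ⟨G, ⟨hf, hGm.locallyIntegrable (by norm_num), fun φ hφ => ?_⟩, ?_⟩
  · have h1 := InnerProductSpace.toDual_symm_apply (𝕜 := ℝ) (x := testToLp N ⟨φ, hφ⟩) (y := L)
    rw [hLe, ← hG, L2.inner_def] at h1
    have h2 : ∫ x, inner ℝ (G x) ((testToLp N ⟨φ, hφ⟩ : Space N → ℝ) x) = ∫ x, G x * φ x := by
      refine integral_congr_ae ?_
      filter_upwards [MemLp.coeFn_toLp (IsTest.memLp hφ 2)] with x hx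
      have : (testToLp N ⟨φ, hφ⟩ : Space N → ℝ) x = φ x := hx
      rw [this]
      simp [mul_comm]
    rw [h2] at h1
    rw [h1]
    change _ = (-1 : ℝ) ^ w.length * ((-1) ^ w.length * ∫ x, f x * D w φ x)
    rw [← mul_assoc, ← pow_add, ← two_mul, pow_mul]
    simp
  · have h3 : ‖G‖ ≤ M := by rw [hG, LinearIsometryEquiv.norm_map]; exact hLn
    rw [Lp.norm_def] at h3
    exact (MemLp.l2le hGm).mono h3

end Duality

/-! ### The Sobolev inequality through the Fourier transform. -/

section Sobolev

open scoped FourierTransform SchwartzMap LineDeriv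

variable {N : ℕ}

/-- A test function as a Schwartz function. -/
def toSchwartz {φ : Space N → ℝ} (hφ : IsTest φ) : 𝓢(Space N, ℂ) :=
  HasCompactSupport.toSchwartzMap (f := fun x => (φ x : ℂ))
    (hφ.2.comp_left (g := fun y : ℝ => (y : ℂ)) (by simp))
    (Complex.ofRealCLM.contDiff.comp hφ.1)

lemma toSchwartz_apply {φ : Space N → ℝ} (hφ : IsTest φ) (x : Space N) :
    toSchwartz hφ x = (φ x : ℂ) := rfl

lemma lineDeriv_toSchwartz {φ : Space N → ℝ} (hφ : IsTest φ) (i : Fin N) :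
    ∂_{EuclideanSpace.single i (1 : ℝ)} (toSchwartz hφ) = toSchwartz (hφ.word [i]) := by
  ext x
  rw [SchwartzMap.lineDerivOp_apply_eq_fderiv, toSchwartz_apply]
  have h1 := Complex.ofRealCLM.hasFDerivAt.comp x (hφ.smooth.differentiable x).hasFDerivAt
  have h2 : fderiv ℝ (toSchwartz hφ) x = Complex.ofRealCLM.comp (fderiv ℝ φ x) := h1.fderiv
  rw [h2]
  rfl

/-- Only pure derivatives ∂ᵢ^q are needed: their symbols together with 1 dominate (1 + |ξ|²)^(q/2).
-/
lemma norm_fourier_word {φ : Space N → ℝ} (hφ : IsTest φ) (i : Fin N) (q : ℕ) (ξ : Space N) :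
    ‖𝓕 (toSchwartz (hφ.word (List.replicate q i))) ξ‖ =
      (2 * Real.pi * |ξ i|) ^ q * ‖𝓕 (toSchwartz hφ) ξ‖ := by
  induction q with
  | zero => simp
  | succ q ih =>
    have e : toSchwartz (hφ.word (List.replicate (q + 1) i)) =
        toSchwartz ((hφ.word (List.replicate q i)).word [i]) := rfl
    rw [e, ← lineDeriv_toSchwartz (hφ.word (List.replicate q i)), SchwartzMap.fourier_lineDerivOp_eq]
    have ht : (fun x : Space N => inner ℝ x (EuclideanSpace.single i (1 : ℝ))).HasTemperateGrowth :=
      ((innerSL ℝ).flip (EuclideanSpace.single i (1 : ℝ))).hasTemperateGrowth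
    rw [smul_apply, SchwartzMap.smulLeftCLM_apply_apply ht, norm_smul, norm_smul, ih]
    have e1 : inner ℝ ξ (EuclideanSpace.single i (1 : ℝ)) = ξ i := by
      simp [EuclideanSpace.inner_single_right]
    rw [e1]
    simp only [norm_mul, Complex.norm_ofNat, Complex.norm_real, Complex.norm_I, mul_one,
      Real.norm_eq_abs, abs_of_pos Real.pi_pos, pow_succ]
    ring

lemma abs_le_integral_fourier {φ : Space N → ℝ} (hφ : IsTest φ) (x : Space N) :
    |φ x| ≤ ∫ ξ, ‖𝓕 (toSchwartz hφ) ξ‖ := by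
  have h : toSchwartz hφ x = 𝓕⁻ (𝓕 (toSchwartz hφ)) x := by
    rw [FourierTransform.fourierInv_fourier_eq]
  have h2 : ‖toSchwartz hφ x‖ = |φ x| := by rw [toSchwartz_apply]; simp
  rw [← h2, h, SchwartzMap.fourierInv_coe, Real.fourierInv_eq]
  refine (norm_integral_le_integral_norm _).trans (le_of_eq ?_)
  simp

lemma memLp_fourier {φ : Space N → ℝ} (hφ : IsTest φ) :
    MemLp (fun ξ => ‖𝓕 (toSchwartz hφ) ξ‖) 2 volume := (SchwartzMap.memLp _ 2 volume).norm

lemma l2le_fourier {φ : Space N → ℝ} (hφ : IsTest φ) {M : ℝ} (hM : 0 ≤ M) (h : L2le φ M) :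
    L2le (fun ξ => ‖𝓕 (toSchwartz hφ) ξ‖) M := by
  refine L2le_of_integral_sq_le hM (memLp_fourier hφ) ?_
  rw [SchwartzMap.integral_norm_sq_fourier]
  have : ∀ x, ‖toSchwartz hφ x‖ ^ 2 = φ x ^ 2 := fun x => by rw [toSchwartz_apply]; simp
  simp only [this]
  exact h.integral_sq_le hM hφ.smooth.aesm

/-- The weight in the Fourier proof of the Sobolev embedding. -/
def sobWeight (N q : ℕ) : Space N → ℝ := fun ξ => ((1 + ‖ξ‖ ^ 2) ^ q)⁻¹.sqrt

/-- The condition N < 2q is exactly the square integrability of the weight. -/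
lemma memLp_sobWeight {q : ℕ} (hq : N < 2 * q) : MemLp (sobWeight N q) 2 volume := by
  have hm : AEStronglyMeasurable (sobWeight N q) volume := by
    refine Continuous.aestronglyMeasurable ?_
    unfold sobWeight
    refine Real.continuous_sqrt.comp (Continuous.inv₀ (by fun_prop) fun x => ?_)
    positivity
  rw [memLp_two_iff_integrable_sq hm]
  have h := integrable_rpow_neg_one_add_norm_sq (E := Space N) (μ := volume) (r := 2 * q)
    (by simpa using (by exact_mod_cast hq : (N : ℝ) < 2 * q))
  refine h.congr (Eventually.of_forall fun x => ?_)
  simp only [sobWeight]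
  rw [Real.sq_sqrt (by positivity), show -(2 * (q : ℝ)) / 2 = -(q : ℝ) by ring,
    Real.rpow_neg (by positivity), Real.rpow_natCast]

/-- The norm of ξ is compared with its largest coordinate m: 1 + |ξ|² ≤ (1 + N) max(1, m)², while
max(1, m)^q is at most 1 + ∑|ξᵢ|^q. Dimension zero has no largest coordinate and is treated with m =
0. -/
lemma one_le_weight (q : ℕ) (ξ : Space N) :
    1 ≤ (√(((1 : ℝ) + N) ^ q)) * sobWeight N q ξ * (1 + ∑ i, |ξ i| ^ q) := by
  have hS : 0 ≤ ∑ i, |ξ i| ^ q := Finset.sum_nonneg fun i _ => by positivity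
  have hp : 0 < (1 + ‖ξ‖ ^ 2) ^ q := by positivity
  unfold sobWeight
  rw [← Real.sqrt_mul (by positivity)]
  have key : (1 + ‖ξ‖ ^ 2) ^ q ≤ (1 + (N : ℝ)) ^ q * (1 + ∑ i, |ξ i| ^ q) ^ 2 := by
    obtain ⟨m, hm0, hm1, hm2⟩ : ∃ m : ℝ, 0 ≤ m ∧ (∀ i, |ξ i| ≤ m) ∧
        max 1 m ^ q ≤ 1 + ∑ i, |ξ i| ^ q := by
      rcases Nat.eq_zero_or_pos N with rfl | hN
      · exact ⟨0, le_rfl, fun i => i.elim0, by simp⟩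
      · have : Nonempty (Fin N) := ⟨⟨0, hN⟩⟩
        obtain ⟨i0, hi0⟩ := Finite.exists_max fun i => |ξ i|
        refine ⟨|ξ i0|, abs_nonneg _, hi0, ?_⟩
        have : |ξ i0| ^ q ≤ ∑ i, |ξ i| ^ q :=
          Finset.single_le_sum (f := fun i => |ξ i| ^ q) (fun i _ => by positivity)
            (Finset.mem_univ i0)
        rcases max_cases 1 |ξ i0| with ⟨h, _⟩ | ⟨h, _⟩
        · rw [h, one_pow]; linarith
        · rw [h]; linarith
    have h1 : ‖ξ‖ ^ 2 ≤ N * max 1 m ^ 2 := by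
      rw [EuclideanSpace.norm_sq_eq]
      calc ∑ i, ‖ξ i‖ ^ 2 ≤ ∑ _i : Fin N, max 1 m ^ 2 := by
            refine Finset.sum_le_sum fun i _ => ?_
            rw [Real.norm_eq_abs]
            gcongr
            exact (hm1 i).trans (le_max_right _ _)
        _ = _ := by simp
    have h2 : 1 + ‖ξ‖ ^ 2 ≤ (1 + N) * max 1 m ^ 2 := by
      have : (1 : ℝ) ≤ max 1 m ^ 2 := one_le_pow₀ (le_max_left _ _)
      nlinarith
    calc (1 + ‖ξ‖ ^ 2) ^ q ≤ ((1 + N) * max 1 m ^ 2) ^ q := by gcongr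
      _ = (1 + (N : ℝ)) ^ q * (max 1 m ^ q) ^ 2 := by
          rw [mul_pow, ← pow_mul, ← pow_mul, mul_comm 2 q]
      _ ≤ _ := by gcongr
  have h3 : (1 + ∑ i, |ξ i| ^ q) = √((1 + ∑ i, |ξ i| ^ q) ^ 2) := by
    rw [Real.sqrt_sq (by linarith)]
  rw [h3, ← Real.sqrt_mul (by positivity)]
  refine Real.le_sqrt_of_sq_le ?_
  rw [one_pow, mul_assoc, mul_left_comm, ← div_eq_inv_mul, le_div_iff₀ hp]
  linarith

/-- **Sobolev inequality** for test functions. -/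
lemma IsTest.sobolev (N : ℕ) {q : ℕ} (hq : N < 2 * q) : ∃ C, 0 ≤ C ∧ ∀ φ : Space N → ℝ, IsTest φ →
    ∀ M, 0 ≤ M → (∀ w : List (Fin N), w.length ≤ q → L2le (D w φ) M) → ∀ x, |φ x| ≤ C * M := by
  set J := (eLpNorm (sobWeight N q) 2 volume).toReal with hJ
  have hw := memLp_sobWeight (N := N) hq
  refine ⟨√(((1 : ℝ) + N) ^ q) * (J * (1 + N)), by positivity, fun φ hφ M hM h x => ?_⟩
  refine (abs_le_integral_fourier hφ x).trans ?_
  set F := fun ξ => ‖𝓕 (toSchwartz hφ) ξ‖ with hF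
  set G := fun i ξ => ‖𝓕 (toSchwartz (hφ.word (List.replicate q i))) ξ‖ with hG
  have hpt : ∀ ξ, F ξ ≤ √(((1 : ℝ) + N) ^ q) * (sobWeight N q ξ * (F ξ + ∑ i, G i ξ)) := by
    intro ξ
    have hF0 : 0 ≤ F ξ := norm_nonneg _
    have hw0 : 0 ≤ sobWeight N q ξ := Real.sqrt_nonneg _
    have h1 := mul_le_mul_of_nonneg_right (one_le_weight q ξ) hF0
    rw [one_mul] at h1
    refine h1.trans ?_
    rw [mul_assoc, mul_assoc]
    gcongr
    rw [add_mul, one_mul, Finset.sum_mul]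
    gcongr with i
    have := norm_fourier_word hφ i q ξ
    change G i ξ = _ at this
    rw [this]
    gcongr
    -- The factor 2π of the Fourier convention is at least 1 and only helps.
    have := Real.pi_gt_three
    nlinarith [abs_nonneg (ξ i)]
  have hFl := l2le_fourier hφ hM (h [] (by simp))
  have hGl : ∀ i, L2le (G i) M := fun i => l2le_fourier (hφ.word _) hM (h _ (by simp))
  have hFm := memLp_fourier hφ
  have hGm : ∀ i, MemLp (G i) 2 volume := fun i => memLp_fourier (hφ.word _)
  have hSm : MemLp (F + ∑ i, G i) 2 volume := hFm.add (memLp_finsetSum' _ fun i _ => hGm i)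
  have hSl : L2le (F + ∑ i, G i) (M + ∑ _i : Fin N, M) :=
    hFl.add (L2le.sum _ (fun i _ => hGl i) (fun i _ => (hGm i).1) (fun _ _ => hM)) hFm.1
      (memLp_finsetSum' _ fun i _ => hGm i).1 hM (Finset.sum_nonneg fun _ _ => hM)
  have hCS := (MemLp.l2le hw).abs_integral_mul_le hSl hw.1 hSm.1 ENNReal.toReal_nonneg
    (add_nonneg hM (Finset.sum_nonneg fun _ _ => hM))
  have hi : Integrable fun ξ => sobWeight N q ξ * (F + ∑ i, G i) ξ := hSm.integrable_mul hw
    |>.congr (Eventually.of_forall fun ξ => by simp [mul_comm])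
  calc ∫ ξ, F ξ ≤ ∫ ξ, √(((1 : ℝ) + N) ^ q) * (sobWeight N q ξ * (F + ∑ i, G i) ξ) := by
        refine integral_mono (SchwartzMap.integrable _).norm (hi.const_mul _) fun ξ => ?_
        have := hpt ξ
        simpa using this
    _ = √(((1 : ℝ) + N) ^ q) * ∫ ξ, sobWeight N q ξ * (F + ∑ i, G i) ξ := integral_const_mul _ _
    _ ≤ √(((1 : ℝ) + N) ^ q) * (J * (M + ∑ _i : Fin N, M)) := by
        gcongr
        exact (le_abs_self _).trans hCS
    _ = _ := by simp; ring

lemma L2le_D_mul {f χ : Space N → ℝ} (hf : Smooth f) (hχ : Smooth χ) {M B : ℝ} (hM : 0 ≤ M)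
    (hB : 0 ≤ B) (w w₁ w₂ : List (Fin N))
    (h : ∀ v : List (Fin N), v.length ≤ w.length + w₂.length → L2le (D v f) M)
    (h' : ∀ v : List (Fin N), v.length ≤ w.length + w₁.length → ∀ x, |D v χ x| ≤ B) :
    L2le (D w (D w₁ χ * D w₂ f)) (2 ^ w.length * (B * M)) := by
  induction w generalizing w₁ w₂ with
  | nil => simpa using (h w₂ (by simp)).bdd_mul (h' w₁ (by simp)) hB
  | cons i w ih =>
    have s1 := hχ.word w₁; have s2 := hf.word w₂
    rw [D_concat_mul s1 s2]
    have a := ih (i :: w₁) w₂ (fun v hv => h v (by simp; omega)) (fun v hv => h' v (by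
      simp at hv ⊢; omega))
    have b := ih w₁ (i :: w₂) (fun v hv => h v (by simp at hv ⊢; omega))
      (fun v hv => h' v (by simp; omega))
    refine (a.add b ((((hχ.word (i :: w₁)).mul s2)).word w).aesm
      ((s1.mul (hf.word (i :: w₂))).word w).aesm (by positivity) (by positivity)).mono ?_
    simp only [List.length_cons, pow_succ]
    linarith

lemma partialDeriv_comp_sub_right {κ : Space N → ℝ} (hκ : Smooth κ) (x : Space N) (i : Fin N) :
    partialDeriv i (fun y => κ (y - x)) = fun y => partialDeriv i κ (y - x) := by
  ext y
  unfold partialDeriv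
  have h1 : HasFDerivAt (fun y : Space N => y - x) (ContinuousLinearMap.id ℝ (Space N)) y := by
    simpa using (hasFDerivAt_id y).sub_const x
  have h2 := ((hκ.differentiable (y - x)).hasFDerivAt).comp y h1
  have h3 : fderiv ℝ (fun y => κ (y - x)) y =
      (fderiv ℝ κ (y - x)).comp (ContinuousLinearMap.id ℝ (Space N)) := h2.fderiv
  rw [h3]
  simp

lemma D_comp_sub_right {κ : Space N → ℝ} (hκ : Smooth κ) (x : Space N) (w : List (Fin N)) :
    D w (fun y => κ (y - x)) = fun y => D w κ (y - x) := by
  induction w with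
  | nil => rfl
  | cons i w ih => rw [D_cons, ih, partialDeriv_comp_sub_right (hκ.word w)]; rfl

/-- A smooth cut-off function. -/
def cutoff (N : ℕ) : Space N → ℝ := (bumpSeq N 0 : Space N → ℝ)

lemma isTest_cutoff (N : ℕ) : IsTest (cutoff N) :=
  ⟨(bumpSeq N 0).contDiff, (bumpSeq N 0).hasCompactSupport⟩

lemma cutoff_zero (N : ℕ) : cutoff N 0 = 1 :=
  (bumpSeq N 0).one_of_mem_closedBall (by simpa using (bumpSeq N 0).rIn_pos.le)

/-- **Sobolev inequality** for smooth functions. -/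
lemma Smooth.sobolev (N : ℕ) {q : ℕ} (hq : N < 2 * q) : ∃ C, 0 ≤ C ∧ ∀ f : Space N → ℝ, Smooth f →
    ∀ M, 0 ≤ M → (∀ w : List (Fin N), w.length ≤ q → L2le (D w f) M) → ∀ x, |f x| ≤ C * M := by
  obtain ⟨C, hC, h⟩ := IsTest.sobolev N hq
  choose B hB using fun w : List (Fin N) => ((isTest_cutoff N).word w).bdd
  have hfin : (Set.range fun v : Σ n : Fin (q + 1), List.Vector (Fin N) n => B v.2.1).Finite :=
    Set.finite_range _
  obtain ⟨B0, hB0⟩ := hfin.bddAbove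
  have hB1 : ∀ w : List (Fin N), w.length ≤ q → ∀ x, |D w (cutoff N) x| ≤ max B0 0 :=
    fun w hw x => (hB w x).trans ((hB0 ⟨⟨⟨w.length, by omega⟩, ⟨w, rfl⟩⟩, rfl⟩).trans
      (le_max_left _ _))
  refine ⟨C * (2 ^ q * max B0 0), by positivity, fun f hf M hM hw x => ?_⟩
  -- The cut-off is translated to the point x, where it equals 1. The bounds on its derivatives do
  -- not depend on x, so neither does the constant.
  set χ : Space N → ℝ := fun y => cutoff N (y - x) with hχ
  have hχt : IsTest χ := ⟨(isTest_cutoff N).1.comp (contDiff_id.sub contDiff_const),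
    (isTest_cutoff N).2.comp_homeomorph (Homeomorph.subRight x)⟩
  have hχb : ∀ w : List (Fin N), w.length ≤ q → ∀ y, |D w χ y| ≤ max B0 0 := fun w hw y => by
    rw [hχ, D_comp_sub_right (isTest_cutoff N).smooth]; exact hB1 w hw _
  have hg : IsTest (χ * f) := by rw [mul_comm]; exact IsTest.smooth_mul hf hχt
  have hχx : χ x = 1 := by simp [hχ, cutoff_zero]
  have key := h (χ * f) hg (2 ^ q * (max B0 0 * M)) (by positivity) (fun w hwq => by
    have := L2le_D_mul hf hχt.smooth hM (le_max_right B0 0) w [] []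
      (fun v hv => hw v (by simp at hv; omega)) (fun v hv => hχb v (by simp at hv; omega))
    refine L2le.mono this ?_
    gcongr
    norm_num) x
  rw [Pi.mul_apply, hχx, one_mul] at key
  refine key.trans (le_of_eq (by ring))

end Sobolev

/-! ### Sobolev bounds for weakly differentiable functions, embedding and algebra property. -/

section SobolevBounds

variable {N : ℕ}

/-- The weak derivatives of `f` of order at most `q` are bounded by `M` in `L²`. -/
def HB (q : ℕ) (M : ℝ) (f : Space N → ℝ) : Prop :=
  0 ≤ M ∧ ∀ w : List (Fin N), w.length ≤ q → ∃ g, WD w f g ∧ L2le g M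

/-- The function `f` is bounded by `M`, and so are its weak derivatives of order `1, …, q`
in `L²`. -/
structure ZB (q : ℕ) (M : ℝ) (f : Space N → ℝ) : Prop where
  nonneg : 0 ≤ M
  locInt : LocallyIntegrable f
  bdd : ∀ᵐ x, |f x| ≤ M
  wd : ∀ w : List (Fin N), w ≠ [] → w.length ≤ q → ∃ g, WD w f g ∧ L2le g M

lemma WD.aesm {w : List (Fin N)} {f g : Space N → ℝ} (h : WD w f g) :
    AEStronglyMeasurable g volume := h.2.1.aestronglyMeasurable

lemma L2le.congr {f g : Space N → ℝ} {S : ℝ} (h : L2le f S) (hfg : f =ᵐ[volume] g) :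
    L2le g S := by
  unfold L2le at *
  rwa [← eLpNorm_congr_ae hfg]

namespace HB

variable {q : ℕ} {M M' : ℝ} {f g : Space N → ℝ}

lemma nonneg (h : HB q M f) : 0 ≤ M := h.1

lemma locInt (h : HB q M f) : LocallyIntegrable f := (h.2 [] (by simp)).choose_spec.1.1

lemma aesm (h : HB q M f) : AEStronglyMeasurable f volume := h.locInt.aestronglyMeasurable

lemma l2le_of_wd (h : HB q M f) {w : List (Fin N)} (hw : w.length ≤ q) (hg : WD w f g) :
    L2le g M := by
  obtain ⟨k, hk, hkM⟩ := h.2 w hw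
  exact hkM.congr (hk.unique hg)

lemma l2le (h : HB q M f) : L2le f M := h.l2le_of_wd (w := []) (by simp) (WD.nil h.locInt)

lemma memLp (h : HB q M f) : MemLp f 2 volume := h.l2le.memLp h.aesm

lemma wd_W (h : HB q M f) {w : List (Fin N)} (hw : w.length ≤ q) : WD w f (W w f) :=
  (h.2 w hw).choose_spec.1.wd_W

lemma mono (h : HB q M f) (hM : M ≤ M') : HB q M' f :=
  ⟨h.1.trans hM, fun w hw => let ⟨g, hg, hgM⟩ := h.2 w hw; ⟨g, hg, hgM.mono hM⟩⟩

lemma mono_order {q' : ℕ} (h : HB q M f) (hq : q' ≤ q) : HB q' M f :=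
  ⟨h.1, fun w hw => h.2 w (hw.trans hq)⟩

lemma congr (h : HB q M f) (hfg : f =ᵐ[volume] g) : HB q M g :=
  ⟨h.1, fun w hw => let ⟨k, hk, hkM⟩ := h.2 w hw
    ⟨k, hk.congr hfg (Filter.EventuallyEq.refl _ _), hkM⟩⟩

lemma add (h : HB q M f) (h' : HB q M' g) : HB q (M + M') (f + g) :=
  ⟨add_nonneg h.1 h'.1, fun w hw => by
    obtain ⟨a, ha, haM⟩ := h.2 w hw
    obtain ⟨b, hb, hbM⟩ := h'.2 w hw
    exact ⟨a + b, ha.add hb, haM.add hbM ha.aesm hb.aesm h.1 h'.1⟩⟩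

lemma smul (h : HB q M f) (c : ℝ) : HB q (|c| * M) (c • f) :=
  ⟨mul_nonneg (abs_nonneg _) h.1, fun w hw => by
    obtain ⟨a, ha, haM⟩ := h.2 w hw
    exact ⟨c • a, ha.smul c, haM.smul c⟩⟩

lemma zero (q : ℕ) : HB q 0 (0 : Space N → ℝ) :=
  ⟨le_rfl, fun w _ => ⟨0, WD.zero w, l2le_zero⟩⟩

lemma of_wd {w : List (Fin N)} (h : HB (q + w.length) M f) (hg : WD w f g) : HB q M g :=
  ⟨h.1, fun v hv => by
    obtain ⟨k, hk, hkM⟩ := h.2 (w ++ v) (by simp; omega)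
    exact ⟨k, hg.of_append hk, hkM⟩⟩

end HB

namespace ZB

variable {q : ℕ} {M M' : ℝ} {f g : Space N → ℝ}

lemma mono (h : ZB q M f) (hM : M ≤ M') : ZB q M' f :=
  ⟨h.1.trans hM, h.2, h.3.mono fun _ hx => hx.trans hM,
    fun w hw hw' => let ⟨g, hg, hgM⟩ := h.4 w hw hw'; ⟨g, hg, hgM.mono hM⟩⟩

lemma mono_order {q' : ℕ} (h : ZB q M f) (hq : q' ≤ q) : ZB q' M f :=
  ⟨h.1, h.2, h.3, fun w hw hw' => h.4 w hw (hw'.trans hq)⟩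

lemma of_wd {w : List (Fin N)} (h : ZB (q + w.length) M f) (hw : w ≠ []) (hg : WD w f g) :
    HB q M g :=
  ⟨h.1, fun v hv => by
    obtain ⟨k, hk, hkM⟩ := h.4 (w ++ v) (by simp [hw]) (by simp; omega)
    exact ⟨k, hg.of_append hk, hkM⟩⟩

lemma l2le_of_wd (h : ZB q M f) {w : List (Fin N)} (hw : w ≠ []) (hq : w.length ≤ q)
    (hg : WD w f g) : L2le g M := by
  obtain ⟨k, hk, hkM⟩ := h.4 w hw hq
  exact hkM.congr (hk.unique hg)

lemma wd_W (h : ZB q M f) {w : List (Fin N)} (hw : w ≠ []) (hq : w.length ≤ q) :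
    WD w f (W w f) := (h.4 w hw hq).choose_spec.1.wd_W

end ZB

lemma memLp_conv {κ f : Space N → ℝ} (hκ : IsTest κ) (hf : MemLp f 2 volume) :
    MemLp (conv κ f) 2 volume :=
  ⟨(smooth_conv hκ (hf.locallyIntegrable (by norm_num))).aesm,
    (eLpNorm_conv_le hκ hf.1).trans_lt (ENNReal.mul_lt_top ENNReal.ofReal_lt_top hf.2)⟩

lemma bdd_conv {κ f : Space N → ℝ} (hκ : IsTest κ) (hf : MemLp f 2 volume) :
    ∃ C, ∀ x, |conv κ f x| ≤ C := by
  refine ⟨(eLpNorm f 2 volume).toReal * (eLpNorm κ 2 volume).toReal, fun x => ?_⟩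
  rw [conv_apply_swap]
  have h := integral_mul_le_of_memLp hf ((hκ.comp_sub x).memLp 2)
  have e : eLpNorm (fun y => κ (x - y)) 2 volume = eLpNorm κ 2 volume :=
    eLpNorm_comp_measurePreserving (g := κ) hκ.smooth.aesm
      (Measure.measurePreserving_sub_left volume x)
  rwa [e] at h

lemma nice2_mf {f : Space N → ℝ} (n : ℕ) (hf : MemLp f 2 volume) : Nice2 (mf n f) := by
  have hl := hf.locallyIntegrable (by norm_num)
  refine ⟨⟨smooth_mf n hl, fun w => ?_, fun w _ => ?_⟩, memLp_conv (isTest_mol n) hf⟩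
  · unfold mf; rw [D_conv (isTest_mol n) hl]; exact bdd_conv ((isTest_mol n).word w) hf
  · unfold mf; rw [D_conv (isTest_mol n) hl]; exact memLp_conv ((isTest_mol n).word w) hf

lemma HB.nice2_mf {q : ℕ} {M : ℝ} {f : Space N → ℝ} (h : HB q M f) (n : ℕ) : Nice2 (mf n f) :=
  LandauLifshitz.nice2_mf n h.memLp

/-- The function itself need not be in L². In a nonempty word the last letter is taken as a weak
derivative, which is in L², and the other letters fall on the kernel. -/
lemma ZB.nice_mf {q : ℕ} {M : ℝ} {f : Space N → ℝ} (h : ZB q M f) (hq : 1 ≤ q) (n : ℕ) :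
    Nice (mf n f) := by
  refine ⟨smooth_mf n h.locInt, fun w => ?_, fun w hw => ?_⟩
  · unfold mf; rw [D_conv (isTest_mol n) h.locInt]
    exact ⟨_, abs_conv_le ((isTest_mol n).word w) h.bdd⟩
  · obtain ⟨w', i, rfl⟩ : ∃ w' i, w = w' ++ [i] := ⟨w.dropLast, w.getLast hw,
      (List.dropLast_append_getLast hw).symm⟩
    obtain ⟨g, hg, hgM⟩ := h.wd [i] (by simp) (by simpa using hq)
    rw [D_append, D_mf n hg]
    exact (LandauLifshitz.nice2_mf n (hgM.memLp hg.aesm)).memLp_word w'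

lemma L2le.mollify {f : Space N → ℝ} {S : ℝ} (h : L2le f S) (hf : AEStronglyMeasurable f volume)
    (n : ℕ) : L2le (mf n f) S := (eLpNorm_mf_le n hf).trans h

lemma HB.l2le_D_mf {q : ℕ} {M : ℝ} {f : Space N → ℝ} (h : HB q M f) (n : ℕ) {w : List (Fin N)}
    (hw : w.length ≤ q) : L2le (D w (mf n f)) M := by
  obtain ⟨g, hg, hgM⟩ := h.2 w hw
  rw [D_mf n hg]
  exact hgM.mollify hg.aesm n

lemma ZB.l2le_D_mf {q : ℕ} {M : ℝ} {f : Space N → ℝ} (h : ZB q M f) (n : ℕ) {w : List (Fin N)}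
    (hw : w ≠ []) (hq : w.length ≤ q) : L2le (D w (mf n f)) M := by
  obtain ⟨g, hg, hgM⟩ := h.4 w hw hq
  rw [D_mf n hg]
  exact hgM.mollify hg.aesm n

/-- **Sobolev embedding** in the space of bounded functions. -/
lemma HB.sobolev (N : ℕ) {q : ℕ} (hq : N < 2 * q) : ∃ C, 1 ≤ C ∧
    ∀ (f : Space N → ℝ) (M : ℝ), HB q M f → ZB q (C * M) f := by
  obtain ⟨C, hC, h⟩ := Smooth.sobolev N hq
  -- Adding 1 makes the constant at least 1, so that the L² bounds on the derivatives survive with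
  -- the same number.
  refine ⟨C + 1, by linarith, fun f M hf => ?_⟩
  have hM := hf.nonneg
  refine ⟨by positivity, hf.locInt, ?_, fun w _ hw => ?_⟩
  -- The mollifications satisfy the uniform bound with a constant independent of n, and it passes to
  -- the almost everywhere limit.
  · filter_upwards [tendsto_mf hf.locInt] with x hx
    have : ∀ n, |mf n f x| ≤ C * M := fun n =>
      h _ (smooth_mf n hf.locInt) M hM (fun w hw => hf.l2le_D_mf n hw) x
    have := le_of_tendsto hx.abs (Eventually.of_forall this)
    linarith
  · obtain ⟨g, hg, hgM⟩ := hf.2 w hw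
    exact ⟨g, hg, hgM.mono (by nlinarith)⟩

/-- **Algebra property** of Sobolev spaces. -/
lemma ZB.mul_HB (N : ℕ) {q : ℕ} (hq : N < 2 * q) : ∃ C, 0 ≤ C ∧
    ∀ (f g : Space N → ℝ) (M M' : ℝ), ZB q M f → HB q M' g → HB q (C * (M * M')) (f * g) := by
  obtain ⟨C, hC, hsob⟩ := Smooth.sobolev N hq
  set K := ∑ j ∈ Finset.range (q + 1), moserConst j with hK
  have hK0 : 0 ≤ K := Finset.sum_nonneg fun j _ => (moserConst_pos j).le
  refine ⟨2 ^ q * (K * (C + 1)) + 1, by positivity, fun f g M M' hf hg => ?_⟩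
  have hM := hf.nonneg
  have hM' := hg.nonneg
  have hq1 : 1 ≤ q := by omega
  have hgb : ∀ n x, |mf n g x| ≤ C * M' := fun n x =>
      hsob _ (smooth_mf n hg.locInt) M' hM' (fun w hw => hg.l2le_D_mf n hw) x
  have hfb : ∀ n x, |mf n f x| ≤ M := fun n x => abs_mf_le n hf.bdd x
  -- The product is first estimated for the mollifications, uniformly in n, where the Moser estimate
  -- applies.
  have hL : ∀ n (w : List (Fin N)), w.length ≤ q →
      L2le (D w (mf n f * mf n g))
        ((2 ^ q * (K * (C + 1)) + 1) * (M * M')) := by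
    intro n w hw
    have n1 := hf.nice_mf hq1 n
    have n2 := hg.nice2_mf n
    -- Order zero is separate: f is only bounded, and the square integrability comes from g.
    rcases Nat.eq_zero_or_pos w.length with h0 | h0
    · rw [List.length_eq_zero_iff] at h0
      subst h0
      refine ((hg.l2le_D_mf n (w := []) (by simp)).bdd_mul (hfb n) hM).mono ?_
      have : 0 ≤ 2 ^ q * (K * (C + 1)) * (M * M') := by positivity
      linarith
    · have hwK : moserConst w.length ≤ K :=
        Finset.single_le_sum (f := moserConst) (fun j _ => (moserConst_pos j).le)
          (Finset.mem_range.2 (by omega))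
      have hwp := (moserConst_pos w.length).le
      have h := D_mul2_le (n := w.length) n1.smooth n2.smooth
        (T := moserConst w.length * (M * (C * M') + M * M')) (by positivity)
        (fun w₁ w₂ h12 => moser_two n1 n2.toNice (hfb n) (hgb n) hM hM' h0
          (fun v hv => hf.l2le_D_mf n (by rintro rfl; simp at hv; omega) (by omega))
          (fun v hv => hg.l2le_D_mf n (by omega)) w₁ w₂ h12) w [] [] (by simp)
      refine L2le.mono h ?_
      calc (2 : ℝ) ^ w.length * (moserConst w.length * (M * (C * M') + M * M'))
          ≤ 2 ^ q * (K * (M * (C * M') + M * M')) := by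
            gcongr
            norm_num
        _ = (2 ^ q * (K * (C + 1))) * (M * M') := by ring
        _ ≤ _ := by nlinarith [mul_nonneg hM hM']
  have hfg : LocallyIntegrable (f * g) := by
    have : MemLp (f * g) 2 volume :=
      (hg.l2le.of_abs_le (f := f * g) (c := M) (by
        filter_upwards [hf.bdd] with x hx
        rw [Pi.mul_apply, abs_mul]; gcongr) hM).memLp (hf.locInt.aestronglyMeasurable.mul hg.aesm)
    exact this.locallyIntegrable (by norm_num)
  -- By duality it suffices to bound the pairing with derivatives of test functions, and this bound
  -- passes to the limit by dominated convergence.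
  refine ⟨by positivity, fun w hw => exists_wd_of_dual hfg w (by positivity) fun φ hφ => ?_⟩
  have ht : Tendsto (fun n => ∫ x, (mf n f * mf n g) x * D w φ x)
      atTop (𝓝 (∫ x, (f * g) x * D w φ x)) := by
    refine tendsto_integral_of_dominated_convergence (fun x => M * (C * M') * |D w φ x|)
      (fun n => ?_) ?_ (fun n => Eventually.of_forall fun x => ?_) ?_
    · exact (((smooth_mf n hf.locInt).mul (smooth_mf n hg.locInt)).aesm).mul
        (hφ.word w).smooth.aesm
    · exact ((memLp_one_iff_integrable.1 ((hφ.word w).memLp 1)).abs).const_mul _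
    · rw [Real.norm_eq_abs, abs_mul, Pi.mul_apply, abs_mul]
      gcongr
      · exact hfb n x
      · exact hgb n x
    · filter_upwards [tendsto_mf hf.locInt, tendsto_mf hg.locInt] with x hx hx'
      exact (hx.mul hx').mul_const _
  refine le_of_tendsto ht.abs (Eventually.of_forall fun n => ?_)
  have hs := (smooth_mf n hf.locInt).mul (smooth_mf n hg.locInt)
  rw [integral_mul_D_test hs hφ, abs_mul, abs_pow, abs_neg, abs_one, one_pow, one_mul]
  exact (hL n w hw).abs_integral_mul_le (MemLp.l2le (hφ.memLp 2)) (hs.word w).aesm hφ.smooth.aesm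
    (by positivity) ENNReal.toReal_nonneg

end SobolevBounds

/-! ### Convergence in Sobolev norms along a filter. -/

section Convergence

variable {N : ℕ} {ι : Type*} {l : Filter ι}

/-- Convergence in the Sobolev space of order `q`. -/
structure HConv (l : Filter ι) (q : ℕ) (F : ι → Space N → ℝ) (f : Space N → ℝ) : Prop where
  bound : ∃ B, HB q B f
  conv : ∃ M : ι → ℝ, Tendsto M l (𝓝 0) ∧ ∀ᶠ i in l, HB q (M i) (F i - f)

/-- Convergence in the space of bounded functions with derivatives of order `1, …, q` in `L²`. -/
structure ZConv (l : Filter ι) (q : ℕ) (F : ι → Space N → ℝ) (f : Space N → ℝ) : Prop where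
  bound : ∃ B, ZB q B f
  conv : ∃ M : ι → ℝ, Tendsto M l (𝓝 0) ∧ ∀ᶠ i in l, ZB q (M i) (F i - f)

namespace HConv

variable {q : ℕ} {F G : ι → Space N → ℝ} {f g : Space N → ℝ}

lemma mono_order {q' : ℕ} (h : HConv l q F f) (hq : q' ≤ q) : HConv l q' F f := by
  obtain ⟨⟨B, hB⟩, M, hM, hF⟩ := h
  exact ⟨⟨B, hB.mono_order hq⟩, M, hM, hF.mono fun i hi => hi.mono_order hq⟩

lemma congr (h : HConv l q F f) (hF : ∀ᶠ i in l, F i =ᵐ[volume] G i) (hf : f =ᵐ[volume] g) :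
    HConv l q G g := by
  obtain ⟨⟨B, hB⟩, M, hM, hFM⟩ := h
  refine ⟨⟨B, hB.congr hf⟩, M, hM, ?_⟩
  filter_upwards [hFM, hF] with i h1 h2
  exact h1.congr (h2.sub hf)

lemma const {B : ℝ} (h : HB q B f) : HConv l q (fun _ => f) f :=
  ⟨⟨B, h⟩, fun _ => 0, tendsto_const_nhds, Eventually.of_forall fun _ => by
    rw [sub_self]; exact HB.zero q⟩

lemma add (hF : HConv l q F f) (hG : HConv l q G g) :
    HConv l q (fun i => F i + G i) (f + g) := by
  obtain ⟨⟨B, hB⟩, M, hM, h1⟩ := hF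
  obtain ⟨⟨B', hB'⟩, M', hM', h2⟩ := hG
  refine ⟨⟨_, hB.add hB'⟩, fun i => M i + M' i, by simpa using hM.add hM', ?_⟩
  filter_upwards [h1, h2] with i h1 h2
  rw [add_sub_add_comm]
  exact h1.add h2

lemma smul (hF : HConv l q F f) (c : ℝ) : HConv l q (fun i => c • F i) (c • f) := by
  obtain ⟨⟨B, hB⟩, M, hM, h1⟩ := hF
  refine ⟨⟨_, hB.smul c⟩, fun i => |c| * M i, by simpa using hM.const_mul |c|, ?_⟩
  filter_upwards [h1] with i h1
  rw [← smul_sub]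
  exact h1.smul c

lemma neg (hF : HConv l q F f) : HConv l q (fun i => -F i) (-f) := by
  simpa using hF.smul (-1)

lemma sub (hF : HConv l q F f) (hG : HConv l q G g) :
    HConv l q (fun i => F i - G i) (f - g) := by
  simpa [sub_eq_add_neg] using hF.add hG.neg

lemma zero : HConv l q (fun _ => (0 : Space N → ℝ)) 0 := const (HB.zero q)

lemma sum {κ : Type*} (s : Finset κ) {F : κ → ι → Space N → ℝ} {f : κ → Space N → ℝ}
    (h : ∀ a ∈ s, HConv l q (F a) (f a)) :
    HConv l q (fun i => ∑ a ∈ s, F a i) (∑ a ∈ s, f a) := by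
  classical
  induction s using Finset.induction_on with
  | empty => simpa using zero
  | insert a s ha ih =>
    simp only [Finset.sum_insert ha]
    exact (h a (Finset.mem_insert_self _ _)).add
      (ih fun i hi => h i (Finset.mem_insert_of_mem hi))

/-- Weak derivatives of convergent families. -/
lemma of_wd {w : List (Fin N)} (h : HConv l (q + w.length) F f)
    (hF : ∀ᶠ i in l, WD w (F i) (G i)) (hf : WD w f g) : HConv l q G g := by
  obtain ⟨⟨B, hB⟩, M, hM, h1⟩ := h
  refine ⟨⟨B, hB.of_wd hf⟩, M, hM, ?_⟩
  filter_upwards [h1, hF] with i h1 h2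
  exact h1.of_wd (h2.sub hf)

lemma memLp (h : HConv l q F f) : MemLp f 2 volume := h.bound.choose_spec.memLp

lemma eventually_memLp (h : HConv l q F f) : ∀ᶠ i in l, MemLp (F i) 2 volume := by
  obtain ⟨M, _, h1⟩ := h.conv
  filter_upwards [h1] with i h1
  simpa using h1.memLp.add h.memLp

lemma wd_W (h : HConv l q F f) {w : List (Fin N)} (hw : w.length ≤ q) : WD w f (W w f) :=
  h.bound.choose_spec.wd_W hw

lemma eventually_wd_W (h : HConv l q F f) {w : List (Fin N)} (hw : w.length ≤ q) :
    ∀ᶠ i in l, WD w (F i) (W w (F i)) := by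
  obtain ⟨M, _, h1⟩ := h.conv
  filter_upwards [h1] with i h1
  have := (h1.wd_W hw).add (h.wd_W hw)
  rw [sub_add_cancel] at this
  exact this.wd_W

lemma derivW {w : List (Fin N)} (h : HConv l (q + w.length) F f) :
    HConv l q (fun i => W w (F i)) (W w f) :=
  h.of_wd (h.eventually_wd_W (by simp)) (h.wd_W (by simp))

lemma derivD {w : List (Fin N)} (h : HConv l (q + w.length) F f) (hs : ∀ i, Smooth (F i)) :
    HConv l q (fun i => D w (F i)) (W w f) :=
  h.of_wd (Eventually.of_forall fun i => (hs i).wd w) (h.wd_W (by simp))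

lemma tendsto_eLpNorm (h : HConv l q F f) :
    Tendsto (fun i => (eLpNorm (F i - f) 2 volume).toReal) l (𝓝 0) := by
  obtain ⟨M, hM, h1⟩ := h.conv
  refine tendsto_of_tendsto_of_tendsto_of_le_of_le' tendsto_const_nhds hM
    (Eventually.of_forall fun _ => ENNReal.toReal_nonneg) ?_
  filter_upwards [h1] with i h1
  exact ENNReal.toReal_le_of_le_ofReal h1.nonneg h1.l2le

lemma tendsto_integral_mul (hF : HConv l q F f) (hG : HConv l q G g) :
    Tendsto (fun i => ∫ x, F i x * G i x) l (𝓝 (∫ x, f x * g x)) := by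
  have t1 := hF.tendsto_eLpNorm
  have t2 := hG.tendsto_eLpNorm
  set a := fun i => (eLpNorm (F i - f) 2 volume).toReal
  set b := fun i => (eLpNorm (G i - g) 2 volume).toReal
  set nf := (eLpNorm f 2 volume).toReal
  set ng := (eLpNorm g 2 volume).toReal
  rw [tendsto_iff_norm_sub_tendsto_zero]
  have hlim : Tendsto (fun i => a i * b i + a i * ng + nf * b i) l (𝓝 0) := by
    have := ((t1.mul t2).add (t1.mul_const ng)).add (t2.const_mul nf)
    simpa using this
  refine tendsto_of_tendsto_of_tendsto_of_le_of_le' tendsto_const_nhds hlim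
    (Eventually.of_forall fun _ => norm_nonneg _) ?_
  filter_upwards [hF.eventually_memLp, hG.eventually_memLp] with i mF mG
  have m1 := mF.sub hF.memLp
  have m2 := mG.sub hG.memLp
  have e : ∫ x, F i x * G i x = ∫ x, (f * g + ((F i - f) * (G i - g) + (F i - f) * g +
      f * (G i - g))) x := by
    congr 1; ext x; simp; ring
  have i1 := m1.integrable_mul m2
  have i2 := m1.integrable_mul hG.memLp
  have i3 := hF.memLp.integrable_mul m2
  have i4 := hF.memLp.integrable_mul hG.memLp
  rw [e, integral_add' i4 ((i1.add i2).add i3), integral_add' (i1.add i2) i3,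
    integral_add' i1 i2]
  have e3 : ∀ y z : ℝ, y + z - y = z := fun y z => by ring
  rw [show (∫ x, (f * g) x) = ∫ x, f x * g x from rfl]
  rw [e3, Real.norm_eq_abs]
  refine (abs_add_le _ _).trans (add_le_add ((abs_add_le _ _).trans (add_le_add ?_ ?_)) ?_)
  · exact integral_mul_le_of_memLp m1 m2
  · exact integral_mul_le_of_memLp m1 hG.memLp
  · exact integral_mul_le_of_memLp hF.memLp m2

lemma toZConv (hq : N < 2 * q) (h : HConv l q F f) : ZConv l q F f := by
  obtain ⟨C, _, hs⟩ := HB.sobolev N hq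
  obtain ⟨⟨B, hB⟩, M, hM, h1⟩ := h
  exact ⟨⟨_, hs _ _ hB⟩, fun i => C * M i, by simpa using hM.const_mul C,
    h1.mono fun i hi => hs _ _ hi⟩

end HConv

namespace ZConv

variable {q : ℕ} {F G : ι → Space N → ℝ} {f g : Space N → ℝ}

lemma mono_order {q' : ℕ} (h : ZConv l q F f) (hq : q' ≤ q) : ZConv l q' F f := by
  obtain ⟨⟨B, hB⟩, M, hM, hF⟩ := h
  exact ⟨⟨B, hB.mono_order hq⟩, M, hM, hF.mono fun i hi => hi.mono_order hq⟩

lemma const {B : ℝ} (h : ZB q B f) : ZConv l q (fun _ => f) f :=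
  ⟨⟨B, h⟩, fun _ => 0, tendsto_const_nhds, Eventually.of_forall fun _ => by
    rw [sub_self]
    exact ⟨le_rfl, locallyIntegrable_zero, by simp, fun w _ _ => ⟨0, WD.zero w, l2le_zero⟩⟩⟩

/-- Weak derivatives of convergent families. -/
lemma of_wd {w : List (Fin N)} (h : ZConv l (q + w.length) F f) (hw : w ≠ [])
    (hF : ∀ᶠ i in l, WD w (F i) (G i)) (hf : WD w f g) : HConv l q G g := by
  obtain ⟨⟨B, hB⟩, M, hM, h1⟩ := h
  refine ⟨⟨B, hB.of_wd hw hf⟩, M, hM, ?_⟩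
  filter_upwards [h1, hF] with i h1 h2
  exact h1.of_wd hw (h2.sub hf)

lemma wd_W (h : ZConv l q F f) {w : List (Fin N)} (hw : w ≠ []) (hq : w.length ≤ q) :
    WD w f (W w f) := h.bound.choose_spec.wd_W hw hq

lemma eventually_wd_W (h : ZConv l q F f) {w : List (Fin N)} (hw : w ≠ []) (hq : w.length ≤ q) :
    ∀ᶠ i in l, WD w (F i) (W w (F i)) := by
  obtain ⟨M, _, h1⟩ := h.conv
  filter_upwards [h1] with i h1
  have := (h1.wd_W hw hq).add (h.wd_W hw hq)
  rw [sub_add_cancel] at this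
  exact this.wd_W

lemma derivW {w : List (Fin N)} (h : ZConv l (q + w.length) F f) (hw : w ≠ []) :
    HConv l q (fun i => W w (F i)) (W w f) :=
  h.of_wd hw (h.eventually_wd_W hw (by simp)) (h.wd_W hw (by simp))

lemma derivD {w : List (Fin N)} (h : ZConv l (q + w.length) F f) (hw : w ≠ [])
    (hs : ∀ i, Smooth (F i)) : HConv l q (fun i => D w (F i)) (W w f) :=
  h.of_wd hw (Eventually.of_forall fun i => (hs i).wd w) (h.wd_W hw (by simp))

lemma mul (hq : N < 2 * q) (hF : ZConv l q F f) (hG : HConv l q G g) :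
    HConv l q (fun i => F i * G i) (f * g) := by
  obtain ⟨C, _, hm⟩ := ZB.mul_HB N hq
  obtain ⟨⟨B, hB⟩, M, hM, h1⟩ := hF
  obtain ⟨⟨B', hB'⟩, M', hM', h2⟩ := hG
  refine ⟨⟨_, hm _ _ _ _ hB hB'⟩, fun i => C * (M i * M' i) + C * (M i * B') + C * (B * M' i), ?_,
    ?_⟩
  · have := (((hM.mul hM').const_mul C).add ((hM.mul_const B').const_mul C)).add
      ((hM'.const_mul B).const_mul C)
    simpa using this
  · filter_upwards [h1, h2] with i h1 h2
    have e : F i * G i - f * g = (F i - f) * (G i - g) + (F i - f) * g + f * (G i - g) := by ring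
    rw [e]
    exact ((hm _ _ _ _ h1 h2).add (hm _ _ _ _ h1 hB')).add (hm _ _ _ _ hB h2)

end ZConv

lemma HConv.mul {q : ℕ} {F G : ι → Space N → ℝ} {f g : Space N → ℝ} (hq : N < 2 * q)
    (hF : HConv l q F f) (hG : HConv l q G g) : HConv l q (fun i => F i * G i) (f * g) :=
  (hF.toZConv hq).mul hq hG

end Convergence

/-! ### The algebraic structure of the nonlinearity. -/

section Identity

variable {N : ℕ}

/-- The product `∇f · ∇g`. -/
def gr (f g : Space N → ℝ) : Space N → ℝ := ∑ i, partialDeriv i f * partialDeriv i g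

/-- The square of the Hessian. -/
def hessSq (f : Space N → ℝ) : Space N → ℝ :=
  ∑ i, ∑ j, partialDeriv i (partialDeriv j f) * partialDeriv i (partialDeriv j f)

lemma gr_comm (f g : Space N → ℝ) : gr f g = gr g f := by simp only [gr, mul_comm]

variable {f g h : Space N → ℝ}

lemma Smooth.gr (hf : Smooth f) (hg : Smooth g) : Smooth (gr f g) :=
  Smooth.sum fun i _ => (hf.pd i).mul (hg.pd i)

lemma gr_add_left (hf : Smooth f) (hg : Smooth g) : gr (f + g) h = gr f h + gr g h := by
  simp only [gr, partialDeriv_add hf hg, add_mul, Finset.sum_add_distrib]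

lemma gr_sub_left (hf : Smooth f) (hg : Smooth g) : gr (f - g) h = gr f h - gr g h := by
  simp only [gr, partialDeriv_sub hf hg, sub_mul, Finset.sum_sub_distrib]

lemma gr_smul_left (c : ℝ) : gr (c • f) h = c • gr f h := by
  simp only [gr, partialDeriv_smul, smul_mul_assoc, Finset.smul_sum]

lemma gr_mul_left (hf : Smooth f) (hg : Smooth g) : gr (f * g) h = f * gr g h + g * gr f h := by
  simp only [gr, partialDeriv_mul hf hg, Finset.mul_sum, ← Finset.sum_add_distrib]
  exact Finset.sum_congr rfl fun i _ => by ring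

lemma gr_add_right (hf : Smooth f) (hg : Smooth g) : gr h (f + g) = gr h f + gr h g := by
  simp only [gr_comm h, gr_add_left hf hg]

lemma gr_sub_right (hf : Smooth f) (hg : Smooth g) : gr h (f - g) = gr h f - gr h g := by
  simp only [gr_comm h, gr_sub_left hf hg]

lemma gr_smul_right (c : ℝ) : gr h (c • f) = c • gr h f := by
  simp only [gr_comm h, gr_smul_left]

lemma gr_mul_right (hf : Smooth f) (hg : Smooth g) : gr h (f * g) = f * gr h g + g * gr h f := by
  simp only [gr_comm h, gr_mul_left hf hg]

lemma lap_add (hf : Smooth f) (hg : Smooth g) : lap (f + g) = lap f + lap g := by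
  simp only [lap, partialDeriv_add hf hg, partialDeriv_add (hf.pd _) (hg.pd _),
    Finset.sum_add_distrib]

lemma lap_sub (hf : Smooth f) (hg : Smooth g) : lap (f - g) = lap f - lap g := by
  simp only [lap, partialDeriv_sub hf hg, partialDeriv_sub (hf.pd _) (hg.pd _),
    Finset.sum_sub_distrib]

lemma lap_neg : lap (-f) = -lap f := by
  simp only [lap, partialDeriv_neg, Finset.sum_neg_distrib]

lemma lap_smul (c : ℝ) : lap (c • f) = c • lap f := by
  simp only [lap, partialDeriv_smul, Finset.smul_sum]

lemma lap_mul (hf : Smooth f) (hg : Smooth g) :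
    lap (f * g) = lap f * g + (2 : ℝ) • gr f g + f * lap g := by
  simp only [lap, gr, Finset.mul_sum, Finset.sum_mul, Finset.smul_sum, ← Finset.sum_add_distrib]
  refine Finset.sum_congr rfl fun i _ => ?_
  rw [partialDeriv_mul hf hg, partialDeriv_add ((hf.pd i).mul hg) (hf.mul (hg.pd i)),
    partialDeriv_mul (hf.pd i) hg, partialDeriv_mul hf (hg.pd i)]
  ext x; simp; ring

lemma partialDeriv_lap (hf : Smooth f) (i : Fin N) : partialDeriv i (lap f) = lap (partialDeriv i f) := by
  have h := D_sum Finset.univ (fun j => partialDeriv j (partialDeriv j f))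
    (fun j _ => (hf.pd j).pd j) [i]
  simp only [D_singleton] at h
  unfold lap
  rw [h]
  refine Finset.sum_congr rfl fun j _ => ?_
  rw [partialDeriv_comm (hf.pd j), partialDeriv_comm hf i j]

lemma partialDeriv_gr (hf : Smooth f) (hg : Smooth g) (i : Fin N) :
    partialDeriv i (gr f g) = gr (partialDeriv i f) g + gr f (partialDeriv i g) := by
  have h := D_sum Finset.univ (fun j => partialDeriv j f * partialDeriv j g)
    (fun j _ => (hf.pd j).mul (hg.pd j)) [i]
  simp only [D_singleton] at h
  unfold gr
  rw [h, ← Finset.sum_add_distrib]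
  refine Finset.sum_congr rfl fun j _ => ?_
  rw [partialDeriv_mul (hf.pd j) (hg.pd j), partialDeriv_comm hf i j, partialDeriv_comm hg i j]

lemma sum_gr_partialDeriv (f : Space N → ℝ) :
    ∑ j, gr (partialDeriv j f) (partialDeriv j f) = hessSq f := by
  unfold gr hessSq
  exact Finset.sum_comm

/-- Bochner's identity in flat space. -/
lemma lap_gr_self (hf : Smooth f) :
    lap (gr f f) = (2 : ℝ) • gr f (lap f) + (2 : ℝ) • hessSq f := by
  have e : lap (gr f f) = ∑ j, lap (partialDeriv j f * partialDeriv j f) := by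
    unfold lap
    rw [Finset.sum_comm]
    refine Finset.sum_congr rfl fun i _ => ?_
    have h := D_sum Finset.univ (fun j => partialDeriv j f * partialDeriv j f)
      (fun j _ => (hf.pd j).mul (hf.pd j)) [i, i]
    exact h
  rw [e, ← sum_gr_partialDeriv, Finset.smul_sum]
  simp only [gr.eq_def f (lap f), Finset.smul_sum, ← Finset.sum_add_distrib]
  refine Finset.sum_congr rfl fun j _ => ?_
  rw [lap_mul (hf.pd j) (hf.pd j), partialDeriv_lap hf]
  ext x; simp; ring

/-- The double divergence of ∇f ⊗ ∇f: the inner divergence is ∇∂ᵢf · ∇f + ∂ᵢf Δf, and the outer one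
is expanded with the symmetry of third derivatives. -/
lemma sum_hess_mul (hf : Smooth f) :
    ∑ i, ∑ j, partialDeriv i (partialDeriv j (partialDeriv i f * partialDeriv j f)) =
      lap f * lap f + (2 : ℝ) • gr f (lap f) + hessSq f := by
  have e : ∀ i, ∑ j, partialDeriv i (partialDeriv j (partialDeriv i f * partialDeriv j f)) =
      partialDeriv i (gr (partialDeriv i f) f + partialDeriv i f * lap f) := by
    intro i
    have h := D_sum Finset.univ (fun j => partialDeriv j (partialDeriv i f * partialDeriv j f))
      (fun j _ => ((hf.pd i).mul (hf.pd j)).pd j) [i]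
    simp only [D_singleton] at h
    rw [← h]
    congr 1
    unfold gr lap
    rw [Finset.mul_sum, ← Finset.sum_add_distrib]
    refine Finset.sum_congr rfl fun j _ => ?_
    rw [partialDeriv_mul (hf.pd i) (hf.pd j)]
  simp only [e]
  have e2 : ∀ i, partialDeriv i (gr (partialDeriv i f) f + partialDeriv i f * lap f) =
      gr (partialDeriv i (partialDeriv i f)) f + gr (partialDeriv i f) (partialDeriv i f) +
        (partialDeriv i (partialDeriv i f) * lap f + partialDeriv i f * partialDeriv i (lap f)) := by
    intro i
    rw [partialDeriv_add ((hf.pd i).gr hf) ((hf.pd i).mul hf.lap), partialDeriv_gr (hf.pd i) hf,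
      partialDeriv_mul (hf.pd i) hf.lap]
  have e3 : ∑ i, gr (partialDeriv i (partialDeriv i f)) f = gr f (lap f) := by
    rw [gr_comm f]
    unfold gr
    rw [Finset.sum_comm]
    refine Finset.sum_congr rfl fun j _ => ?_
    have h := D_sum Finset.univ (fun i => partialDeriv i (partialDeriv i f))
      (fun i _ => (hf.pd i).pd i) [j]
    simp only [D_singleton] at h
    unfold lap
    rw [h, Finset.sum_mul]
  simp only [e2, Finset.sum_add_distrib]
  rw [e3, sum_gr_partialDeriv, ← Finset.sum_mul]
  change _ + (lap f * lap f + gr f (lap f)) = _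
  ext x; simp; ring

/-- The second order time derivative of `u` in terms of `u` and its velocity `v`. -/
def acc (lam : ℝ) (u v : Fin 3 → Space N → ℝ) (a : Fin 3) : Space N → ℝ :=
  -crs v (field lam u) a - crs u (field lam v) a

/-- The function `|u|²/2`. -/
def half (u : Fin 3 → Space N → ℝ) : Space N → ℝ :=
  (1 / 2 : ℝ) • (u 0 * u 0 + u 1 * u 1 + u 2 * u 2)

/-- The defect of `|u| = 1`. -/
def dfct (u : Fin 3 → Space N → ℝ) : Space N → ℝ :=
  u 0 * u 0 + u 1 * u 1 + u 2 * u 2 - fun _ => 1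

/-- The terms which vanish for maps with values in the sphere. -/
def errT (lam : ℝ) (u : Fin 3 → Space N → ℝ) (a : Fin 3) : Space N → ℝ :=
  lap (u a) * lap (half u) + (2 : ℝ) • gr (u a) (lap (half u))
    - (2 : ℝ) • gr (field lam u a) (half u) + u a * lap (lap (half u))
    - dfct u * lap (field lam u a) + lam • (dfct u * field lam u a)
    - (![0, lam • (dfct u * lap (u 1)), 0] : Fin 3 → Space N → ℝ) a
    - lam • (pr u a * lap (half u))

variable {u : Fin 3 → Space N → ℝ}

lemma smooth_half (hu : ∀ a, Smooth (u a)) : Smooth (half u) :=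
  ((((hu 0).mul (hu 0)).add ((hu 1).mul (hu 1))).add ((hu 2).mul (hu 2))).smul _

lemma lap_half (hu : ∀ a, Smooth (u a)) : lap (half u) =
    u 0 * lap (u 0) + gr (u 0) (u 0) + (u 1 * lap (u 1) + gr (u 1) (u 1)) +
      (u 2 * lap (u 2) + gr (u 2) (u 2)) := by
  unfold half
  rw [lap_smul, lap_add (((hu 0).mul (hu 0)).add ((hu 1).mul (hu 1))) ((hu 2).mul (hu 2)),
    lap_add ((hu 0).mul (hu 0)) ((hu 1).mul (hu 1)), lap_mul (hu 0) (hu 0), lap_mul (hu 1) (hu 1),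
    lap_mul (hu 2) (hu 2)]
  ext x; simp; ring

lemma gr_half (hu : ∀ a, Smooth (u a)) (f : Space N → ℝ) : gr f (half u) =
    u 0 * gr f (u 0) + u 1 * gr f (u 1) + u 2 * gr f (u 2) := by
  unfold half
  rw [gr_smul_right, gr_add_right (((hu 0).mul (hu 0)).add ((hu 1).mul (hu 1))) ((hu 2).mul (hu 2)),
    gr_add_right ((hu 0).mul (hu 0)) ((hu 1).mul (hu 1)), gr_mul_right (hu 0) (hu 0),
    gr_mul_right (hu 1) (hu 1), gr_mul_right (hu 2) (hu 2)]
  ext x; simp; ring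

lemma gr_lap_half (hu : ∀ a, Smooth (u a)) (f : Space N → ℝ) : gr f (lap (half u)) =
    (u 0 * gr f (lap (u 0)) + lap (u 0) * gr f (u 0) + gr f (gr (u 0) (u 0))) +
    (u 1 * gr f (lap (u 1)) + lap (u 1) * gr f (u 1) + gr f (gr (u 1) (u 1))) +
    (u 2 * gr f (lap (u 2)) + lap (u 2) * gr f (u 2) + gr f (gr (u 2) (u 2))) := by
  have s : ∀ a, Smooth (u a * lap (u a)) := fun a => (hu a).mul (hu a).lap
  have t : ∀ a, Smooth (gr (u a) (u a)) := fun a => (hu a).gr (hu a)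
  rw [lap_half hu, gr_add_right (((s 0).add (t 0)).add ((s 1).add (t 1))) ((s 2).add (t 2)),
    gr_add_right ((s 0).add (t 0)) ((s 1).add (t 1)), gr_add_right (s 0) (t 0),
    gr_add_right (s 1) (t 1), gr_add_right (s 2) (t 2), gr_mul_right (hu 0) (hu 0).lap,
    gr_mul_right (hu 1) (hu 1).lap, gr_mul_right (hu 2) (hu 2).lap]

/-- On the sphere the left-hand side vanishes, so this expresses u · Δ²u through derivatives of
order at most three. The product u · Δ²u arises from u × (u × Δ²u) in the acceleration. -/
lemma lap_lap_half (hu : ∀ a, Smooth (u a)) : lap (lap (half u)) =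
    ∑ b, (lap (u b) * lap (u b) + (4 : ℝ) • gr (u b) (lap (u b)) + u b * lap (lap (u b)) +
      (2 : ℝ) • hessSq (u b)) := by
  have s : ∀ a, Smooth (u a * lap (u a)) := fun a => (hu a).mul (hu a).lap
  have t : ∀ a, Smooth (gr (u a) (u a)) := fun a => (hu a).gr (hu a)
  rw [lap_half hu, lap_add (((s 0).add (t 0)).add ((s 1).add (t 1))) ((s 2).add (t 2)),
    lap_add ((s 0).add (t 0)) ((s 1).add (t 1)), lap_add (s 0) (t 0),
    lap_add (s 1) (t 1), lap_add (s 2) (t 2), lap_mul (hu 0) (hu 0).lap,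
    lap_mul (hu 1) (hu 1).lap, lap_mul (hu 2) (hu 2).lap, lap_gr_self (hu 0), lap_gr_self (hu 1),
    lap_gr_self (hu 2), Fin.sum_univ_three]
  ext x; simp; ring

/-- The expanded form serves the algebra, the double divergence serves the integration by parts.
Compared with the terms produced by `lap_lap_half`, the additional square of the Laplacian comes
from (u × F) × F. -/
lemma gK_eq (hu : ∀ a, Smooth (u a)) : gK u = (-2 : ℝ) • ∑ b, (lap (u b) * lap (u b) +
    (2 : ℝ) • gr (u b) (lap (u b)) + hessSq (u b)) := by
  unfold gK
  congr 1
  have e : ∀ i : Fin N, ∑ j, ∑ b,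
      partialDeriv i (partialDeriv j (partialDeriv i (u b) * partialDeriv j (u b))) =
      ∑ b, ∑ j, partialDeriv i (partialDeriv j (partialDeriv i (u b) * partialDeriv j (u b))) :=
    fun i => Finset.sum_comm
  simp only [e]
  rw [Finset.sum_comm]
  exact Finset.sum_congr rfl fun b _ => sum_hess_mul (hu b)

lemma gr_gr_self (hg : Smooth g) (f : Space N → ℝ) : gr f (gr g g) =
    ∑ i, ∑ j, (2 : ℝ) • (partialDeriv i f * partialDeriv j g * partialDeriv i (partialDeriv j g)) := by
  rw [gr.eq_def f]
  refine Finset.sum_congr rfl fun i _ => ?_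
  rw [partialDeriv_gr hg hg, gr_comm (partialDeriv i g), gr, ← Finset.sum_add_distrib,
    Finset.mul_sum]
  refine Finset.sum_congr rfl fun j _ => ?_
  rw [partialDeriv_comm hg i j]
  ext x; simp; ring

/-- The definition lists single products, suited to Moser estimates; this form is written in the
operators that occur in the identity for the acceleration. -/
lemma cubZero_eq (hu : ∀ a, Smooth (u a)) (a : Fin 3) : cubZero u a =
    ∑ b, (-(gr (u b) (u b) * lap (u a)) - (2 : ℝ) • gr (u a) (gr (u b) (u b))
      - (2 : ℝ) • (gr (u a) (u b) * lap (u b))) := by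
  unfold cubZero
  rw [Finset.sum_comm]
  refine Finset.sum_congr rfl fun b _ => ?_
  simp only [Finset.sum_sub_distrib, Finset.sum_neg_distrib]
  congr 1
  · congr 1
    · congr 1
      simp only [gr, lap, Finset.sum_mul, Finset.mul_sum]
    · rw [gr_gr_self (hu b), Finset.smul_sum]
      refine Finset.sum_congr rfl fun i _ => ?_
      rw [Finset.smul_sum]
      refine Finset.sum_congr rfl fun j _ => ?_
      rw [smul_smul]; norm_num
  · simp only [gr, lap, Finset.sum_mul, Finset.mul_sum, Finset.smul_sum]
    exact Finset.sum_comm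

lemma cubOne_eq (u : Fin 3 → Space N → ℝ) (a : Fin 3) : cubOne u a =
    -((2 : ℝ) • ((u 0 * u 0 + u 2 * u 2) * lap (u a)))
      - (2 : ℝ) • (u 0 * gr (u 0) (u a) + u 2 * gr (u 2) (u a)) +
    (![u 0 * (gr (u 0) (u 0) + gr (u 1) (u 1) + gr (u 2) (u 2)) + u 0 * u 0 * lap (u 0) +
        u 0 * u 2 * lap (u 2) - u 2 * u 2 * lap (u 0) + u 2 * u 0 * lap (u 2),
      (u 0 * u 0 + u 2 * u 2) * lap (u 1),
      u 2 * (gr (u 0) (u 0) + gr (u 1) (u 1) + gr (u 2) (u 2)) + u 2 * u 0 * lap (u 0) +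
        u 2 * u 2 * lap (u 2) + u 0 * u 2 * lap (u 0) - u 0 * u 0 * lap (u 2)] :
      Fin 3 → Space N → ℝ) a := by
  unfold cubOne
  congr 1
  · ext x
    simp only [gr, lap, Finset.sum_apply, Pi.sub_apply, Pi.neg_apply, Pi.smul_apply, Pi.mul_apply,
      Pi.add_apply, smul_eq_mul, Finset.mul_sum, ← Finset.sum_sub_distrib, ← Finset.sum_add_distrib,
      ← Finset.sum_neg_distrib]
    exact Finset.sum_congr rfl fun i _ => by ring
  · fin_cases a <;> ext x <;>
    simp only [Fin.zero_eta, Fin.mk_one, Fin.reduceFinMk, Matrix.cons_val] <;>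
    simp only [gr, lap, Finset.sum_apply, Pi.sub_apply, Pi.mul_apply,
      Pi.add_apply, Finset.mul_sum, ← Finset.sum_sub_distrib, ← Finset.sum_add_distrib] <;>
    exact Finset.sum_congr rfl fun i _ => by ring

lemma lap_mul_sub_mul {f g h k : Space N → ℝ} (hf : Smooth f) (hg : Smooth g) (hh : Smooth h)
    (hk : Smooth k) : lap (f * g - h * k) = lap f * g + (2 : ℝ) • gr f g + f * lap g -
      (lap h * k + (2 : ℝ) • gr h k + h * lap k) := by
  rw [lap_sub (hf.mul hg) (hh.mul hk), lap_mul hf hg, lap_mul hh hk]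

lemma smooth_pr (hu : ∀ a, Smooth (u a)) (a : Fin 3) : Smooth (pr u a) := by
  fin_cases a
  · exact hu 0
  · exact smooth_zero
  · exact hu 2

lemma smooth_field (lam : ℝ) (hu : ∀ a, Smooth (u a)) (a : Fin 3) : Smooth (field lam u a) :=
  (hu a).lap.sub ((smooth_pr hu a).smul lam)

lemma lap_zero : lap (0 : Space N → ℝ) = 0 := by
  have := lap_smul 0 (f := (0 : Space N → ℝ)); simpa using this

lemma gr_zero_right (f : Space N → ℝ) : gr f 0 = 0 := by
  have := gr_smul_right 0 (h := f) (f := (0 : Space N → ℝ)); simpa using this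

lemma gr_zero_left (f : Space N → ℝ) : gr 0 f = 0 := by rw [gr_comm, gr_zero_right]

/-- The structure of the nonlinearity in the equation for the velocity. -/
lemma acc_add_eq (lam : ℝ) (hu : ∀ a, Smooth (u a)) (a : Fin 3) :
    acc lam u (velo lam u) a + lap (lap (u a)) - (2 * lam) • lap (pr u a) + lam ^ 2 • pr u a =
      cub lam u a + u a * gK u + errT lam u a := by
  have hF := smooth_field lam hu
  have lf : ∀ b, lap (field lam u b) = lap (lap (u b)) - lam • lap (pr u b) := fun b => by
    unfold field; rw [lap_sub (hu b).lap ((smooth_pr hu b).smul lam), lap_smul]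
  have gf : ∀ b (f : Space N → ℝ), gr f (field lam u b) = gr f (lap (u b)) - lam • gr f (pr u b) :=
    fun b f => by
      unfold field; rw [gr_sub_right (hu b).lap ((smooth_pr hu b).smul lam), gr_smul_right]
  have v0 : velo lam u 0 = -(u 1 * field lam u 2 - u 2 * field lam u 1) := rfl
  have v1 : velo lam u 1 = -(u 2 * field lam u 0 - u 0 * field lam u 2) := rfl
  have v2 : velo lam u 2 = -(u 0 * field lam u 1 - u 1 * field lam u 0) := rfl
  have l0 := congrArg lap v0
  have l1 := congrArg lap v1
  have l2 := congrArg lap v2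
  rw [lap_neg, lap_mul_sub_mul (hu _) (hF _) (hu _) (hF _), lf, lf, gf, gf] at l0 l1 l2
  have p0 : pr u 0 = u 0 := rfl
  have p1 : pr u 1 = 0 := rfl
  have p2 : pr u 2 = u 2 := rfl
  have f0 : field lam u 0 = lap (u 0) - lam • u 0 := rfl
  have f1 : field lam u 1 = lap (u 1) - lam • (0 : Space N → ℝ) := rfl
  have f2 : field lam u 2 = lap (u 2) - lam • u 2 := rfl
  have q0 : pr (velo lam u) 0 = velo lam u 0 := rfl
  have q1 : pr (velo lam u) 1 = 0 := rfl
  have q2 : pr (velo lam u) 2 = velo lam u 2 := rfl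
  have g0 : ∀ b, field lam (velo lam u) b = lap (velo lam u b) - lam • pr (velo lam u) b :=
    fun b => rfl
  have s10 := gr_comm (u 1) (u 0)
  have s20 := gr_comm (u 2) (u 0)
  have s21 := gr_comm (u 2) (u 1)
  unfold acc errT cub
  rw [gr_comm (field lam u a) (half u), gf, gr_comm (half u) (lap (u a)),
    gr_comm (half u) (pr u a), lap_lap_half hu, lf, cubZero_eq hu, cubOne_eq, gK_eq hu,
    gr_lap_half hu, gr_half hu, gr_half hu, lap_half hu, Fin.sum_univ_three, Fin.sum_univ_three,
    Fin.sum_univ_three]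
  -- All differential operators are now reduced to common atoms, so each component is a polynomial
  -- identity. The relation |u| = 1 is not involved; its defect is recorded in `errT`.
  fin_cases a <;> ext x <;>
    simp only [Fin.zero_eta, Fin.mk_one, Fin.reduceFinMk, crs, Matrix.cons_val, dfct, cubTwo, g0,
      q0, q1, q2, l0, l1, l2] <;>
    simp only [v0, v1, v2, p0, p1, p2, f0, f1, f2, s10, s20, s21, lap_zero,
      gr_zero_left, gr_zero_right, smul_zero, sub_zero,
      Pi.add_apply, Pi.sub_apply, Pi.mul_apply, Pi.neg_apply, Pi.smul_apply, Pi.zero_apply,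
      smul_eq_mul, gr_comm (lap (u _)) (u _)] <;>
    ring

end Identity

/-! ### Convergence of mollifications in Sobolev and uniform norms. -/

section MollifierConvergence

variable {N : ℕ}

/-- The sum over the words of length at most `q`. -/
def wordSum (q : ℕ) (m : List (Fin N) → ℝ) : ℝ :=
  ∑ j ∈ Finset.range (q + 1), ∑ v : List.Vector (Fin N) j, m v.1

lemma le_wordSum {q : ℕ} {m : List (Fin N) → ℝ} (hm : ∀ w, 0 ≤ m w) {w : List (Fin N)}
    (hw : w.length ≤ q) : m w ≤ wordSum q m := by
  have h1 : m w ≤ ∑ v : List.Vector (Fin N) w.length, m v.1 :=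
    Finset.single_le_sum (f := fun v : List.Vector (Fin N) w.length => m v.1)
      (fun v _ => hm v.1) (a := (⟨w, rfl⟩ : List.Vector (Fin N) w.length)) (Finset.mem_univ _)
  refine h1.trans ?_
  exact Finset.single_le_sum (f := fun j => ∑ v : List.Vector (Fin N) j, m v.1)
    (fun j _ => Finset.sum_nonneg fun v _ => hm v.1) (Finset.mem_range.2 (by omega))

lemma wordSum_nonneg {q : ℕ} {m : List (Fin N) → ℝ} (hm : ∀ w, 0 ≤ m w) : 0 ≤ wordSum q m :=
  Finset.sum_nonneg fun _ _ => Finset.sum_nonneg fun v _ => hm v.1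

lemma tendsto_wordSum {ι : Type*} {l : Filter ι} {q : ℕ} {m : ι → List (Fin N) → ℝ}
    (h : ∀ w : List (Fin N), w.length ≤ q → Tendsto (fun i => m i w) l (𝓝 0)) :
    Tendsto (fun i => wordSum q (m i)) l (𝓝 0) := by
  have : Tendsto (fun i => wordSum q (m i)) l
      (𝓝 (∑ j ∈ Finset.range (q + 1), ∑ v : List.Vector (Fin N) j, 0)) := by
    refine tendsto_finsetSum _ fun j hj => tendsto_finsetSum _ fun v _ => h v.1 ?_
    have := Finset.mem_range.1 hj
    rw [v.2]; omega
  simpa using this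

lemma tendsto_toReal_mf {g : Space N → ℝ} (hg : MemLp g 2 volume) :
    Tendsto (fun n => (eLpNorm (mf n g - g) 2 volume).toReal) atTop (𝓝 0) := by
  exact (ENNReal.tendsto_toReal ENNReal.zero_ne_top).comp (tendsto_mf_L2 hg)

lemma WD.mf_sub {w : List (Fin N)} {f g : Space N → ℝ} (h : WD w f g) (n : ℕ) :
    WD w (mf n f - f) (mf n g - g) := by
  have := ((smooth_mf n h.1).wd w).sub h
  rwa [D_mf n h] at this

lemma HB.hconv_mf {q : ℕ} {B : ℝ} {f : Space N → ℝ} (hf : HB q B f) :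
    HConv atTop q (fun n => mf n f) f := by
  classical
  set m : ℕ → List (Fin N) → ℝ := fun n w => if w.length ≤ q then
    (eLpNorm (mf n (W w f) - W w f) 2 volume).toReal else 0 with hm
  have hm0 : ∀ n w, 0 ≤ m n w := fun n w => by
    simp only [hm]; split_ifs; exacts [ENNReal.toReal_nonneg, le_rfl]
  have hW : ∀ w : List (Fin N), w.length ≤ q → MemLp (W w f) 2 volume := fun w hw =>
    (hf.l2le_of_wd hw (hf.wd_W hw)).memLp (hf.wd_W hw).aesm
  refine ⟨⟨B, hf⟩, fun n => wordSum q (m n), tendsto_wordSum fun w hw => ?_,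
    Eventually.of_forall fun n => ⟨wordSum_nonneg (hm0 n), fun w hw => ?_⟩⟩
  · simp only [hm, if_pos hw]
    exact tendsto_toReal_mf (hW w hw)
  · refine ⟨_, (hf.wd_W hw).mf_sub n, ?_⟩
    have h1 := MemLp.l2le ((memLp_conv (isTest_mol n) (hW w hw)).sub (hW w hw))
    refine L2le.mono h1 (le_trans (le_of_eq ?_) (le_wordSum (hm0 n) hw))
    simp only [hm, if_pos hw]; rfl

lemma abs_sub_le_of_abs_partialDeriv_le {f : Space N → ℝ} (hf : Smooth f) {B : ℝ} (hB : 0 ≤ B)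
    (h : ∀ i x, |partialDeriv i f x| ≤ B) (x y : Space N) : |f x - f y| ≤ N * B * ‖x - y‖ := by
  have hd : ∀ z, ‖fderiv ℝ f z‖ ≤ N * B := by
    intro z
    refine ContinuousLinearMap.opNorm_le_bound _ (by positivity) fun v => ?_
    have hv : v = ∑ i, v i • EuclideanSpace.single i (1 : ℝ) := by
      ext j
      simp [Finset.sum_apply, Pi.single_apply]
    have : fderiv ℝ f z v = ∑ i, v i * partialDeriv i f z := by
      conv_lhs => rw [hv]
      rw [map_sum]
      simp [partialDeriv]
    rw [this]
    calc ‖∑ i, v i * partialDeriv i f z‖ ≤ ∑ i, ‖v i * partialDeriv i f z‖ := norm_sum_le _ _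
      _ ≤ ∑ _i : Fin N, ‖v‖ * B := by
          refine Finset.sum_le_sum fun i _ => ?_
          rw [norm_mul]
          gcongr
          · exact PiLp.norm_apply_le v i
          · exact h i z
      _ = N * B * ‖v‖ := by simp; ring
  have := Convex.norm_image_sub_le_of_norm_fderiv_le (𝕜 := ℝ) (f := f) (s := univ) (x := y) (y := x)
    (fun z _ => hf.differentiable z) (fun z _ => hd z) convex_univ (mem_univ _) (mem_univ _)
  simpa using this

/-- A function with bounded weak gradient agrees almost everywhere with a Lipschitz function, and
averaging over a ball of radius 1/(n + 1) moves a Lipschitz function by at most its constant times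
that radius. -/
lemma abs_mf_sub_le {f : Space N → ℝ} (hf : LocallyIntegrable f) {B : ℝ} (hB : 0 ≤ B)
    (h : ∀ i, ∃ g, WD [i] f g ∧ ∀ᵐ x, |g x| ≤ B) (n : ℕ) :
    ∀ᵐ x, |mf n f x - f x| ≤ N * B * (1 / (n + 1)) := by
  have hL : ∀ m x y, |mf m f x - mf m f y| ≤ N * B * ‖x - y‖ := fun m =>
    abs_sub_le_of_abs_partialDeriv_le (smooth_mf m hf) hB fun i x => by
      obtain ⟨g, hg, hgB⟩ := h i
      rw [← D_singleton, D_mf m hg]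
      exact abs_mf_le m hgB x
  set s : Set (Space N) := {x | Tendsto (fun m => mf m f x) atTop (𝓝 (f x))} with hs
  -- The mollifications are uniformly Lipschitz, so f is Lipschitz on the set of full measure where
  -- they converge to it, and is extended from there.
  have hLs : LipschitzOnWith (N * B).toNNReal f s := by
    refine LipschitzOnWith.of_dist_le_mul fun x hx y hy => ?_
    rw [Real.dist_eq, dist_eq_norm, Real.coe_toNNReal _ (by positivity)]
    exact le_of_tendsto (hx.sub hy).abs (Eventually.of_forall fun m => hL m x y)
  obtain ⟨g, hg, hfg⟩ := hLs.extend_real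
  have hae : f =ᵐ[volume] g := by
    filter_upwards [tendsto_mf hf] with x hx
    exact hfg hx
  filter_upwards [hae] with x hx
  rw [mf_congr n hae, hx, ← Real.dist_eq]
  refine ContDiffBump.dist_normed_convolution_le (φ := bumpSeq N n)
    hg.continuous.aestronglyMeasurable fun y hy => ?_
  refine (hg.dist_le_mul y x).trans ?_
  rw [Real.coe_toNNReal _ (by positivity)]
  gcongr
  exact (Metric.mem_ball.1 hy).le

lemma ZB.hconv_of_wd {q : ℕ} {B : ℝ} {f g : Space N → ℝ} (hf : ZB (q + 1) B f) {i : Fin N}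
    (hg : WD [i] f g) : HB q B g := hf.of_wd (w := [i]) (by simp) hg

lemma ZB.exists_grad_bound {q : ℕ} (hq : N < 2 * q) {B : ℝ} {f : Space N → ℝ} (hf : ZB (q + 1) B f) :
    ∃ B', 0 ≤ B' ∧ ∀ i, ∃ g, WD [i] f g ∧ ∀ᵐ x, |g x| ≤ B' := by
  obtain ⟨C, hC, hs⟩ := HB.sobolev N hq
  refine ⟨C * B, mul_nonneg (by linarith) hf.nonneg, fun i => ?_⟩
  obtain ⟨g, hg, _⟩ := hf.wd [i] (by simp) (by simp)
  exact ⟨g, hg, (hs _ _ (hf.hconv_of_wd hg)).bdd⟩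

/-- Uniform convergence needs a bounded gradient, hence one derivative beyond the Sobolev threshold;
this explains the order q + 1. -/
lemma ZB.zconv_mf {q : ℕ} (hq : N < 2 * q) {B : ℝ} {f : Space N → ℝ} (hf : ZB (q + 1) B f) :
    ZConv atTop (q + 1) (fun n => mf n f) f := by
  classical
  obtain ⟨B', hB', hgrad⟩ := hf.exists_grad_bound hq
  set m : ℕ → List (Fin N) → ℝ := fun n w => if w ≠ [] ∧ w.length ≤ q + 1 then
    (eLpNorm (mf n (W w f) - W w f) 2 volume).toReal else 0 with hm
  have hm0 : ∀ n w, 0 ≤ m n w := fun n w => by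
    simp only [hm]; split_ifs; exacts [ENNReal.toReal_nonneg, le_rfl]
  have hW : ∀ w : List (Fin N), w ≠ [] → w.length ≤ q + 1 → MemLp (W w f) 2 volume :=
    fun w h0 hw => (hf.l2le_of_wd h0 hw (hf.wd_W h0 hw)).memLp (hf.wd_W h0 hw).aesm
  have hb0 : ∀ n : ℕ, 0 ≤ N * B' * (1 / ((n : ℝ) + 1)) := fun n => by positivity
  refine ⟨⟨B, hf⟩, fun n => N * B' * (1 / ((n : ℝ) + 1)) + wordSum (q + 1) (m n), ?_,
    Eventually.of_forall fun n => ⟨add_nonneg (hb0 n) (wordSum_nonneg (hm0 n)),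
      ((smooth_mf n hf.locInt).continuous.locallyIntegrable).sub hf.locInt, ?_, fun w h0 hw => ?_⟩⟩
  · have h1 : Tendsto (fun n : ℕ => N * B' * (1 / ((n : ℝ) + 1))) atTop (𝓝 0) := by
      simpa using tendsto_one_div_add_atTop_nhds_zero_nat.const_mul (N * B')
    have h2 : Tendsto (fun n => wordSum (q + 1) (m n)) atTop (𝓝 0) := by
      refine tendsto_wordSum fun w hw => ?_
      simp only [hm]
      by_cases h0 : w = []
      · simp [h0]
      · simp only [if_pos (And.intro h0 hw)]
        exact tendsto_toReal_mf (hW w h0 hw)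
    simpa using h1.add h2
  · filter_upwards [abs_mf_sub_le hf.locInt hB' hgrad n] with x hx
    have := wordSum_nonneg (q := q + 1) (hm0 n)
    rw [Pi.sub_apply]; linarith
  · refine ⟨_, (hf.wd_W h0 hw).mf_sub n, ?_⟩
    have h1 := MemLp.l2le ((memLp_conv (isTest_mol n) (hW w h0 hw)).sub (hW w h0 hw))
    refine L2le.mono h1 (le_trans (le_of_eq ?_) ((le_wordSum (hm0 n) hw).trans
      (le_add_of_nonneg_left (hb0 n))))
    simp only [hm, if_pos (And.intro h0 hw)]; rfl

end MollifierConvergence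

/-! ### Rules for derivatives and products of convergent families. -/

section ConvergenceRules

variable {N : ℕ} {ι : Type*} {l : Filter ι} {q : ℕ} {F G : ι → Space N → ℝ} {f g : Space N → ℝ}

/-- The weak Laplacian in terms of words. -/
def lapW (f : Space N → ℝ) : Space N → ℝ := ∑ i, W [i, i] f

lemma HConv.pd (h : HConv l (q + 1) F f) (hs : ∀ n, Smooth (F n)) (i : Fin N) :
    HConv l q (fun n => partialDeriv i (F n)) (W [i] f) := h.derivD (w := [i]) hs

lemma HConv.pd_zero (h : HConv l (q + 1) F 0) (hs : ∀ n, Smooth (F n)) (i : Fin N) :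
    HConv l q (fun n => partialDeriv i (F n)) 0 :=
  h.of_wd (w := [i]) (Eventually.of_forall fun n => (hs n).wd [i]) (WD.zero [i])

lemma ZConv.pd (h : ZConv l (q + 1) F f) (hs : ∀ n, Smooth (F n)) (i : Fin N) :
    HConv l q (fun n => partialDeriv i (F n)) (W [i] f) := h.derivD (w := [i]) (by simp) hs

lemma HConv.lap (h : HConv l (q + 2) F f) (hs : ∀ n, Smooth (F n)) :
    HConv l q (fun n => lap (F n)) (lapW f) :=
  HConv.sum Finset.univ fun i _ => h.derivD (w := [i, i]) hs

lemma ZConv.lap (h : ZConv l (q + 2) F f) (hs : ∀ n, Smooth (F n)) :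
    HConv l q (fun n => LandauLifshitz.lap (F n)) (lapW f) :=
  HConv.sum Finset.univ fun i _ => h.derivD (w := [i, i]) (by simp) hs

lemma HConv.lapW (h : HConv l (q + 2) F f) :
    HConv l q (fun n => lapW (F n)) (lapW f) :=
  HConv.sum Finset.univ fun i _ => h.derivW (w := [i, i])

lemma ZConv.lapW (h : ZConv l (q + 2) F f) :
    HConv l q (fun n => LandauLifshitz.lapW (F n)) (LandauLifshitz.lapW f) :=
  HConv.sum Finset.univ fun i _ => h.derivW (w := [i, i]) (by simp)

lemma HConv.lap_zero (h : HConv l (q + 2) F 0) (hs : ∀ n, Smooth (F n)) :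
    HConv l q (fun n => LandauLifshitz.lap (F n)) 0 := by
  have := HConv.sum Finset.univ fun i _ => (h.pd_zero hs i).pd_zero (fun n => (hs n).pd i) i
  rwa [Finset.sum_const_zero] at this

lemma HConv.mul_zero (hq : N < 2 * q) (hF : HConv l q F f) (hG : HConv l q G 0) :
    HConv l q (fun n => F n * G n) 0 := by
  have := hF.mul hq hG
  rwa [MulZeroClass.mul_zero] at this

lemma ZConv.mul_zero (hq : N < 2 * q) (hF : ZConv l q F f) (hG : HConv l q G 0) :
    HConv l q (fun n => F n * G n) 0 := by
  have := hF.mul hq hG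
  rwa [MulZeroClass.mul_zero] at this

lemma ZConv.zero_mul (hq : N < 2 * q) (hF : ZConv l q F 0) (hG : HConv l q G g) :
    HConv l q (fun n => F n * G n) 0 := by
  have := hF.mul hq hG
  rwa [MulZeroClass.zero_mul] at this

lemma HConv.sum_zero {κ : Type*} (s : Finset κ) {F : κ → ι → Space N → ℝ}
    (h : ∀ a ∈ s, HConv l q (F a) 0) : HConv l q (fun i => ∑ a ∈ s, F a i) 0 := by
  have := HConv.sum s h
  simpa using this

lemma HConv.smul_zero (c : ℝ) (hF : HConv l q F 0) : HConv l q (fun i => c • F i) 0 := by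
  have := hF.smul c
  rwa [_root_.smul_zero] at this

lemma HConv.add_zero (hF : HConv l q F 0) (hG : HConv l q G 0) :
    HConv l q (fun i => F i + G i) 0 := by
  have := hF.add hG
  rwa [_root_.add_zero] at this

lemma HConv.sub_zero (hF : HConv l q F 0) (hG : HConv l q G 0) :
    HConv l q (fun i => F i - G i) 0 := by
  have := hF.sub hG
  rwa [_root_.sub_zero] at this

/-- Convergence of cross products. -/
lemma HConv.crs (hq : N < 2 * q) {F G : ι → Fin 3 → Space N → ℝ} {f g : Fin 3 → Space N → ℝ}
    (hF : ∀ a, ZConv l q (fun n => F n a) (f a)) (hG : ∀ a, HConv l q (fun n => G n a) (g a))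
    (a : Fin 3) : HConv l q (fun n => crs (F n) (G n) a) (crs f g a) := by
  fin_cases a
  · exact ((hF 1).mul hq (hG 2)).sub ((hF 2).mul hq (hG 1))
  · exact ((hF 2).mul hq (hG 0)).sub ((hF 0).mul hq (hG 2))
  · exact ((hF 0).mul hq (hG 1)).sub ((hF 1).mul hq (hG 0))

lemma HConv.pr {F : ι → Fin 3 → Space N → ℝ} {f : Fin 3 → Space N → ℝ}
    (hF : ∀ a, a ≠ 1 → HConv l q (fun n => F n a) (f a)) (a : Fin 3) :
    HConv l q (fun n => pr (F n) a) (pr f a) := by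
  fin_cases a
  · exact hF 0 (by decide)
  · exact HConv.zero
  · exact hF 2 (by decide)

lemma HB.of_smooth_pd {q : ℕ} {M : ℝ} {f : Space N → ℝ} (hf : Smooth f) (hM : 0 ≤ M)
    (hb : ∀ᵐ x, |f x| ≤ M) (h : ∀ i, HB q M (partialDeriv i f)) : ZB (q + 1) M f := by
  refine ⟨hM, hf.continuous.locallyIntegrable, hb, fun w h0 hw => ⟨D w f, hf.wd w, ?_⟩⟩
  obtain ⟨w', i, rfl⟩ : ∃ w' i, w = w' ++ [i] := ⟨w.dropLast, w.getLast h0,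
    (List.dropLast_append_getLast h0).symm⟩
  rw [D_append, D_singleton]
  exact (h i).l2le_of_wd (by simp at hw; omega) ((hf.pd i).wd w')

end ConvergenceRules

/-! ### Mollified sphere-valued maps and their distance to the sphere. -/

section Sphere

variable {N : ℕ}

/-- Maps with values in the sphere of `ℝ³`, with Sobolev regularity of order `q`. -/
structure SphereMap (q : ℕ) (u : Fin 3 → Space N → ℝ) : Prop where
  zb : ∀ a, ∃ B, ZB q B (u a)
  hb : ∀ a, a ≠ 1 → ∃ B, HB q B (u a)
  sph : ∀ᵐ x, u 0 x ^ 2 + u 1 x ^ 2 + u 2 x ^ 2 = 1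

/-- The mollification of a map. -/
def mfv (n : ℕ) (u : Fin 3 → Space N → ℝ) : Fin 3 → Space N → ℝ := fun a => mf n (u a)

variable {q : ℕ} {u : Fin 3 → Space N → ℝ}

namespace SphereMap

lemma locInt (h : SphereMap q u) (a : Fin 3) : LocallyIntegrable (u a) :=
  (h.zb a).choose_spec.locInt

lemma smooth (h : SphereMap q u) (n : ℕ) (a : Fin 3) : Smooth (mfv n u a) :=
  smooth_mf n (h.locInt a)

lemma zconv (h : SphereMap (q + 1) u) (hq : N < 2 * q) (a : Fin 3) :
    ZConv atTop (q + 1) (fun n => mfv n u a) (u a) := (h.zb a).choose_spec.zconv_mf hq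

lemma hconv (h : SphereMap q u) (a : Fin 3) (ha : a ≠ 1) :
    HConv atTop q (fun n => mfv n u a) (u a) := (h.hb a ha).choose_spec.hconv_mf

lemma abs_le (h : SphereMap q u) (a : Fin 3) : ∀ᵐ x, |u a x| ≤ 1 := by
  filter_upwards [h.sph] with x hx
  rw [abs_le_one_iff_mul_self_le_one]
  fin_cases a <;> simp only [Fin.zero_eta, Fin.mk_one, Fin.reduceFinMk] <;>
    nlinarith [sq_nonneg (u 0 x), sq_nonneg (u 1 x), sq_nonneg (u 2 x)]

lemma abs_mfv_le (h : SphereMap q u) (n : ℕ) (a : Fin 3) (x : Space N) : |mfv n u a x| ≤ 1 :=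
  abs_mf_le n (h.abs_le a) x

lemma smooth_half (h : SphereMap q u) (n : ℕ) : Smooth (half (mfv n u)) :=
  LandauLifshitz.smooth_half fun a => h.smooth n a

lemma partialDeriv_half {u : Fin 3 → Space N → ℝ} (hu : ∀ a, Smooth (u a)) (i : Fin N) :
    partialDeriv i (half u) = u 0 * partialDeriv i (u 0) + u 1 * partialDeriv i (u 1) +
      u 2 * partialDeriv i (u 2) := by
  unfold half
  rw [partialDeriv_smul, partialDeriv_add (((hu 0).mul (hu 0)).add ((hu 1).mul (hu 1)))
    ((hu 2).mul (hu 2)), partialDeriv_add ((hu 0).mul (hu 0)) ((hu 1).mul (hu 1)),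
    partialDeriv_mul (hu 0) (hu 0), partialDeriv_mul (hu 1) (hu 1), partialDeriv_mul (hu 2) (hu 2)]
  ext x; simp; ring

/-- The limit is ∑ u_a ∂ᵢu_a, formally ∂ᵢ(|u|²/2) = 0. It is identified with zero by testing: after
integration by parts, |uₙ|²/2 tends to 1/2 boundedly, and the derivative of a test function has
integral zero. -/
lemma hconv_partialDeriv_half (h : SphereMap (q + 1) u) (hq : N < 2 * q) (i : Fin N) :
    HConv atTop q (fun n => partialDeriv i (half (mfv n u))) 0 := by
  have hm : ∀ a, HConv atTop q (fun n => mfv n u a * partialDeriv i (mfv n u a))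
      (u a * W [i] (u a)) := fun a =>
    ((h.zconv hq a).mono_order (by omega)).mul hq ((h.zconv hq a).pd (fun n => h.smooth n a) i)
  have h1 := ((hm 0).add (hm 1)).add (hm 2)
  have e : ∀ n, partialDeriv i (half (mfv n u)) = mfv n u 0 * partialDeriv i (mfv n u 0) +
      mfv n u 1 * partialDeriv i (mfv n u 1) + mfv n u 2 * partialDeriv i (mfv n u 2) :=
    fun n => partialDeriv_half (h.smooth n) i
  simp only [← e] at h1
  set g := u 0 * W [i] (u 0) + u 1 * W [i] (u 1) + u 2 * W [i] (u 2) with hg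
  refine h1.congr (Eventually.of_forall fun _ => Filter.EventuallyEq.refl _ _) ?_
  refine ae_eq_of_test (h1.memLp.locallyIntegrable (by norm_num)) locallyIntegrable_zero
    fun φ hφ => ?_
  have hφb : HB 0 (eLpNorm φ 2 volume).toReal φ := ⟨ENNReal.toReal_nonneg, fun w hw => by
    have : w = [] := List.length_eq_zero_iff.1 (Nat.le_zero.1 hw)
    subst this
    exact ⟨φ, hφ.smooth.wd [], MemLp.l2le (hφ.memLp 2)⟩⟩
  have t1 := (h1.mono_order (Nat.zero_le q)).tendsto_integral_mul (HConv.const hφb)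
  have e2 : ∀ n, ∫ x, partialDeriv i (half (mfv n u)) x * φ x =
      -∫ x, half (mfv n u) x * D [i] φ x := fun n => by
    have := integral_mul_D_test (h.smooth_half n) hφ [i]
    rw [this, D_singleton]; simp
  simp only [e2] at t1
  have t2 : Tendsto (fun n => ∫ x, half (mfv n u) x * D [i] φ x) atTop
      (𝓝 (∫ x, (1 / 2 : ℝ) * D [i] φ x)) := by
    refine tendsto_integral_of_dominated_convergence (fun x => 2 * |D [i] φ x|)
      (fun n => (h.smooth_half n).aesm.mul (hφ.word [i]).smooth.aesm)
      ((memLp_one_iff_integrable.1 ((hφ.word [i]).memLp 1)).abs.const_mul _)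
      (fun n => Eventually.of_forall fun x => ?_) ?_
    · rw [Real.norm_eq_abs, abs_mul]
      gcongr
      have hs : ∀ a, mfv n u a x * mfv n u a x ≤ 1 := fun a =>
        abs_le_one_iff_mul_self_le_one.1 (h.abs_mfv_le n a x)
      have h0 : ∀ a, 0 ≤ mfv n u a x * mfv n u a x := fun a => mul_self_nonneg _
      simp only [half, Pi.smul_apply, Pi.add_apply, Pi.mul_apply, smul_eq_mul]
      rw [abs_of_nonneg (by linarith [h0 0, h0 1, h0 2])]
      linarith [hs 0, hs 1, hs 2]
    · filter_upwards [tendsto_mf (h.locInt 0), tendsto_mf (h.locInt 1), tendsto_mf (h.locInt 2),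
        h.sph] with x h0 h1 h2 hx
      refine Tendsto.mul_const _ ?_
      have := ((h0.mul h0).add (h1.mul h1)).add (h2.mul h2) |>.const_mul (1 / 2 : ℝ)
      have e3 : u 0 x * u 0 x + u 1 x * u 1 x + u 2 x * u 2 x = 1 := by linarith
      rw [e3, mul_one] at this
      exact this
  have e4 : ∫ x, (1 / 2 : ℝ) * D [i] φ x = 0 := by
    have := integral_mul_D_test (F := fun _ : Space N => (1 / 2 : ℝ)) contDiff_const hφ [i]
    rw [D_const _ (by simp)] at this
    rw [this]
    simp
  rw [e4] at t2
  have := tendsto_nhds_unique t1 t2.neg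
  rw [this]
  simp

/-- The derivatives are covered by the preceding lemma. The uniform part follows from |u| = 1 and
the uniform convergence of the mollifications. -/
lemma zconv_dfct (h : SphereMap (q + 1) u) (hq : N < 2 * q) :
    ZConv atTop (q + 1) (fun n => dfct (mfv n u)) 0 := by
  have hs : ∀ n, Smooth (dfct (mfv n u)) := fun n =>
    (((((h.smooth n 0).mul (h.smooth n 0)).add ((h.smooth n 1).mul (h.smooth n 1))).add
      ((h.smooth n 2).mul (h.smooth n 2)))).sub contDiff_const
  have hd : ∀ n i, partialDeriv i (dfct (mfv n u)) = (2 : ℝ) • partialDeriv i (half (mfv n u)) := by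
    intro n i
    have e : dfct (mfv n u) = (2 : ℝ) • half (mfv n u) - fun _ => 1 := by
      unfold dfct half; ext x; simp
    rw [e, partialDeriv_sub ((h.smooth_half n).smul 2) contDiff_const, partialDeriv_smul,
      partialDeriv_const, _root_.sub_zero]
  have hH : ∀ i, HConv atTop q (fun n => partialDeriv i (dfct (mfv n u))) 0 := fun i => by
    simp only [hd]; exact (h.hconv_partialDeriv_half hq i).smul_zero 2
  choose M hM hMb using fun i => (hH i).conv
  choose S hS hSb using fun a => (h.zconv hq a).conv
  refine ⟨⟨0, ⟨le_rfl, locallyIntegrable_zero, by simp,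
    fun w _ _ => ⟨0, WD.zero w, l2le_zero⟩⟩⟩,
    fun n => ∑ a, 2 * |S a n| + ∑ i, |M i n|, ?_, ?_⟩
  · have t1 : Tendsto (fun n => ∑ a, 2 * |S a n|) atTop (𝓝 (∑ _a : Fin 3, 2 * |(0 : ℝ)|)) :=
      tendsto_finsetSum _ fun a _ => (hS a).abs.const_mul 2
    have t2 : Tendsto (fun n => ∑ i, |M i n|) atTop (𝓝 (∑ _i : Fin N, |(0 : ℝ)|)) :=
      tendsto_finsetSum _ fun i _ => (hM i).abs
    simpa using t1.add t2
  · have hall := (eventually_all.2 hMb).and (eventually_all.2 hSb)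
    filter_upwards [hall] with n hn
    rw [_root_.sub_zero]
    have hMn : 0 ≤ ∑ i, |M i n| := by positivity
    have hSn : 0 ≤ ∑ a, 2 * |S a n| := by positivity
    refine HB.of_smooth_pd (hs n) (add_nonneg hSn hMn) ?_ fun i => ?_
    · filter_upwards [(hn.2 0).bdd, (hn.2 1).bdd, (hn.2 2).bdd, h.sph, h.abs_le 0, h.abs_le 1,
        h.abs_le 2] with x h0 h1 h2 hx b0 b1 b2
      -- A difference of squares factors, and the sum of the two values is at most 2 because
      -- mollification preserves the bound 1.
      have key : ∀ a, |u a x| ≤ 1 → |(mfv n u a - u a) x| ≤ S a n →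
          |mfv n u a x * mfv n u a x - u a x * u a x| ≤ 2 * |S a n| := by
        intro a hb hd
        have e : mfv n u a x * mfv n u a x - u a x * u a x =
          (mfv n u a x + u a x) * (mfv n u a - u a) x := by rw [Pi.sub_apply]; ring
        rw [e, abs_mul]
        have h3 : |mfv n u a x + u a x| ≤ 2 :=
          (abs_add_le _ _).trans (by linarith [h.abs_mfv_le n a x])
        exact mul_le_mul h3 (hd.trans (le_abs_self _)) (abs_nonneg _) (by norm_num)
      have e : dfct (mfv n u) x = (mfv n u 0 x * mfv n u 0 x - u 0 x * u 0 x) +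
          (mfv n u 1 x * mfv n u 1 x - u 1 x * u 1 x) +
          (mfv n u 2 x * mfv n u 2 x - u 2 x * u 2 x) := by
        simp only [dfct, Pi.sub_apply, Pi.add_apply, Pi.mul_apply]; linarith
      rw [e, Fin.sum_univ_three]
      have := (abs_add_le _ _).trans (add_le_add ((abs_add_le _ _).trans
        (add_le_add (key 0 b0 h0) (key 1 b1 h1))) (key 2 b2 h2))
      linarith
    · have := hn.1 i
      rw [_root_.sub_zero] at this
      refine this.mono ((le_abs_self _).trans ?_)
      have := Finset.single_le_sum (f := fun i => |M i n|) (fun i _ => abs_nonneg _)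
        (Finset.mem_univ i)
      linarith

end SphereMap

end Sphere

/-! ### Passage to the limit in the estimate at a fixed time. -/

section FixedTime

variable {N : ℕ}

/-- The effective field, with weak derivatives. -/
def fieldW (lam : ℝ) (u : Fin 3 → Space N → ℝ) : Fin 3 → Space N → ℝ :=
  fun a => lapW (u a) - lam • pr u a

/-- The velocity, with weak derivatives. -/
def veloW (lam : ℝ) (u : Fin 3 → Space N → ℝ) : Fin 3 → Space N → ℝ :=
  fun a => -crs u (fieldW lam u) a

/-- The second order time derivative, with weak derivatives. -/
def accW (lam : ℝ) (u v : Fin 3 → Space N → ℝ) (a : Fin 3) : Space N → ℝ :=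
  -crs v (fieldW lam u) a - crs u (fieldW lam v) a

/-- The left-hand side of the wave equation satisfied by `u`, up to nonlinear terms. -/
def waveW (lam : ℝ) (u v : Fin 3 → Space N → ℝ) (a : Fin 3) : Space N → ℝ :=
  accW lam u v a + lapW (lapW (u a)) - (2 * lam) • lapW (pr u a) + lam ^ 2 • pr u a

/-- The left-hand side of the wave equation, for smooth maps. -/
def wave (lam : ℝ) (u : Fin 3 → Space N → ℝ) (a : Fin 3) : Space N → ℝ :=
  acc lam u (velo lam u) a + lap (lap (u a)) - (2 * lam) • lap (pr u a) + lam ^ 2 • pr u a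

lemma Smooth.crs {f g : Fin 3 → Space N → ℝ} (hf : ∀ a, Smooth (f a)) (hg : ∀ a, Smooth (g a))
    (a : Fin 3) : Smooth (crs f g a) := by
  fin_cases a
  · exact ((hf 1).mul (hg 2)).sub ((hf 2).mul (hg 1))
  · exact ((hf 2).mul (hg 0)).sub ((hf 0).mul (hg 2))
  · exact ((hf 0).mul (hg 1)).sub ((hf 1).mul (hg 0))

lemma smooth_velo (lam : ℝ) {u : Fin 3 → Space N → ℝ} (hu : ∀ a, Smooth (u a)) (a : Fin 3) :
    Smooth (velo lam u a) := (Smooth.crs hu (smooth_field lam hu) a).neg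

lemma smooth_wave (lam : ℝ) {u : Fin 3 → Space N → ℝ} (hu : ∀ a, Smooth (u a)) (a : Fin 3) :
    Smooth (wave lam u a) :=
  ((((Smooth.crs (smooth_velo lam hu) (smooth_field lam hu) a).neg.sub
    (Smooth.crs hu (smooth_field lam (smooth_velo lam hu)) a)).add (hu a).lap.lap).sub
    ((smooth_pr hu a).lap.smul _)).add ((smooth_pr hu a).smul _)

namespace SphereMap

variable {k : ℕ} {u : Fin 3 → Space N → ℝ}

lemma hconv_field (h : SphereMap (k + 4) u) (hk : N < 2 * k) (lam : ℝ) (a : Fin 3) :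
    HConv atTop (k + 2) (fun n => field lam (mfv n u) a) (fieldW lam u a) :=
  ((h.zconv (q := k + 3) (by omega) a).lap fun n => h.smooth n a).sub
    ((HConv.pr (fun a ha => (h.hconv a ha).mono_order (by omega)) a).smul lam)

lemma hconv_velo (h : SphereMap (k + 4) u) (hk : N < 2 * k) (lam : ℝ) (a : Fin 3) :
    HConv atTop (k + 2) (fun n => velo lam (mfv n u) a) (veloW lam u a) :=
  (HConv.crs (by omega) (fun a => (h.zconv (q := k + 3) (by omega) a).mono_order (by omega))
    (fun a => h.hconv_field hk lam a) a).neg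

lemma hconv_acc (h : SphereMap (k + 4) u) (hk : N < 2 * k) (lam : ℝ) (a : Fin 3) :
    HConv atTop k (fun n => acc lam (mfv n u) (velo lam (mfv n u)) a)
      (accW lam u (veloW lam u) a) := by
  have hv := h.hconv_velo hk lam
  have hf : ∀ a, HConv atTop k (fun n => field lam (velo lam (mfv n u)) a)
      (fieldW lam (veloW lam u) a) := fun a =>
    ((hv a).lap fun n => smooth_velo lam (h.smooth n) a).sub
      ((HConv.pr (fun a _ => (hv a).mono_order (by omega)) a).smul lam)
  exact (HConv.crs hk (fun a => ((hv a).mono_order (by omega)).toZConv hk)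
    (fun a => (h.hconv_field hk lam a).mono_order (by omega)) a).neg.sub
    (HConv.crs hk (fun a => (h.zconv (q := k + 3) (by omega) a).mono_order (by omega)) hf a)

lemma hconv_wave (h : SphereMap (k + 4) u) (hk : N < 2 * k) (lam : ℝ) (a : Fin 3) :
    HConv atTop k (fun n => wave lam (mfv n u) a) (waveW lam u (veloW lam u) a) := by
  have hp := HConv.pr (fun a ha => h.hconv a ha) a
  have h1 := ((h.zconv (q := k + 3) (by omega) a).lap fun n => h.smooth n a).lap
    fun n => (h.smooth n a).lap
  exact (((h.hconv_acc hk lam a).add h1).sub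
    (((hp.mono_order (by omega : k + 2 ≤ k + 4)).lap fun n => smooth_pr (h.smooth n) a).smul _)).add
    ((hp.mono_order (by omega)).smul _)

/-- Every term has a factor that tends to zero: the defect of |u| = 1, or a derivative of |u|²/2.
The most demanding one is Δ²(|u|²/2); convergence of its gradient at order k + 3 leaves order k
after three more derivatives. -/
lemma hconv_errT (h : SphereMap (k + 4) u) (hk : N < 2 * k) (lam : ℝ) (a : Fin 3) :
    HConv atTop k (fun n => errT lam (mfv n u) a) 0 := by
  have hc : ∀ i, HConv atTop (k + 3) (fun n => partialDeriv i (half (mfv n u))) 0 :=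
    h.hconv_partialDeriv_half (by omega)
  have sc : ∀ n, Smooth (half (mfv n u)) := h.smooth_half
  have hlc : HConv atTop (k + 2) (fun n => lap (half (mfv n u))) 0 :=
    HConv.sum_zero Finset.univ fun i _ => (hc i).pd_zero (fun n => (sc n).pd i) i
  have hllc : HConv atTop k (fun n => lap (lap (half (mfv n u)))) 0 :=
    hlc.lap_zero fun n => (sc n).lap
  have hd : ZConv atTop k (fun n => dfct (mfv n u)) 0 :=
    (h.zconv_dfct (q := k + 3) (by omega)).mono_order (by omega)
  have hz := fun a => h.zconv (q := k + 3) (by omega) a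
  have hl : ∀ a, HConv atTop (k + 2) (fun n => lap (mfv n u a)) (lapW (u a)) := fun a =>
    (hz a).lap fun n => h.smooth n a
  have hf := h.hconv_field hk lam
  have hp : HConv atTop (k + 4) (fun n => pr (mfv n u) a) (pr u a) :=
    HConv.pr (fun a ha => h.hconv a ha) a
  have t1 : HConv atTop k (fun n => lap (mfv n u a) * lap (half (mfv n u))) 0 :=
    ((hl a).mono_order (by omega)).mul_zero hk (hlc.mono_order (by omega))
  have t2 : HConv atTop k (fun n => gr (mfv n u a) (lap (half (mfv n u)))) 0 :=
    HConv.sum_zero Finset.univ fun i _ =>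
      (((hz a).pd (fun n => h.smooth n a) i).mono_order (by omega)).mul_zero hk
        ((hlc.mono_order (by omega)).pd_zero (fun n => (sc n).lap) i)
  have t3 : HConv atTop k (fun n => gr (field lam (mfv n u) a) (half (mfv n u))) 0 :=
    HConv.sum_zero Finset.univ fun i _ =>
      (((hf a).mono_order (by omega : k + 1 ≤ k + 2)).pd
        (fun n => smooth_field lam (h.smooth n) a) i).mul_zero hk ((hc i).mono_order (by omega))
  have t4 : HConv atTop k (fun n => mfv n u a * lap (lap (half (mfv n u)))) 0 :=
    ((hz a).mono_order (by omega)).mul_zero hk hllc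
  have t5 : HConv atTop k (fun n => dfct (mfv n u) * lap (field lam (mfv n u) a)) 0 :=
    hd.zero_mul hk ((hf a).lap fun n => smooth_field lam (h.smooth n) a)
  have t6 : HConv atTop k (fun n => dfct (mfv n u) * field lam (mfv n u) a) 0 :=
    hd.zero_mul hk ((hf a).mono_order (by omega))
  have t7 : HConv atTop k (fun n => (![0, lam • (dfct (mfv n u) * lap (mfv n u 1)), 0] :
      Fin 3 → Space N → ℝ) a) 0 := by
    fin_cases a
    · exact HConv.zero
    · exact (hd.zero_mul hk ((hl 1).mono_order (by omega))).smul_zero lam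
    · exact HConv.zero
  have t8 : HConv atTop k (fun n => pr (mfv n u) a * lap (half (mfv n u))) 0 :=
    (hp.mono_order (by omega)).mul_zero hk (hlc.mono_order (by omega))
  exact ((((((t1.add_zero (t2.smul_zero 2)).sub_zero (t3.smul_zero 2)).add_zero t4).sub_zero
    t5).add_zero (t6.smul_zero lam)).sub_zero t7).sub_zero (t8.smul_zero lam)

end SphereMap

/-- The bounds entering in the energy estimate of order `s + 2`, with weak derivatives. -/
structure CtrlW (s : ℕ) (lam A X : ℝ) (u : Fin 3 → Space N → ℝ) : Prop where
  A_nonneg : 0 ≤ A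
  X_nonneg : 0 ≤ X
  one_le : 1 ≤ lam
  supA : ∀ a, a ≠ 1 → ∀ᵐ x, |u a x| ≤ A
  supd : ∀ a i, ∀ᵐ x, |W [i] (u a) x| ≤ A
  dX : ∀ a i (w : List (Fin N)), w.length = s ∨ w.length = s + 1 → L2le (W (w ++ [i]) (u a)) X
  pX : ∀ a, a ≠ 1 → ∀ w : List (Fin N), w.length = s ∨ w.length = s + 1 → L2le (W w (u a)) X
  pX' : ∀ a, a ≠ 1 → ∀ w : List (Fin N), w.length = s → L2le (W w (u a)) (X / lam)

/-- Mollification increases neither uniform nor L² norms, so the bounds are inherited, even with the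
larger number X'. -/
lemma SphereMap.ctrl {s k : ℕ} {lam A X : ℝ} {u : Fin 3 → Space N → ℝ} (h : SphereMap (k + 4) u)
    (hs : s ≤ k) (hc : CtrlW s lam A X u) {X' : ℝ} (hX : X ≤ X') (n : ℕ) :
    Ctrl s lam A X' (mfv n u) := by
  have hlam : 0 < lam := lt_of_lt_of_le one_pos hc.one_le
  have hwz : ∀ a (w : List (Fin N)), w ≠ [] → w.length ≤ k + 4 → WD w (u a) (W w (u a)) :=
    fun a w h0 hw => (h.zb a).choose_spec.wd_W h0 hw
  have hwh : ∀ a, a ≠ 1 → ∀ (w : List (Fin N)), w.length ≤ k + 4 → WD w (u a) (W w (u a)) :=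
    fun a ha w hw => (h.hb a ha).choose_spec.wd_W hw
  refine ⟨fun a => (h.zb a).choose_spec.nice_mf (by omega) n,
    fun a ha => (h.hb a ha).choose_spec.nice2_mf n, hc.A_nonneg, hc.X_nonneg.trans hX, hc.one_le,
    fun a x => h.abs_mfv_le n a x, fun a ha x => abs_mf_le n (hc.supA a ha) x, fun a i x => ?_,
    fun a i w hw => ?_, fun a ha w hw => ?_, fun a ha w hw => ?_⟩
  · rw [← D_singleton, mfv, D_mf n (hwz a [i] (by simp) (by simp))]
    exact abs_mf_le n (hc.supd a i) x
  · have hd := hwz a (w ++ [i]) (by simp) (by simp; omega)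
    rw [← D_singleton, ← D_append, mfv, D_mf n hd]
    exact ((hc.dX a i w hw).mollify hd.aesm n).mono hX
  · have hd := hwh a ha w (by omega)
    rw [mfv, D_mf n hd]
    exact ((hc.pX a ha w hw).mollify hd.aesm n).mono hX
  · have hd := hwh a ha w (by omega)
    rw [mfv, D_mf n hd]
    exact ((hc.pX' a ha w hw).mollify hd.aesm n).mono (by gcongr)

/-- The energy estimate at a fixed time. -/
lemma weak_estimate (N s : ℕ) : ∃ C, 0 ≤ C ∧ ∀ k, N < 2 * k → s ≤ k →
    ∀ (lam A X : ℝ) (u : Fin 3 → Space N → ℝ), SphereMap (k + 4) u → CtrlW s lam A X u →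
    ∀ w : List (Fin N), w.length = s → (∀ a, L2le (W w (veloW lam u a)) X) →
    ∑ a, ∫ x, W w (veloW lam u a) x * W w (waveW lam u (veloW lam u) a) x ≤
      C * (lam * (A ^ 2 * X ^ 2)) := by
  obtain ⟨C, hC, hest⟩ := smooth_estimate N s
  refine ⟨C, hC, fun k hk hs lam A X u h hc w hw hv => ?_⟩
  have hlam : 0 < lam := lt_of_lt_of_le one_pos hc.one_le
  have hX := hc.X_nonneg
  have hwk : w.length ≤ k := by omega
  have cv : ∀ a, HConv atTop 0 (fun n => D w (velo lam (mfv n u) a)) (W w (veloW lam u a)) :=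
    fun a => ((h.hconv_velo hk lam a).mono_order (by omega : 0 + w.length ≤ k + 2)).derivD
      fun n => smooth_velo lam (h.smooth n) a
  have cz : ∀ a, HConv atTop 0 (fun n => D w (wave lam (mfv n u) a))
      (W w (waveW lam u (veloW lam u) a)) :=
    fun a => ((h.hconv_wave hk lam a).mono_order (by omega : 0 + w.length ≤ k)).derivD
      fun n => smooth_wave lam (h.smooth n) a
  -- Writing the remainder as a difference gives its smoothness without inspecting its terms.
  have se : ∀ n a, errT lam (mfv n u) a =
      wave lam (mfv n u) a - (cub lam (mfv n u) a + mfv n u a * gK (mfv n u)) := fun n a => by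
    rw [eq_sub_iff_add_eq', ← acc_add_eq lam (h.smooth n) a]; rfl
  have sK : ∀ n, Smooth (gK (mfv n u)) := fun n =>
    Smooth.smul (Smooth.sum fun i _ => Smooth.sum fun j _ => Smooth.sum fun b _ =>
      ((((h.smooth n b).pd i).mul ((h.smooth n b).pd j)).pd j).pd i) _
  obtain ⟨c, hc0, hcub⟩ := cub_le N s
  have sP : ∀ n a, Smooth (cub lam (mfv n u) a + mfv n u a * gK (mfv n u)) := fun n a =>
    (hcub lam A X _ (h.ctrl hs hc le_rfl n) a).smooth.add ((h.smooth n a).mul (sK n))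
  have sE : ∀ n a, Smooth (errT lam (mfv n u) a) := fun n a => by
    rw [se]; exact (smooth_wave lam (h.smooth n) a).sub (sP n a)
  have ce : ∀ a, HConv atTop 0 (fun n => D w (errT lam (mfv n u) a)) 0 := fun a =>
    ((h.hconv_errT hk lam a).mono_order (by omega : 0 + w.length ≤ k)).of_wd
      (Eventually.of_forall fun n => (sE n a).wd w) (WD.zero w)
  have t1 : Tendsto (fun n => ∑ a, ∫ x, D w (velo lam (mfv n u) a) x *
      D w (wave lam (mfv n u) a) x) atTop (𝓝 (∑ a, ∫ x, W w (veloW lam u a) x *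
        W w (waveW lam u (veloW lam u) a) x)) :=
    tendsto_finsetSum _ fun a _ => (cv a).tendsto_integral_mul (cz a)
  have t2 : Tendsto (fun n => ∑ a, ∫ x, D w (velo lam (mfv n u) a) x *
      D w (errT lam (mfv n u) a) x) atTop (𝓝 0) := by
    have := tendsto_finsetSum (Finset.univ : Finset (Fin 3))
      fun a _ => (cv a).tendsto_integral_mul (ce a)
    simpa using this
  -- The velocity is nonlinear, so the velocity of the mollified map is not the mollified velocity
  -- and need not satisfy the bound X. It converges in L², hence satisfies X + δ eventually; δ tends
  -- to zero at the end.
  have key : ∀ δ : ℝ, 0 < δ → ∑ a, ∫ x, W w (veloW lam u a) x *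
      W w (waveW lam u (veloW lam u) a) x ≤ C * (lam * (A ^ 2 * (X + δ) ^ 2)) := by
    intro δ hδ
    have t3 : Tendsto (fun n => C * (lam * (A ^ 2 * (X + δ) ^ 2)) +
        ∑ a, ∫ x, D w (velo lam (mfv n u) a) x * D w (errT lam (mfv n u) a) x) atTop
        (𝓝 (C * (lam * (A ^ 2 * (X + δ) ^ 2)) + 0)) := t2.const_add _
    rw [add_zero] at t3
    refine le_of_tendsto_of_tendsto t1 t3 ?_
    have hev : ∀ᶠ n in atTop, ∀ a,
        (eLpNorm (D w (velo lam (mfv n u) a) - W w (veloW lam u a)) 2 volume).toReal < δ :=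
      eventually_all.2 fun a => (cv a).tendsto_eLpNorm.eventually (gt_mem_nhds hδ)
    have hm1 := eventually_all.2 fun a => (cv a).eventually_memLp
    have hm2 := eventually_all.2 fun a => (cz a).eventually_memLp
    have hm3 := eventually_all.2 fun a => (ce a).eventually_memLp
    filter_upwards [hev, hm1, hm2, hm3] with n hn m1 m2 m3
    have hvn : ∀ a, L2le (D w (velo lam (mfv n u) a)) (X + δ) := fun a => by
      have h1 := MemLp.l2le ((m1 a).sub (cv a).memLp)
      have h2 := (h1.mono (hn a).le).add (hv a) ((m1 a).sub (cv a).memLp).1 (cv a).memLp.1 hδ.le hX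
      rw [sub_add_cancel, add_comm δ] at h2
      exact h2
    have hb := hest lam A (X + δ) (mfv n u) (h.ctrl hs hc (by linarith) n) w hw hvn
    have eD : ∀ a, D w (wave lam (mfv n u) a) =
        D w (cub lam (mfv n u) a + mfv n u a * gK (mfv n u)) + D w (errT lam (mfv n u) a) := by
      intro a
      rw [← D_add (sP n a) (sE n a), se]
      congr 1; ring
    have m4 : ∀ a, MemLp (D w (cub lam (mfv n u) a + mfv n u a * gK (mfv n u))) 2 volume := by
      intro a
      have := (m2 a).sub (m3 a)
      rwa [eD, add_sub_cancel_right] at this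
    have eI : ∀ a, ∫ x, D w (velo lam (mfv n u) a) x * D w (wave lam (mfv n u) a) x =
        (∫ x, D w (velo lam (mfv n u) a) x *
          D w (cub lam (mfv n u) a + mfv n u a * gK (mfv n u)) x) +
        ∫ x, D w (velo lam (mfv n u) a) x * D w (errT lam (mfv n u) a) x := by
      intro a
      rw [eD]
      simp only [Pi.add_apply, mul_add]
      exact integral_add ((m1 a).integrable_mul (m4 a)) ((m1 a).integrable_mul (m3 a))
    simp only [eI, Finset.sum_add_distrib]
    linarith
  have tl : Tendsto (fun δ : ℝ => C * (lam * (A ^ 2 * (X + δ) ^ 2))) (𝓝[>] 0)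
      (𝓝 (C * (lam * (A ^ 2 * (X + 0) ^ 2)))) := by
    refine Tendsto.mono_left ?_ nhdsWithin_le_nhds
    have : Continuous fun δ : ℝ => C * (lam * (A ^ 2 * (X + δ) ^ 2)) := by fun_prop
    exact this.tendsto 0
  rw [add_zero] at tl
  exact ge_of_tendsto tl (eventually_nhdsWithin_of_forall fun δ hδ => key δ hδ)

end FixedTime

/-! ### Integration by parts and commutation for weak derivatives. -/

section WeakByParts

variable {N : ℕ}

/-- Functions with weak derivatives of order at most `q`. -/
def Reg (q : ℕ) (f : Space N → ℝ) : Prop := ∀ w : List (Fin N), w.length ≤ q → WD w f (W w f)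

/-- Functions in the Sobolev space of order `q`. -/
def HR (q : ℕ) (f : Space N → ℝ) : Prop := ∃ B, HB q B f

variable {q : ℕ} {f g : Space N → ℝ}

lemma HB.reg {B : ℝ} (h : HB q B f) : Reg q f := fun _ hw => h.wd_W hw

lemma ZB.reg {B : ℝ} (h : ZB q B f) : Reg q f := fun w hw => by
  by_cases h0 : w = []
  · subst h0; exact (WD.nil h.locInt).wd_W
  · exact h.wd_W h0 hw

lemma HR.reg (h : HR q f) : Reg q f := h.choose_spec.reg

lemma HR.memLp (h : HR q f) : MemLp f 2 volume := h.choose_spec.memLp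

lemma HR.mono_order {q' : ℕ} (h : HR q f) (hq : q' ≤ q) : HR q' f :=
  ⟨_, h.choose_spec.mono_order hq⟩

lemma HR.word {w : List (Fin N)} (h : HR (q + w.length) f) : HR q (W w f) :=
  ⟨_, h.choose_spec.of_wd (h.reg w (by omega))⟩

lemma HR.memLp_word {w : List (Fin N)} (h : HR q f) (hw : w.length ≤ q) : MemLp (W w f) 2 volume :=
  ((h.mono_order (by omega : 0 + w.length ≤ q)).word).memLp

lemma HR.add (hf : HR q f) (hg : HR q g) : HR q (f + g) := ⟨_, hf.choose_spec.add hg.choose_spec⟩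

lemma HR.smul (c : ℝ) (hf : HR q f) : HR q (c • f) := ⟨_, hf.choose_spec.smul c⟩

lemma HR.zero (q : ℕ) : HR q (0 : Space N → ℝ) := ⟨0, HB.zero q⟩

lemma HR.sum {κ : Type*} (s : Finset κ) {F : κ → Space N → ℝ} (h : ∀ a ∈ s, HR q (F a)) :
    HR q (∑ a ∈ s, F a) := by
  classical
  induction s using Finset.induction_on with
  | empty => simpa using HR.zero q
  | insert a s ha ih =>
    rw [Finset.sum_insert ha]
    exact (h a (by simp)).add (ih fun b hb => h b (by simp [hb]))

lemma HConv.hr {ι : Type*} {l : Filter ι} {F : ι → Space N → ℝ} (h : HConv l q F f) : HR q f :=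
  h.bound

lemma ZB.hr_word {B : ℝ} {w : List (Fin N)} (h : ZB (q + w.length) B f) (hw : w ≠ []) :
    HR q (W w f) := ⟨_, h.of_wd hw (h.wd_W hw (by omega))⟩

lemma HR.hconv_mf (h : HR q f) : HConv atTop q (fun n => mf n f) f := h.choose_spec.hconv_mf

lemma Reg.W_W {w v : List (Fin N)} (h : Reg q f) (hq : w.length + v.length ≤ q) :
    W v (W w f) =ᵐ[volume] W (w ++ v) f :=
  ((h w (by omega)).of_append (h (w ++ v) (by simpa using hq))).W_ae

lemma W_perm {w v : List (Fin N)} (h : w.Perm v) (f : Space N → ℝ) : W w f = W v f := by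
  unfold W
  congr 1
  ext i
  exact h.count_eq i

lemma Reg.W_comm {w v : List (Fin N)} (h : Reg q f) (hq : w.length + v.length ≤ q) :
    W v (W w f) =ᵐ[volume] W w (W v f) := by
  refine (h.W_W hq).trans ?_
  rw [W_perm List.perm_append_comm f]
  exact (h.W_W (by omega)).symm

lemma Reg.wd_lapW (h : Reg q f) {w : List (Fin N)} (hq : w.length + 2 ≤ q) :
    WD w (lapW f) (∑ i, W ([i, i] ++ w) f) :=
  WD.sum _ fun i _ => (h [i, i] (by simp; omega)).of_append (h _ (by simp; omega))

lemma Reg.W_lapW (h : Reg q f) {w : List (Fin N)} (hq : w.length + 2 ≤ q) :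
    W w (lapW f) =ᵐ[volume] lapW (W w f) := by
  refine (h.wd_lapW hq).W_ae.trans ?_
  have : ∀ᵐ x, ∀ i, W [i, i] (W w f) x = W ([i, i] ++ w) f x := ae_all_iff.2 fun i => by
    rw [W_perm List.perm_append_comm f]
    exact h.W_W (by simpa using hq)
  filter_upwards [this] with x hx
  simp only [lapW, Finset.sum_apply, hx]

lemma HR.lapW (h : HR (q + 2) f) : HR q (lapW f) :=
  HR.sum _ fun i _ => HR.word (w := [i, i]) h

lemma ZB.hr_lapW {B : ℝ} (h : ZB (q + 2) B f) : HR q (lapW f) :=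
  HR.sum _ fun i _ => h.hr_word (w := [i, i]) (by simp)

lemma MemLp.integrable_fun_mul (hf : MemLp f 2 volume) (hg : MemLp g 2 volume) :
    Integrable fun x => f x * g x := hf.integrable_mul hg

/-- Both sides are limits of the corresponding integrals for mollifications. -/
lemma integral_W_mul (hf : HR 1 f) (hg : HR 1 g) (i : Fin N) :
    ∫ x, W [i] f x * g x = -∫ x, f x * W [i] g x := by
  have cf := hf.hconv_mf
  have cg := hg.hconv_mf
  have sf : ∀ n, Smooth (mf n f) := fun n => smooth_mf n hf.choose_spec.locInt
  have sg : ∀ n, Smooth (mf n g) := fun n => smooth_mf n hg.choose_spec.locInt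
  have t1 := (cf.pd sf i).tendsto_integral_mul (cg.mono_order zero_le_one)
  have t2 := ((cf.mono_order zero_le_one).tendsto_integral_mul (cg.pd sg i)).neg
  refine tendsto_nhds_unique t1 (t2.congr fun n => ?_)
  exact ((nice2_mf n hf.memLp).integral_partialDeriv_mul (nice2_mf n hg.memLp) i).symm

lemma integral_lapW_mul (hf : HR 2 f) (hg : HR 1 g) :
    ∫ x, lapW f x * g x = -∑ i, ∫ x, W [i] f x * W [i] g x := by
  have h1 : ∀ i, HR 1 (W [i] f) := fun i => HR.word (w := [i]) hf
  have e : ∀ i, ∫ x, W [i, i] f x * g x = -∫ x, W [i] f x * W [i] g x := fun i => by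
    rw [← integral_W_mul (h1 i) hg]
    exact integral_congr_ae ((hf.reg.W_W (w := [i]) (v := [i]) le_rfl).symm.mono
      fun x hx => by simp only [List.singleton_append] at hx; simp only [hx])
  simp only [lapW, Finset.sum_apply, Finset.sum_mul]
  rw [integral_finsetSum _ fun i _ => MemLp.integrable_fun_mul (hf.memLp_word (w := [i, i]) le_rfl) hg.memLp]
  simp only [e, Finset.sum_neg_distrib]

lemma integral_lapW_mul_comm (hf : HR 2 f) (hg : HR 2 g) :
    ∫ x, lapW f x * g x = ∫ x, f x * lapW g x := by
  rw [integral_lapW_mul hf (hg.mono_order (by omega))]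
  have := integral_lapW_mul hg (hf.mono_order (by omega : 1 ≤ 2))
  simp only [mul_comm (f _)]
  rw [this]
  simp only [mul_comm]

/-- The second derivatives are controlled by the Laplacian. -/
lemma integral_hess_eq {F : Fin N → Space N → ℝ} (hF : ∀ i, HR 2 (F i))
    (hs : ∀ i j, W [j] (F i) =ᵐ[volume] W [i] (F j)) :
    ∑ i, ∑ j, ∫ x, W [j] (F i) x ^ 2 = ∫ x, (∑ i, W [i] (F i) x) ^ 2 := by
  have hF1 : ∀ i, HR 1 (F i) := fun i => (hF i).mono_order (by omega)
  have hW : ∀ i j, HR 1 (W [j] (F i)) := fun i j => HR.word (w := [j]) (hF i)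
  -- The curl condition exchanges the indices once, and two integrations by parts exchange the
  -- derivatives. The squares thus become products of diagonal terms, that is, the square of the
  -- divergence.
  have e1 : ∀ i j, ∫ x, W [j] (F i) x ^ 2 = ∫ x, W [i] (F i) x * W [j] (F j) x := by
    intro i j
    have a1 : ∫ x, W [j] (F i) x ^ 2 = ∫ x, W [j] (F i) x * W [i] (F j) x :=
      integral_congr_ae ((hs i j).mono fun x hx => by simp only [← hx, sq])
    have a2 : ∫ x, F i x * W [j] (W [i] (F j)) x = ∫ x, F i x * W [i] (W [j] (F j)) x :=
      integral_congr_ae (((hF j).reg.W_comm (w := [i]) (v := [j]) le_rfl).mono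
        fun x hx => by simp only [hx])
    rw [a1, integral_W_mul (hF1 i) (hW j i), a2, ← integral_W_mul (hF1 i) (hW j j)]
  simp only [e1]
  simp only [sq, Finset.sum_mul_sum]
  rw [integral_finsetSum _ fun i _ => integrable_finsetSum _ fun j _ =>
    MemLp.integrable_fun_mul (hW i i).memLp (hW j j).memLp]
  refine Finset.sum_congr rfl fun i _ => ?_
  rw [integral_finsetSum _ fun j _ => MemLp.integrable_fun_mul (hW i i).memLp (hW j j).memLp]

end WeakByParts

/-! ### The derivative of the energy in terms of the wave operator. -/

section Rate

variable {N k : ℕ} {u : Fin 3 → Space N → ℝ}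

lemma integral_congr_mul {f f' g g' : Space N → ℝ} (hf : f =ᵐ[volume] f') (hg : g =ᵐ[volume] g') :
    ∫ x, f x * g x = ∫ x, f' x * g' x :=
  integral_congr_ae (by filter_upwards [hf, hg] with x h1 h2; rw [h1, h2])

/-- The sum of the terms of the derivative of the energy, in terms of the wave operator. -/
lemma SphereMap.rate_eq (h : SphereMap (k + 4) u) (hk : N < 2 * k) (lam : ℝ) {w : List (Fin N)}
    (hw : w.length ≤ k) (a : Fin 3) :
    (∫ x, W w (veloW lam u a) x * W w (accW lam u (veloW lam u) a) x) +
      (∫ x, W w (lapW (u a)) x * W w (lapW (veloW lam u a)) x) +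
      (2 * lam) * (∑ i, ∫ x, W w (W [i] (pr u a)) x * W w (W [i] (veloW lam u a)) x) +
      lam ^ 2 * ∫ x, W w (pr u a) x * W w (veloW lam u a) x =
    ∫ x, W w (veloW lam u a) x * W w (waveW lam u (veloW lam u) a) x := by
  set v := veloW lam u with hv
  have hp : HR (k + 4) (pr u a) := (HConv.pr (fun a ha => h.hconv a ha) a).hr
  have hV : HR (k + 2) (v a) := (h.hconv_velo hk lam a).hr
  have hA : HR k (accW lam u v a) := (h.hconv_acc hk lam a).hr
  have hL : HR (k + 2) (lapW (u a)) := (h.zb a).choose_spec.hr_lapW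
  have hVw : HR 2 (W w (v a)) := (hV.mono_order (by omega)).word
  have hLw : HR 2 (W w (lapW (u a))) := (hL.mono_order (by omega)).word
  have hpw : HR 2 (W w (pr u a)) := (hp.mono_order (by omega)).word
  have hLL : HR k (lapW (lapW (u a))) := hL.lapW
  have hLp : HR (k + 2) (lapW (pr u a)) := hp.lapW
  -- The Laplacian is moved from the velocity to Δu, producing the bilaplacian.
  have e1 : ∫ x, W w (lapW (u a)) x * W w (lapW (v a)) x =
      ∫ x, W w (v a) x * W w (lapW (lapW (u a))) x := by
    rw [integral_congr_mul (EventuallyEq.refl _ _) (hV.reg.W_lapW (by omega)),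
      ← integral_lapW_mul_comm hLw hVw,
      integral_congr_mul (hL.reg.W_lapW (by omega)).symm (EventuallyEq.refl _ _)]
    simp only [mul_comm]
  -- The scalar product of the gradients is minus the product with the Laplacian, which gives the
  -- sign of the term −2λΔ in the wave operator.
  have e2 : ∑ i, ∫ x, W w (W [i] (pr u a)) x * W w (W [i] (v a)) x =
      -∫ x, W w (v a) x * W w (lapW (pr u a)) x := by
    have := integral_lapW_mul hpw (hVw.mono_order (by omega))
    rw [integral_congr_mul (EventuallyEq.refl _ _) (hp.reg.W_lapW (by omega))]
    simp only [mul_comm (W w (v a) _)]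
    rw [this, neg_neg]
    exact Finset.sum_congr rfl fun i _ => integral_congr_mul
      (hp.reg.W_comm (by simp; omega)) (hV.reg.W_comm (by simp; omega))
  have hwd : WD w (waveW lam u v a) (W w (accW lam u v a) + W w (lapW (lapW (u a))) -
      (2 * lam) • W w (lapW (pr u a)) + lam ^ 2 • W w (pr u a)) :=
    (((hA.reg w hw).add (hLL.reg w hw)).sub ((hLp.reg w (by omega)).smul _)).add
      ((hp.reg w (by omega)).smul _)
  rw [integral_congr_mul (EventuallyEq.refl _ _) hwd.W_ae, e1, e2]
  have mV := hVw.memLp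
  have i1 := MemLp.integrable_fun_mul mV (hA.memLp_word hw)
  have i2 := MemLp.integrable_fun_mul mV (hLL.memLp_word hw)
  have i3 := (MemLp.integrable_fun_mul mV
    (hLp.memLp_word (by omega : w.length ≤ k + 2))).const_mul (2 * lam)
  have i4 := (MemLp.integrable_fun_mul mV hpw.memLp).const_mul (lam ^ 2)
  have e3 : ∀ x, W w (v a) x * (W w (accW lam u v a) + W w (lapW (lapW (u a))) -
      (2 * lam) • W w (lapW (pr u a)) + lam ^ 2 • W w (pr u a)) x =
      W w (v a) x * W w (accW lam u v a) x + W w (v a) x * W w (lapW (lapW (u a))) x -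
      (2 * lam) * (W w (v a) x * W w (lapW (pr u a)) x) +
      lam ^ 2 * (W w (v a) x * W w (pr u a) x) := fun x => by
    simp; ring
  simp only [e3]
  rw [integral_add (by exact (i1.add i2).sub i3) i4, integral_sub (by exact i1.add i2) i3,
    integral_add i1 i2, integral_const_mul, integral_const_mul]
  simp only [mul_comm (W w (pr u a) _)]
  ring

end Rate

/-! ### Comparison with the norms of the statement. -/

section Norms

variable {N : ℕ} {f g : Space N → ℝ}

/-- Almost everywhere equal functions have the same predicate `HasWeakDeriv`, so the choice returns
the very same function, not merely an equivalent one. -/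
lemma weakDeriv_congr (h : f =ᵐ[volume] g) (α : Fin N → ℕ) : weakDeriv α f = weakDeriv α g := by
  have : HasWeakDeriv α f = HasWeakDeriv α g := by
    funext p
    rw [eq_iff_iff, hasWeakDeriv_iff, hasWeakDeriv_iff]
    exact ⟨fun hp => WD.congr hp h (EventuallyEq.refl _ _),
      fun hp => WD.congr hp h.symm (EventuallyEq.refl _ _)⟩
  unfold weakDeriv
  rw [this]

lemma W_congr (h : f =ᵐ[volume] g) (w : List (Fin N)) : W w f = W w g := weakDeriv_congr h _

lemma hdotSq_congr (h : f =ᵐ[volume] g) (j : ℕ) : hdotSq j f = hdotSq j g := by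
  simp only [hdotSq, weakDeriv_congr h]

lemma hdotSq_nonneg (j : ℕ) (f : Space N → ℝ) : 0 ≤ hdotSq j f :=
  Finset.sum_nonneg fun _ _ => integral_nonneg fun _ => sq_nonneg _

lemma integral_W_sq_le (w : List (Fin N)) (f : Space N → ℝ) :
    ∫ x, W w f x ^ 2 ≤ hdotSq w.length f :=
  Finset.single_le_sum (f := fun α => ∫ x, weakDeriv α f x ^ 2)
    (fun _ _ => integral_nonneg fun _ => sq_nonneg _)
    (Finset.mem_piAntidiag.2 ⟨sum_cnt w, fun i _ => Finset.mem_univ i⟩)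

lemma cnt_replicate (i : Fin N) (n : ℕ) : cnt (List.replicate n i) = Pi.single i n := by
  ext j
  rw [cnt, List.count_replicate, Pi.single_apply]
  simp only [beq_iff_eq]
  simp only [eq_comm]

lemma weakPartial_eq (i : Fin N) (f : Space N → ℝ) : weakPartial i f = W [i] f := by
  unfold weakPartial W
  rw [← cnt_replicate i 1]; rfl

lemma weakLaplacian_eq (f : Space N → ℝ) : weakLaplacian f = lapW f := by
  ext x
  simp only [weakLaplacian, lapW, Finset.sum_apply, W, ← cnt_replicate]
  rfl

/-- An a priori bound is required: `toReal` sends an infinite norm to 0. -/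
lemma abs_le_supNorm {B : ℝ} (h : ∀ᵐ x, |f x| ≤ B) : ∀ᵐ x, |f x| ≤ supNorm f := by
  have hfin : eLpNorm f ⊤ volume ≠ ⊤ := by
    rw [eLpNorm_exponent_top]
    exact (eLpNormEssSup_lt_top_of_ae_bound (f := f) (C := B) h).ne
  filter_upwards [ae_le_eLpNormEssSup (f := f) (μ := (volume : Measure (Space N)))] with x hx
  rw [← eLpNorm_exponent_top] at hx
  have := ENNReal.toReal_mono hfin hx
  rwa [toReal_enorm, Real.norm_eq_abs] at this

end Norms

/-! ### The energies control the quantities A and X. -/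

section EnergyBounds

variable {N : ℕ} {U V : Space N → Fin 3 → ℝ} {lam : ℝ}

lemma energyOrder_eq (lam : ℝ) (j : ℕ) (U V : Space N → Fin 3 → ℝ) :
    2 * energyOrder lam lam (j + 2) U V = ∑ a, hdotSq j (comp V a) +
      ∑ a, hdotSq j (lapW (comp U a)) + 2 * lam *
        (∑ i, hdotSq j (W [i] (comp U 0)) + ∑ i, hdotSq j (W [i] (comp U 2))) +
      lam ^ 2 * (hdotSq j (comp U 0) + hdotSq j (comp U 2)) := by
  simp only [energyOrder, weakLaplacian_eq, weakPartial_eq]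
  ring

/-- All terms of the energy are nonnegative. The last bound keeps its weight λ², which is the origin
of the gain X/λ. -/
lemma hdotSq_le_energy (hlam : 1 ≤ lam) (j : ℕ) (U V : Space N → Fin 3 → ℝ) :
    (∀ a, hdotSq j (comp V a) ≤ 2 * energyOrder lam lam (j + 2) U V) ∧
    (∀ a, hdotSq j (lapW (comp U a)) ≤ 2 * energyOrder lam lam (j + 2) U V) ∧
    (∀ a, a ≠ 1 → ∀ i, hdotSq j (W [i] (comp U a)) ≤ 2 * energyOrder lam lam (j + 2) U V) ∧
    (∀ a, a ≠ 1 → lam ^ 2 * hdotSq j (comp U a) ≤ 2 * energyOrder lam lam (j + 2) U V) := by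
  rw [energyOrder_eq]
  have p1 : 0 ≤ ∑ a, hdotSq j (comp V a) := Finset.sum_nonneg fun _ _ => hdotSq_nonneg _ _
  have p2 : 0 ≤ ∑ a, hdotSq j (lapW (comp U a)) := Finset.sum_nonneg fun _ _ => hdotSq_nonneg _ _
  have p3 : ∀ a, 0 ≤ ∑ i, hdotSq j (W [i] (comp U a)) := fun a =>
    Finset.sum_nonneg fun _ _ => hdotSq_nonneg _ _
  have p4 : ∀ a, 0 ≤ lam ^ 2 * hdotSq j (comp U a) := fun a =>
    mul_nonneg (sq_nonneg _) (hdotSq_nonneg _ _)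
  have p5 : ∀ a, ∑ i, hdotSq j (W [i] (comp U a)) ≤ 2 * lam * ∑ i, hdotSq j (W [i] (comp U a)) :=
    fun a => le_mul_of_one_le_left (p3 a) (by linarith)
  have h0 := p3 0
  have h2 := p3 2
  have h0' := p5 0
  have h2' := p5 2
  have q0 := p4 0
  have q2 := p4 2
  simp only [mul_add]
  refine ⟨fun a => ?_, fun a => ?_, fun a ha i => ?_, fun a ha => ?_⟩
  · have := Finset.single_le_sum (f := fun a => hdotSq j (comp V a))
      (fun _ _ => hdotSq_nonneg _ _) (Finset.mem_univ a)
    linarith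
  · have := Finset.single_le_sum (f := fun a => hdotSq j (lapW (comp U a)))
      (fun _ _ => hdotSq_nonneg _ _) (Finset.mem_univ a)
    linarith
  · have := Finset.single_le_sum (f := fun i => hdotSq j (W [i] (comp U a)))
      (fun _ _ => hdotSq_nonneg _ _) (Finset.mem_univ i)
    fin_cases a <;> simp at ha this ⊢ <;> linarith
  · fin_cases a <;> simp at ha ⊢ <;> linarith

lemma energyOrder_nonneg (hlam : 1 ≤ lam) (l : ℕ) (U V : Space N → Fin 3 → ℝ) :
    0 ≤ energyOrder lam lam l U V := by
  have h : 0 ≤ energyLL lam lam U := by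
    refine mul_nonneg (by norm_num) (integral_nonneg fun x => ?_)
    have : 0 ≤ gradSq U x := Finset.sum_nonneg fun _ _ => Finset.sum_nonneg fun _ _ => sq_nonneg _
    simp only [Pi.zero_apply]
    positivity
  match l with
  | 0 => exact h
  | 1 => exact h
  | j + 2 =>
    have := (hdotSq_le_energy hlam j U V).1 0
    have := hdotSq_nonneg j (comp V 0)
    linarith

variable {k : ℕ}

/-- The energy contains only Laplacians; all second derivatives are recovered from
`integral_hess_eq`, applied to the gradient of ∂^w u. Working with the gradient avoids the missing
square integrability of the component of index 1. -/
lemma SphereMap.integral_hess_le {u : Fin 3 → Space N → ℝ} (h : SphereMap (k + 4) u)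
    {w : List (Fin N)} (hw : w.length ≤ k) (a : Fin 3) (i j : Fin N) :
    ∫ x, W (w ++ [i, j]) (u a) x ^ 2 ≤ ∫ x, W w (lapW (u a)) x ^ 2 := by
  obtain ⟨B, hB⟩ := h.zb a
  have hr := hB.reg
  have hF : ∀ i, HR 2 (W (w ++ [i]) (u a)) := fun i =>
    (hB.mono_order (by simp; omega)).hr_word (by simp)
  have hij : ∀ i j, W [j] (W (w ++ [i]) (u a)) =ᵐ[volume] W (w ++ [i, j]) (u a) := fun i j => by
    have := hr.W_W (w := w ++ [i]) (v := [j]) (by simp; omega)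
    simpa using this
  have key := integral_hess_eq hF fun i j => (hij i j).trans (by
    rw [W_perm ((List.Perm.swap j i []).append_left w)]
    exact (hij j i).symm)
  have hl : W w (lapW (u a)) =ᵐ[volume] fun x => ∑ i, W [i] (W (w ++ [i]) (u a)) x := by
    have h1 : ∀ᵐ x, ∀ i, W [i] (W (w ++ [i]) (u a)) x = W (w ++ [i, i]) (u a) x :=
      ae_all_iff.2 fun i => hij i i
    filter_upwards [(hr.wd_lapW (w := w) (by omega)).W_ae, h1] with x hx h1
    rw [hx, Finset.sum_apply]
    refine Finset.sum_congr rfl fun i _ => ?_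
    rw [h1, W_perm List.perm_append_comm]
  have e1 : ∫ x, W w (lapW (u a)) x ^ 2 = ∫ x, (∑ i, W [i] (W (w ++ [i]) (u a)) x) ^ 2 :=
    integral_congr_ae (hl.mono fun x hx => by simp only [hx])
  have e2 : ∫ x, W (w ++ [i, j]) (u a) x ^ 2 = ∫ x, W [j] (W (w ++ [i]) (u a)) x ^ 2 :=
    integral_congr_ae ((hij i j).mono fun x hx => by simp only [hx])
  rw [e1, e2, ← key]
  have n : ∀ i j, 0 ≤ ∫ x, W [j] (W (w ++ [i]) (u a)) x ^ 2 := fun i j =>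
    integral_nonneg fun _ => sq_nonneg _
  exact (Finset.single_le_sum (f := fun j => ∫ x, W [j] (W (w ++ [i]) (u a)) x ^ 2)
    (fun j _ => n i j) (Finset.mem_univ j)).trans (Finset.single_le_sum
    (f := fun i => ∑ j, ∫ x, W [j] (W (w ++ [i]) (u a)) x ^ 2)
    (fun i _ => Finset.sum_nonneg fun j _ => n i j) (Finset.mem_univ i))

/-- This is where the energy of order 1 enters, for s = 0, when no energy with a Laplacian controls
the first derivatives of all components. -/
lemma SphereMap.integral_grad_le (h : SphereMap (k + 4) (comp U)) (hlam : 1 ≤ lam) (a : Fin 3)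
    (i : Fin N) : ∫ x, W [i] (comp U a) x ^ 2 ≤ 2 * energyLL lam lam U := by
  have hm : ∀ a i, Integrable fun x => W [i] (comp U a) x ^ 2 := fun a i =>
    (((h.zb a).choose_spec.mono_order (by simp : 0 + [i].length ≤ k + 4)).hr_word
      (w := [i]) (by simp)).memLp.integrable_sq
  have hg : Integrable (gradSq U) := by
    have : gradSq U = fun x => ∑ i, ∑ a, W [i] (comp U a) x ^ 2 := by
      ext x; simp only [gradSq, weakPartial_eq]
    rw [this]
    exact integrable_finsetSum _ fun i _ => integrable_finsetSum _ fun a _ => hm a i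
  have h0 : Integrable fun x => U x 0 ^ 2 := (h.hb 0 (by decide)).choose_spec.memLp.integrable_sq
  have h2 : Integrable fun x => U x 2 ^ 2 := (h.hb 2 (by decide)).choose_spec.memLp.integrable_sq
  have e : 2 * energyLL lam lam U = ∫ x, (gradSq U x + lam * U x 0 ^ 2 + lam * U x 2 ^ 2) := by
    unfold energyLL; ring
  rw [e]
  refine integral_mono (hm a i) ((hg.add (h0.const_mul lam)).add (h2.const_mul lam)) fun x => ?_
  have h3 : W [i] (comp U a) x ^ 2 ≤ gradSq U x := by
    simp only [gradSq, weakPartial_eq]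
    exact (Finset.single_le_sum (f := fun a => W [i] (comp U a) x ^ 2)
      (fun _ _ => sq_nonneg _) (Finset.mem_univ a)).trans (Finset.single_le_sum
      (f := fun i => ∑ a, W [i] (comp U a) x ^ 2)
      (fun _ _ => Finset.sum_nonneg fun _ _ => sq_nonneg _) (Finset.mem_univ i))
  have : 0 ≤ lam * U x 0 ^ 2 := by positivity
  have : 0 ≤ lam * U x 2 ^ 2 := by positivity
  linarith

lemma SphereMap.abs_grad_le (h : SphereMap (k + 4) (comp U)) (hk : N < 2 * k) (a : Fin 3)
    (i : Fin N) : ∀ᵐ x, |W [i] (comp U a) x| ≤ gradSupNorm U := by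
  obtain ⟨C, _, hs⟩ := HB.sobolev N hk
  have hb : ∀ i a, ∃ B, ∀ᵐ x, |W [i] (comp U a) x| ≤ B := fun i a => by
    obtain ⟨B, hB⟩ := ((h.zb a).choose_spec.mono_order
      (by simp : k + [i].length ≤ k + 4)).hr_word (w := [i]) (by simp)
    exact ⟨_, (hs _ _ hB).bdd⟩
  choose B hB using hb
  have hall : ∀ᵐ x, ∀ i a, |W [i] (comp U a) x| ≤ B i a :=
    ae_all_iff.2 fun i => ae_all_iff.2 fun a => hB i a
  have hg : ∀ᵐ x, |Real.sqrt (gradSq U x)| ≤ Real.sqrt (∑ i, ∑ a, B i a ^ 2) := by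
    filter_upwards [hall] with x hx
    rw [abs_of_nonneg (Real.sqrt_nonneg _)]
    refine Real.sqrt_le_sqrt (Finset.sum_le_sum fun i _ => Finset.sum_le_sum fun a _ => ?_)
    rw [weakPartial_eq, ← sq_abs]
    exact pow_le_pow_left₀ (abs_nonneg _) (hx i a) 2
  filter_upwards [abs_le_supNorm hg] with x hx
  refine le_trans ?_ ((le_abs_self _).trans hx)
  refine Real.abs_le_sqrt ?_
  simp only [gradSq, weakPartial_eq]
  exact (Finset.single_le_sum (f := fun a => W [i] (comp U a) x ^ 2)
    (fun _ _ => sq_nonneg _) (Finset.mem_univ a)).trans (Finset.single_le_sum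
    (f := fun i => ∑ a, W [i] (comp U a) x ^ 2)
    (fun _ _ => Finset.sum_nonneg fun _ _ => sq_nonneg _) (Finset.mem_univ i))

lemma l2le_sqrt {f : Space N → ℝ} {e : ℝ} (hf : MemLp f 2 volume) (h : ∫ x, f x ^ 2 ≤ e) :
    L2le f (Real.sqrt e) :=
  L2le_of_integral_sq_le (Real.sqrt_nonneg _) hf
    (by rwa [Real.sq_sqrt ((integral_nonneg fun _ => sq_nonneg _).trans h)])

/-- The energies control the quantities entering in the energy estimate. -/
lemma SphereMap.ctrlW {s : ℕ} (h : SphereMap (k + 4) (comp U)) (hk : N < 2 * k) (hs : s ≤ k)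
    (hlam : 1 ≤ lam) (V : Space N → Fin 3 → ℝ) :
    CtrlW s lam (Real.sqrt (supNorm (comp U 0) ^ 2 + supNorm (comp U 2) ^ 2 + gradSupNorm U ^ 2))
      (Real.sqrt (2 * energyOrder lam lam (s + 2) U V + 2 * energyOrder lam lam (s + 1) U V))
      (comp U) := by
  have hE2 := energyOrder_nonneg hlam (s + 2) U V
  have hE1 := energyOrder_nonneg hlam (s + 1) U V
  set e := 2 * energyOrder lam lam (s + 2) U V + 2 * energyOrder lam lam (s + 1) U V with he
  obtain ⟨-, bL, bG, b0⟩ := hdotSq_le_energy hlam s U V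
  have hmem : ∀ a (w : List (Fin N)), w ≠ [] → w.length ≤ k + 4 →
      MemLp (W w (comp U a)) 2 volume := fun a w h0 hw =>
    (((h.zb a).choose_spec.mono_order (by omega : 0 + w.length ≤ k + 4)).hr_word h0).memLp
  have hmem' : ∀ a, a ≠ 1 → ∀ (w : List (Fin N)), w.length ≤ k + 4 →
      MemLp (W w (comp U a)) 2 volume := fun a ha w hw => HR.memLp_word (h.hb a ha) hw
  have hhess : ∀ a i j (w : List (Fin N)), w.length ≤ k → hdotSq w.length (lapW (comp U a)) ≤ e →
      ∫ x, W (w ++ [i, j]) (comp U a) x ^ 2 ≤ e := fun a i j w hw hle =>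
    (h.integral_hess_le hw a i j).trans ((integral_W_sq_le w _).trans hle)
  -- Derivatives of order s + 1 of all components come from the energy of order s + 1: for s = 0
  -- from its gradient term, for s ≥ 1 by splitting off two letters and using the Laplacian at order
  -- s − 1. This is why the lower energy appears in the estimate.
  have hgrad : ∀ a i (w : List (Fin N)), w.length = s →
      ∫ x, W (w ++ [i]) (comp U a) x ^ 2 ≤ e := by
    intro a i w hw
    rcases List.eq_nil_or_concat w with rfl | ⟨w', j, rfl⟩
    · simp only [List.length_nil] at hw
      subst hw
      have := h.integral_grad_le hlam a i
      have e1 : energyOrder lam lam (0 + 1) U V = energyLL lam lam U := rfl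
      rw [e1] at he
      simp only [List.nil_append]
      linarith
    · simp only [List.concat_eq_append, List.length_append, List.length_singleton] at hw ⊢
      rw [List.append_assoc]
      refine hhess a j i w' (by omega) ?_
      have := (hdotSq_le_energy hlam w'.length U V).2.1 a
      rw [show w'.length + 2 = s + 1 by omega] at this
      linarith
  refine ⟨Real.sqrt_nonneg _, Real.sqrt_nonneg _, hlam, fun a ha => ?_, fun a i => ?_,
    fun a i w hw => ?_, fun a ha w hw => ?_, fun a ha w hw => ?_⟩
  · filter_upwards [abs_le_supNorm (h.abs_le a)] with x hx
    refine hx.trans (Real.le_sqrt_of_sq_le ?_)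
    have := sq_nonneg (supNorm (comp U 0))
    have := sq_nonneg (supNorm (comp U 2))
    have := sq_nonneg (gradSupNorm U)
    fin_cases a <;> simp at ha ⊢ <;> linarith
  · filter_upwards [h.abs_grad_le hk a i] with x hx
    refine hx.trans (Real.le_sqrt_of_sq_le ?_)
    have := sq_nonneg (supNorm (comp U 0))
    have := sq_nonneg (supNorm (comp U 2))
    linarith
  · refine l2le_sqrt (hmem a _ (by simp) (by simp; omega)) ?_
    rcases hw with hw | hw
    · exact hgrad a i w hw
    · rcases List.eq_nil_or_concat w with rfl | ⟨w', j, rfl⟩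
      · simp at hw
      · simp only [List.concat_eq_append, List.length_append, List.length_singleton] at hw ⊢
        rw [List.append_assoc]
        refine hhess a j i w' (by omega) ?_
        rw [show w'.length = s by omega]
        have := bL a
        linarith
  · refine l2le_sqrt (hmem' a ha _ (by omega)) ?_
    rcases hw with hw | hw
    · refine (integral_W_sq_le w _).trans ?_
      rw [hw]
      have h1 := b0 a ha
      have h2 : hdotSq s (comp U a) ≤ lam ^ 2 * hdotSq s (comp U a) :=
        le_mul_of_one_le_left (hdotSq_nonneg _ _) (one_le_pow₀ hlam)
      linarith
    · rcases List.eq_nil_or_concat w with rfl | ⟨w', j, rfl⟩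
      · simp at hw
      · simp only [List.concat_eq_append, List.length_append, List.length_singleton] at hw ⊢
        exact hgrad a j w' (by omega)
  -- The energy bounds λ² times the square of the norm, so the norm is at most X/λ.
  · have h1 := b0 a ha
    have h2 := integral_W_sq_le w (comp U a)
    rw [hw] at h2
    refine L2le_of_integral_sq_le (by positivity) (hmem' a ha _ (by omega)) ?_
    rw [div_pow, Real.sq_sqrt (by positivity), le_div_iff₀ (by positivity)]
    nlinarith [sq_nonneg lam]

lemma SphereMap.l2le_velo {s : ℕ} (h : SphereMap (k + 4) (comp U)) (hk : N < 2 * k) (hs : s ≤ k)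
    (hlam : 1 ≤ lam) (hV : ∀ a, comp V a =ᵐ[volume] veloW lam (comp U) a) {w : List (Fin N)}
    (hw : w.length = s) (a : Fin 3) : L2le (W w (veloW lam (comp U) a))
      (Real.sqrt (2 * energyOrder lam lam (s + 2) U V + 2 * energyOrder lam lam (s + 1) U V)) := by
  refine l2le_sqrt ((h.hconv_velo hk lam a).hr.memLp_word (by omega)) ?_
  rw [← W_congr (hV a)]
  refine (integral_W_sq_le w _).trans ?_
  rw [hw]
  have := (hdotSq_le_energy hlam s U V).1 a
  have := energyOrder_nonneg hlam (s + 1) U V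
  linarith

end EnergyBounds

/-! ### Weak derivative bounds from Sobolev norms. -/

section SobolevNorms

variable {N q : ℕ} {f g : Space N → ℝ}

lemma sobolevSq_nonneg (q : ℕ) (f : Space N → ℝ) : 0 ≤ sobolevSq q f :=
  Finset.sum_nonneg fun _ _ => hdotSq_nonneg _ _

lemma integral_W_sq_le_sobolevSq {w : List (Fin N)} (hw : w.length ≤ q) (f : Space N → ℝ) :
    ∫ x, W w f x ^ 2 ≤ sobolevSq q f :=
  (integral_W_sq_le w f).trans (Finset.single_le_sum (f := fun j => hdotSq j f)
    (fun _ _ => hdotSq_nonneg _ _) (Finset.mem_range.2 (by omega)))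

/-- Existence of the derivatives in L² is a separate hypothesis: weak derivatives that do not exist
and integrals that diverge are 0 by convention, so the number `sobolevSq` alone gives no regularity.
-/
lemma HB.of_sobolevSq (h : ∀ w : List (Fin N), w.length ≤ q → ∃ g, WD w f g ∧ MemLp g 2 volume) :
    HB q (Real.sqrt (sobolevSq q f)) f := by
  refine ⟨Real.sqrt_nonneg _, fun w hw => ?_⟩
  obtain ⟨g, hg, hg2⟩ := h w hw
  exact ⟨W w f, hg.wd_W, l2le_sqrt ((memLp_congr_ae hg.W_ae).2 hg2)
    (integral_W_sq_le_sobolevSq hw f)⟩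

lemma HR.exists_wd (h : HR q f) (w : List (Fin N)) (hw : w.length ≤ q) :
    ∃ g, WD w f g ∧ MemLp g 2 volume := ⟨_, h.reg w hw, h.memLp_word hw⟩

lemma HR.hb_sobolevSq (h : HR q f) : HB q (Real.sqrt (sobolevSq q f)) f :=
  HB.of_sobolevSq h.exists_wd

lemma HR.sub (hf : HR q f) (hg : HR q g) : HR q (f - g) := by
  have := hf.add (hg.smul (-1))
  simpa [sub_eq_add_neg] using this

lemma ZB.of_sobolevSq {B : ℝ} (hl : LocallyIntegrable f) (hb : ∀ᵐ x, |f x| ≤ B)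
    (h : ∀ w : List (Fin N), w ≠ [] → w.length ≤ q → ∃ g, WD w f g ∧ MemLp g 2 volume) :
    ZB q (Real.sqrt (supNorm f ^ 2 + ∑ i, sobolevSq (q - 1) (weakPartial i f))) f := by
  have hp : ∀ i, 0 ≤ sobolevSq (q - 1) (weakPartial i f) := fun i => sobolevSq_nonneg _ _
  have hs : 0 ≤ ∑ i, sobolevSq (q - 1) (weakPartial i f) := Finset.sum_nonneg fun i _ => hp i
  refine ⟨Real.sqrt_nonneg _, hl, ?_, fun w h0 hw => ?_⟩
  · filter_upwards [abs_le_supNorm hb] with x hx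
    exact hx.trans (Real.le_sqrt_of_sq_le (by linarith))
  · obtain ⟨g, hg, hg2⟩ := h w h0 hw
    refine ⟨W w f, hg.wd_W, l2le_sqrt ((memLp_congr_ae hg.W_ae).2 hg2) ?_⟩
    obtain ⟨i, v, rfl⟩ := List.exists_cons_of_ne_nil h0
    simp only [List.length_cons] at hw
    obtain ⟨k, hk, -⟩ := h [i] (by simp) (by simp; omega)
    have e : W v (W [i] f) =ᵐ[volume] W (i :: v) f := (hk.wd_W.of_append hg.wd_W).W_ae
    have e2 : ∫ x, W (i :: v) f x ^ 2 = ∫ x, W v (weakPartial i f) x ^ 2 := by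
      rw [weakPartial_eq]
      exact integral_congr_ae (e.mono fun x hx => by simp only [hx])
    rw [e2]
    have h1 := integral_W_sq_le_sobolevSq (q := q - 1) (w := v) (by omega) (weakPartial i f)
    have h2 := Finset.single_le_sum (f := fun i => sobolevSq (q - 1) (weakPartial i f))
      (fun i _ => hp i) (Finset.mem_univ i)
    have h3 := sq_nonneg (supNorm f)
    linarith

lemma MemH.exists_wd (h : MemH q f) (w : List (Fin N)) (hw : w.length ≤ q) :
    ∃ g, WD w f g ∧ MemLp g 2 volume := by
  obtain ⟨g, hg, hg2⟩ := h.2 (cnt w) (by rw [sum_cnt]; exact hw)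
  exact ⟨g, (hasWeakDeriv_iff.1 hg).perm (wordOf_cnt w), hg2⟩

lemma MemH.hr (h : MemH q f) : HR q f := ⟨_, HB.of_sobolevSq h.exists_wd⟩

lemma HB.sobolevSq_le (q : ℕ) : ∃ C : ℝ, 0 ≤ C ∧ ∀ (f : Space N → ℝ) (M : ℝ), HB q M f →
    sobolevSq q f ≤ C * M ^ 2 := by
  refine ⟨∑ j ∈ Finset.range (q + 1),
    ((Finset.piAntidiag (Finset.univ : Finset (Fin N)) j).card : ℝ), by positivity,
    fun f M h => ?_⟩
  rw [Finset.sum_mul]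
  refine Finset.sum_le_sum fun j hj => ?_
  rw [← nsmul_eq_mul]
  refine Finset.sum_le_card_nsmul _ _ _ fun α hα => ?_
  have hl : (wordOf α).length ≤ q := by
    have : ∑ i, α i = j := (Finset.mem_piAntidiag.1 hα).1
    have := Finset.mem_range.1 hj
    rw [length_wordOf]; omega
  rw [← W_wordOf]
  exact (h.l2le_of_wd hl (h.wd_W hl)).integral_sq_le h.nonneg (h.wd_W hl).aesm

/-- The bounding family is chosen canonically as the Sobolev norm of the difference, which is finite
and comparable to any other bound. -/
lemma HConv.of_eventually {ι : Type*} {l : Filter ι} {F : ι → Space N → ℝ} (hf : HR q f)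
    (h : ∀ η : ℝ, 0 < η → ∀ᶠ i in l, HB q η (F i - f)) : HConv l q F f := by
  refine ⟨hf, fun i => Real.sqrt (sobolevSq q (F i - f)), ?_,
    (h 1 one_pos).mono fun i hi => HR.hb_sobolevSq ⟨1, hi⟩⟩
  have : Tendsto (fun i => sobolevSq q (F i - f)) l (𝓝 0) := by
    obtain ⟨C, hC, hCb⟩ := HB.sobolevSq_le (N := N) q
    rw [Metric.tendsto_nhds]
    intro e he
    have hη : 0 < Real.sqrt (e / (C + 1)) := Real.sqrt_pos.2 (by positivity)
    filter_upwards [h _ hη] with i hi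
    rw [Real.dist_eq, _root_.sub_zero, abs_of_nonneg (sobolevSq_nonneg _ _)]
    refine (hCb _ _ hi).trans_lt ?_
    rw [Real.sq_sqrt (by positivity), mul_div_assoc', div_lt_iff₀ (by positivity)]
    nlinarith
  have h2 := (Real.continuous_sqrt.tendsto 0).comp this
  rwa [Real.sqrt_zero] at h2

end SobolevNorms

/-! ### Strong convergence of difference quotients. -/

section Difference

variable {N q : ℕ}

/-- Difference quotients converge to the time derivative. -/
lemma hconv_slope {T : ℝ} {m v : ℝ → Space N → ℝ} (hm : ∀ t ∈ Icc 0 T, LocallyIntegrable (m t))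
    (hd : ∀ φ, IsTest φ → ∀ t ∈ Icc 0 T,
      HasDerivWithinAt (fun s => ∫ x, m s x * φ x) (∫ x, v t x * φ x) (Icc 0 T) t)
    {s : ℝ} (hs : s ∈ Icc 0 T) (hv : HConv (𝓝[Icc 0 T] s) q v (v s)) :
    HConv (𝓝[Icc 0 T \ {s}] s) q (fun t => (t - s)⁻¹ • (m t - m s)) (v s) := by
  refine HConv.of_eventually hv.hr fun η hη => ?_
  have hvl : LocallyIntegrable (v s) := hv.hr.choose_spec.locInt
  have hev : ∀ᶠ t in 𝓝[Icc 0 T] s, HB q η (v t - v s) := by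
    obtain ⟨M, hM, hMb⟩ := hv.conv
    filter_upwards [hMb, hM.eventually (gt_mem_nhds hη)] with t h1 h2
    exact h1.mono h2.le
  obtain ⟨r, hr, hball⟩ := Metric.mem_nhdsWithin_iff.1 hev
  have hc : Convex ℝ (Metric.ball s r ∩ Icc 0 T) := (convex_ball s r).inter (convex_Icc 0 T)
  have hsS : s ∈ Metric.ball s r ∩ Icc 0 T := ⟨Metric.mem_ball_self hr, hs⟩
  filter_upwards [nhdsWithin_mono s Set.sdiff_subset (inter_mem_nhdsWithin (Icc 0 T)
    (Metric.ball_mem_nhds s hr)), self_mem_nhdsWithin] with t ht htd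
  have hts : t - s ≠ 0 := sub_ne_zero.2 htd.2
  have htS : t ∈ Metric.ball s r ∩ Icc 0 T := ⟨ht.2, ht.1⟩
  have hml := ((hm t ht.1).sub (hm s hs)).smul (t - s)⁻¹
  -- By duality, the Sobolev bound on the difference quotient minus v(s) reduces to a bound tested
  -- against ∂^w φ, which is all that the distributional time derivative provides.
  refine ⟨hη.le, fun w hw => exists_wd_of_dual (hml.sub hvl) w hη.le fun φ hφ => ?_⟩
  have hφw := hφ.word w
  set n := (eLpNorm φ 2 volume).toReal
  have hint : ∀ {g : Space N → ℝ}, LocallyIntegrable g → Integrable fun x => g x * D w φ x :=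
    fun hg => LocallyIntegrable.int_mul_test hg hφw
  -- Subtracting the linear function with slope given by v(s) leaves a scalar function whose
  -- derivative is at most η times the norm of φ near s. The mean value inequality then bounds its
  -- increment.
  have hder : ∀ τ ∈ Metric.ball s r ∩ Icc 0 T, HasDerivWithinAt
      (fun τ => (∫ x, m τ x * D w φ x) - τ * ∫ x, v s x * D w φ x)
      ((∫ x, v τ x * D w φ x) - 1 * ∫ x, v s x * D w φ x) (Metric.ball s r ∩ Icc 0 T) τ :=
    fun τ hτ => ((hd _ hφw τ hτ.2).mono inter_subset_right).sub
      ((hasDerivWithinAt_id τ _).mul_const _)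
  have hbd : ∀ τ ∈ Metric.ball s r ∩ Icc 0 T,
      ‖(∫ x, v τ x * D w φ x) - 1 * ∫ x, v s x * D w φ x‖ ≤ η * n := by
    intro τ hτ
    have hH : HB q η (v τ - v s) := hball hτ
    have hvτ : LocallyIntegrable (v τ) := by
      have := hH.locInt.add hvl
      rwa [sub_add_cancel] at this
    have hW := hH.wd_W hw
    have e : (∫ x, v τ x * D w φ x) - 1 * ∫ x, v s x * D w φ x =
        (-1) ^ w.length * ∫ x, W w (v τ - v s) x * φ x := by
      rw [← hW.2.2 φ hφ, one_mul, ← integral_sub (hint hvτ) (hint hvl)]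
      simp only [Pi.sub_apply, sub_mul]
    rw [e, norm_mul, norm_pow, norm_neg, norm_one, one_pow, one_mul]
    exact (hH.l2le_of_wd hw hW).abs_integral_mul_le (MemLp.l2le (hφ.memLp 2)) hW.aesm
      (hφ.memLp 2).1 hη.le ENNReal.toReal_nonneg
  have key := hc.norm_image_sub_le_of_norm_hasDerivWithin_le hder hbd hsS htS
  have e : ∫ x, ((t - s)⁻¹ • (m t - m s) - v s) x * D w φ x = (t - s)⁻¹ *
      (((∫ x, m t x * D w φ x) - t * ∫ x, v s x * D w φ x) -
        ((∫ x, m s x * D w φ x) - s * ∫ x, v s x * D w φ x)) := by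
    have e1 : ∀ x, ((t - s)⁻¹ • (m t - m s) - v s) x * D w φ x =
        (t - s)⁻¹ * (m t x * D w φ x - m s x * D w φ x) - v s x * D w φ x := fun x => by
      simp only [Pi.sub_apply, Pi.smul_apply, smul_eq_mul]; ring
    simp only [e1]
    rw [integral_sub (by exact ((hint (hm t ht.1)).sub (hint (hm s hs))).const_mul _) (hint hvl),
      integral_const_mul, integral_sub (hint (hm t ht.1)) (hint (hm s hs))]
    field_simp
    ring
  rw [e, abs_mul, abs_inv]
  rw [Real.norm_eq_abs, Real.norm_eq_abs] at key
  rw [inv_mul_le_iff₀ (abs_pos.2 hts)]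
  linarith

end Difference

/-! ### Regularity in time of the solutions. -/

section Flows

variable {N k : ℕ}

/-- The solutions of the Landau-Lifshitz equation, with strong regularity in time. -/
structure Flow (k : ℕ) (lam T : ℝ) (u : ℝ → Fin 3 → Space N → ℝ) : Prop where
  sphere : ∀ t ∈ Icc 0 T, SphereMap (k + 4) (u t)
  zconv : ∀ s ∈ Icc 0 T, ∀ a, ZConv (𝓝[Icc 0 T] s) (k + 4) (fun t => u t a) (u s a)
  hconv : ∀ s ∈ Icc 0 T, ∀ a, a ≠ 1 → HConv (𝓝[Icc 0 T] s) (k + 4) (fun t => u t a) (u s a)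
  vconv : ∀ s ∈ Icc 0 T, ∀ a,
    HConv (𝓝[Icc 0 T] s) (k + 2) (fun t => veloW lam (u t) a) (veloW lam (u s) a)
  slope : ∀ s ∈ Icc 0 T, ∀ a, HConv (𝓝[Icc 0 T \ {s}] s) (k + 2)
    (fun t => (t - s)⁻¹ • (u t a - u s a)) (veloW lam (u s) a)

lemma MemE.exists_wd {q : ℕ} {U : Space N → Fin 3 → ℝ} (h : MemE (q + 1) U) (a : Fin 3)
    (w : List (Fin N)) (h0 : w ≠ []) (hw : w.length ≤ q + 1) :
    ∃ g, WD w (comp U a) g ∧ MemLp g 2 volume := by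
  obtain ⟨i, v, rfl⟩ := List.exists_cons_of_ne_nil h0
  obtain ⟨g, hg, hgH⟩ := h.2.2.2.2 i a
  simp only [List.length_cons] at hw
  obtain ⟨g', hg', hm⟩ := MemH.exists_wd hgH v (by omega)
  rw [← cnt_replicate i 1] at hg
  exact ⟨g', ((hasWeakDeriv_iff.1 hg).perm (wordOf_cnt _)).append hg', hm⟩

lemma MemE.abs_le {q : ℕ} {U : Space N → Fin 3 → ℝ} (h : MemE q U) (a : Fin 3) :
    ∀ᵐ x, |comp U a x| ≤ 1 := by
  filter_upwards [h.2.1] with x hx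
  rw [← sq_le_one_iff_abs_le_one, ← hx]
  exact Finset.single_le_sum (f := fun a => U x a ^ 2) (fun _ _ => sq_nonneg _) (Finset.mem_univ a)

lemma MemE.locInt {q : ℕ} {U : Space N → Fin 3 → ℝ} (h : MemE q U) (a : Fin 3) :
    LocallyIntegrable (comp U a) :=
  (memLp_top_of_bound (h.1 a) 1 (h.abs_le a)).locallyIntegrable le_top

lemma MemE.memLp {q : ℕ} {U : Space N → Fin 3 → ℝ} (h : MemE q U) (a : Fin 3) (ha : a ≠ 1) :
    MemLp (comp U a) 2 volume := by
  fin_cases a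
  · exact h.2.2.1
  · exact absurd rfl ha
  · exact h.2.2.2.1

lemma MemE.hr {q : ℕ} {U : Space N → Fin 3 → ℝ} (h : MemE (q + 1) U) (a : Fin 3) (ha : a ≠ 1) :
    HR (q + 1) (comp U a) :=
  ⟨_, HB.of_sobolevSq fun w hw => by
    by_cases h0 : w = []
    · subst h0; exact ⟨_, WD.nil (h.locInt a), h.memLp a ha⟩
    · exact h.exists_wd a w h0 hw⟩

lemma MemE.sphereMap {q : ℕ} {U : Space N → Fin 3 → ℝ} (h : MemE (q + 1) U) :
    SphereMap (q + 1) (comp U) where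
  zb a := ⟨_, ZB.of_sobolevSq (h.locInt a) (h.abs_le a) (h.exists_wd a)⟩
  hb a ha := h.hr a ha
  sph := by
    filter_upwards [h.2.1] with x hx
    rwa [Fin.sum_univ_three] at hx

lemma tendsto_sqrt_zero {ι : Type*} {l : Filter ι} {f : ι → ℝ} (h : Tendsto f l (𝓝 0)) :
    Tendsto (fun i => Real.sqrt (f i)) l (𝓝 0) := by
  have h2 := (Real.continuous_sqrt.tendsto 0).comp h
  rwa [Real.sqrt_zero] at h2

lemma zNormSq_bounds (q : ℕ) (U : Space N → Fin 3 → ℝ) :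
    (∀ a, a ≠ 1 → sobolevSq q (comp U a) ≤ zNormSq q U) ∧
    supNorm (comp U 1) ^ 2 + ∑ i, sobolevSq (q - 1) (weakPartial i (comp U 1)) ≤ zNormSq q U := by
  have h0 := sobolevSq_nonneg q (comp U 0)
  have h2 := sobolevSq_nonneg q (comp U 2)
  have h1 := sq_nonneg (supNorm (comp U 1))
  have h3 : 0 ≤ ∑ i, sobolevSq (q - 1) (weakPartial i (comp U 1)) :=
    Finset.sum_nonneg fun i _ => sobolevSq_nonneg _ _
  unfold zNormSq
  refine ⟨fun a ha => ?_, by linarith⟩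
  fin_cases a <;> simp at ha ⊢ <;> linarith

lemma ContinuousInE.hconv {q : ℕ} {T : ℝ} {m : ℝ → Space N → Fin 3 → ℝ}
    (h : ContinuousInE (q + 1) T m) {s : ℝ} (hs : s ∈ Icc 0 T) {a : Fin 3} (ha : a ≠ 1) :
    HConv (𝓝[Icc 0 T] s) (q + 1) (fun t => comp (m t) a) (comp (m s) a) := by
  refine ⟨(h.1 s hs).hr a ha, _, tendsto_sqrt_zero (h.2 s hs), ?_⟩
  filter_upwards [self_mem_nhdsWithin] with t ht
  exact (((h.1 t ht).hr a ha).sub ((h.1 s hs).hr a ha)).hb_sobolevSq.mono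
    (Real.sqrt_le_sqrt ((zNormSq_bounds (q + 1) (m t - m s)).1 a ha))

lemma ContinuousInE.zconv {q : ℕ} {T : ℝ} {m : ℝ → Space N → Fin 3 → ℝ}
    (h : ContinuousInE (q + 1) T m) (hq : N < 2 * (q + 1)) {s : ℝ} (hs : s ∈ Icc 0 T) (a : Fin 3) :
    ZConv (𝓝[Icc 0 T] s) (q + 1) (fun t => comp (m t) a) (comp (m s) a) := by
  -- The component of index 1 is not in L²; its convergence is read off directly from the uniform
  -- and gradient parts of the Z norm. For the other components the Sobolev embedding is used.
  by_cases ha : a = 1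
  · subst ha
    refine ⟨(h.1 s hs).sphereMap.zb 1, _, tendsto_sqrt_zero (h.2 s hs), ?_⟩
    filter_upwards [self_mem_nhdsWithin] with t ht
    have hb : ∀ᵐ x, |(comp (m t) 1 - comp (m s) 1) x| ≤ 2 := by
      filter_upwards [(h.1 t ht).abs_le 1, (h.1 s hs).abs_le 1] with x h1 h2
      exact (abs_sub _ _).trans (by linarith)
    refine (ZB.of_sobolevSq (((h.1 t ht).locInt 1).sub ((h.1 s hs).locInt 1)) hb
      fun w h0 hw => ?_).mono (Real.sqrt_le_sqrt (zNormSq_bounds (q + 1) (m t - m s)).2)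
    obtain ⟨g, hg, hg2⟩ := (h.1 t ht).exists_wd 1 w h0 hw
    obtain ⟨g', hg', hg2'⟩ := (h.1 s hs).exists_wd 1 w h0 hw
    exact ⟨g - g', hg.sub hg', hg2.sub hg2'⟩
  · exact (h.hconv hs ha).toZConv hq

lemma ContinuousInH.hconv {q : ℕ} {T : ℝ} {v : ℝ → Space N → Fin 3 → ℝ}
    (h : ContinuousInH q T v) {s : ℝ} (hs : s ∈ Icc 0 T) (a : Fin 3) :
    HConv (𝓝[Icc 0 T] s) q (fun t => comp (v t) a) (comp (v s) a) := by
  refine ⟨(h.1 s hs a).hr, _, tendsto_sqrt_zero (h.2 s hs), ?_⟩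
  filter_upwards [self_mem_nhdsWithin] with t ht
  exact ((h.1 t ht a).hr.sub (h.1 s hs a).hr).hb_sobolevSq.mono (Real.sqrt_le_sqrt
    (Finset.single_le_sum (f := fun a => sobolevSq q (comp (v t - v s) a))
      (fun _ _ => sobolevSq_nonneg _ _) (Finset.mem_univ a)))

lemma IsLLSolution.velo {lam T : ℝ} {m v : ℝ → Space N → Fin 3 → ℝ} (h : IsLLSolution lam lam T m v)
    {t : ℝ} (ht : t ∈ Icc 0 T) (a : Fin 3) : comp (v t) a =ᵐ[volume] veloW lam (comp (m t)) a := by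
  filter_upwards [h.2 t ht] with x hx
  have := congrFun hx a
  rw [cross_apply] at this
  simp only [Pi.add_apply, Pi.zero_apply, Pi.sub_apply, weakLaplacian_eq] at this
  fin_cases a <;> simp [veloW, crs, fieldW, pr, comp] at this ⊢ <;> linarith

lemma IsLLSolution.flow {lam T : ℝ} {m v : ℝ → Space N → Fin 3 → ℝ} (hN : N < 2 * k)
    (hm : ContinuousInE (k + 4) T m) (hv : ContinuousInH (k + 2) T v)
    (h : IsLLSolution lam lam T m v) : Flow k lam T fun t => comp (m t) where
  sphere t ht := (hm.1 t ht).sphereMap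
  zconv s hs a := ContinuousInE.zconv (q := k + 3) hm (by omega) hs a
  hconv s hs a ha := ContinuousInE.hconv (q := k + 3) hm hs ha
  vconv s hs a := (ContinuousInH.hconv hv hs a).congr
    (by filter_upwards [self_mem_nhdsWithin] with t ht using h.velo ht a) (h.velo hs a)
  slope s hs a := (hconv_slope (fun t ht => MemE.locInt (hm.1 t ht) a)
    (fun φ hφ t ht => h.1 φ hφ a t ht) hs (ContinuousInH.hconv hv hs a)).congr
    (Eventually.of_forall fun _ => EventuallyEq.refl _ _) (h.velo hs a)

end Flows

/-! ### Time differentiation of squared Sobolev norms. -/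

section TimeDerivatives

variable {N q : ℕ}

/-- The function `y` has the time derivative `z` on `[0, T]`, continuously in the Sobolev space of
order `q`. -/
structure TD (q : ℕ) (T : ℝ) (y z : ℝ → Space N → ℝ) : Prop where
  cont : ∀ s ∈ Icc 0 T, HConv (𝓝[Icc 0 T] s) q y (y s)
  slope : ∀ s ∈ Icc 0 T, HConv (𝓝[Icc 0 T \ {s}] s) q (fun t => (t - s)⁻¹ • (y t - y s)) (z s)
  zcont : ∀ s ∈ Icc 0 T, HConv (𝓝[Icc 0 T] s) q z (z s)

lemma HConv.mono_filter {ι : Type*} {l l' : Filter ι} {F : ι → Space N → ℝ} {f : Space N → ℝ}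
    (h : HConv l q F f) (hl : l' ≤ l) : HConv l' q F f := by
  obtain ⟨hb, M, hM, h1⟩ := h
  exact ⟨hb, M, hM.mono_left hl, h1.filter_mono hl⟩

lemma nhdsWithin_punctured_le (T s : ℝ) : 𝓝[Icc 0 T \ {s}] s ≤ 𝓝[Icc 0 T] s :=
  nhdsWithin_mono s Set.sdiff_subset

/-- The `L²` scalar product of the derivatives of order `j`. -/
def hdotPair (j : ℕ) (f g : Space N → ℝ) : ℝ :=
  ∑ α ∈ Finset.piAntidiag (Finset.univ : Finset (Fin N)) j,
    ∫ x, W (wordOf α) f x * W (wordOf α) g x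

namespace TD

variable {T : ℝ} {y z : ℝ → Space N → ℝ}

lemma mono_order {q' : ℕ} (h : TD q T y z) (hq : q' ≤ q) : TD q' T y z :=
  ⟨fun s hs => (h.cont s hs).mono_order hq, fun s hs => (h.slope s hs).mono_order hq,
    fun s hs => (h.zcont s hs).mono_order hq⟩

lemma word {w : List (Fin N)} (h : TD (q + w.length) T y z) :
    TD q T (fun t => W w (y t)) (fun t => W w (z t)) where
  cont s hs := (h.cont s hs).derivW
  zcont s hs := (h.zcont s hs).derivW
  slope s hs := by
    have hy : ∀ t ∈ Icc 0 T, WD w (y t) (W w (y t)) := fun t ht =>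
      (h.cont t ht).hr.reg w (by omega)
    refine (h.slope s hs).of_wd ?_ ((h.zcont s hs).hr.reg w (by omega))
    filter_upwards [self_mem_nhdsWithin] with t ht
    exact ((hy t ht.1).sub (hy s hs)).smul _

/-- The difference quotient of the integral is the pairing of the difference quotient of y with y(t)
+ y(s), and both factors converge in L². -/
lemma hasDerivWithinAt_integral_sq (h : TD 0 T y z) {s : ℝ} (hs : s ∈ Icc 0 T) :
    HasDerivWithinAt (fun t => ∫ x, y t x ^ 2) (2 * ∫ x, y s x * z s x) (Icc 0 T) s := by
  rw [hasDerivWithinAt_iff_tendsto_slope]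
  have hc := (h.cont s hs).mono_filter (nhdsWithin_punctured_le T s)
  have ht := (h.slope s hs).tendsto_integral_mul (hc.add (HConv.const (h.cont s hs).bound.choose_spec))
  have e : ∫ x, z s x * (y s + y s) x = 2 * ∫ x, y s x * z s x := by
    rw [← integral_const_mul]
    congr 1; ext x; simp; ring
  rw [e] at ht
  refine ht.congr' ?_
  filter_upwards [self_mem_nhdsWithin] with t htS
  have m1 := (h.cont t htS.1).memLp.integrable_sq
  have m2 := (h.cont s hs).memLp.integrable_sq
  rw [slope_def_module, ← integral_sub m1 m2, smul_eq_mul, ← integral_const_mul]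
  congr 1; ext x
  simp only [Pi.smul_apply, Pi.sub_apply, Pi.add_apply, smul_eq_mul]
  ring

lemma hasDerivWithinAt_hdotSq (h : TD q T y z) {j : ℕ} (hj : j ≤ q) {s : ℝ} (hs : s ∈ Icc 0 T) :
    HasDerivWithinAt (fun t => hdotSq j (y t)) (2 * hdotPair j (y s) (z s)) (Icc 0 T) s := by
  unfold hdotSq hdotPair
  rw [Finset.mul_sum]
  refine HasDerivWithinAt.fun_sum fun α hα => ?_
  have hl : (wordOf α).length ≤ q := by
    have : ∑ i, α i = j := (Finset.mem_piAntidiag.1 hα).1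
    rw [length_wordOf]; omega
  simp only [← W_wordOf]
  exact ((h.mono_order (by omega : 0 + (wordOf α).length ≤ q)).word).hasDerivWithinAt_integral_sq hs

lemma continuousOn_hdotPair (h : TD q T y z) {j : ℕ} (hj : j ≤ q) :
    ContinuousOn (fun t => hdotPair j (y t) (z t)) (Icc 0 T) := by
  unfold hdotPair
  refine continuousOn_finsetSum _ fun α hα => ?_
  have hl : (wordOf α).length ≤ q := by
    have : ∑ i, α i = j := (Finset.mem_piAntidiag.1 hα).1
    rw [length_wordOf]; omega
  have h0 := (h.mono_order (by omega : 0 + (wordOf α).length ≤ q)).word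
  exact fun s hs => (h0.cont s hs).tendsto_integral_mul (h0.zcont s hs)

end TD

lemma W_zero_ae (w : List (Fin N)) : W w (0 : Space N → ℝ) =ᵐ[volume] 0 := (WD.zero w).W_ae

lemma hdotPair_congr {f f' : Space N → ℝ} (h : f =ᵐ[volume] f') (j : ℕ) (g : Space N → ℝ) :
    hdotPair j f g = hdotPair j f' g := by
  simp only [hdotPair, W_congr h]

lemma hdotPair_zero (j : ℕ) (g : Space N → ℝ) : hdotPair j 0 g = 0 := by
  refine Finset.sum_eq_zero fun α _ => ?_
  rw [integral_congr_mul (W_zero_ae _) (EventuallyEq.refl _ _)]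
  simp

end TimeDerivatives

/-! ### The energy along a flow: differentiability and the final estimate. -/

section FlowDerivatives

variable {N k : ℕ} {lam T : ℝ} {u : ℝ → Fin 3 → Space N → ℝ}

namespace Flow

lemma td_comp (h : Flow k lam T u) {a : Fin 3} (ha : a ≠ 1) :
    TD (k + 2) T (fun t => u t a) (fun t => veloW lam (u t) a) where
  cont s hs := (h.hconv s hs a ha).mono_order (by omega)
  slope s hs := h.slope s hs a
  zcont s hs := h.vconv s hs a

/-- All components are allowed: the Laplacian of the component of index 1 is in L² although the
component is not. -/
lemma td_lapW (h : Flow k lam T u) (a : Fin 3) :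
    TD k T (fun t => lapW (u t a)) (fun t => lapW (veloW lam (u t) a)) where
  cont s hs := ((h.zconv s hs a).mono_order (by omega : k + 2 ≤ k + 4)).lapW
  zcont s hs := (h.vconv s hs a).lapW
  slope s hs := by
    have hy : ∀ t ∈ Icc 0 T, ∀ i, WD [i, i] (u t a) (W [i, i] (u t a)) := fun t ht i =>
      ((h.sphere t ht).zb a).choose_spec.reg [i, i] (by simp)
    have h1 : HConv (𝓝[Icc 0 T \ {s}] s) k
        (fun t => ∑ i, (t - s)⁻¹ • (W [i, i] (u t a) - W [i, i] (u s a)))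
        (lapW (veloW lam (u s) a)) := HConv.sum Finset.univ fun i _ =>
      (h.slope s hs a).of_wd (w := [i, i])
        (by filter_upwards [self_mem_nhdsWithin] with t ht
            exact ((hy t ht.1 i).sub (hy s hs i)).smul _)
        ((h.vconv s hs a).hr.reg [i, i] (by simp))
    simpa only [lapW, ← Finset.sum_sub_distrib, Finset.smul_sum] using h1

lemma conv_field (h : Flow k lam T u) {s : ℝ} (hs : s ∈ Icc 0 T) (a : Fin 3) :
    HConv (𝓝[Icc 0 T] s) (k + 2) (fun t => fieldW lam (u t) a) (fieldW lam (u s) a) :=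
  (h.zconv s hs a).lapW.sub
    ((HConv.pr (fun a ha => (h.hconv s hs a ha).mono_order (by omega)) a).smul lam)

lemma conv_field_velo (h : Flow k lam T u) {s : ℝ} (hs : s ∈ Icc 0 T) (a : Fin 3) :
    HConv (𝓝[Icc 0 T] s) k (fun t => fieldW lam (veloW lam (u t)) a)
      (fieldW lam (veloW lam (u s)) a) :=
  (h.vconv s hs a).lapW.sub
    ((HConv.pr (fun a _ => (h.vconv s hs a).mono_order (by omega)) a).smul lam)

lemma slope_field (h : Flow k lam T u) {s : ℝ} (hs : s ∈ Icc 0 T) (a : Fin 3) :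
    HConv (𝓝[Icc 0 T \ {s}] s) k
      (fun t => (t - s)⁻¹ • (fieldW lam (u t) a - fieldW lam (u s) a))
      (fieldW lam (veloW lam (u s)) a) := by
  have h1 := ((h.td_lapW a).slope s hs).sub
    ((HConv.pr (fun a _ => (h.slope s hs a).mono_order (by omega : k ≤ k + 2)) a).smul lam)
  have e : ∀ t, (t - s)⁻¹ • (fieldW lam (u t) a - fieldW lam (u s) a) =
      (t - s)⁻¹ • (lapW (u t a) - lapW (u s a)) -
        lam • pr (fun a => (t - s)⁻¹ • (u t a - u s a)) a := fun t => by
    ext x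
    fin_cases a <;> simp [fieldW, pr] <;> ring
  simp only [e]
  exact h1

/-- Product rule on difference quotients: v(t) − v(s) = −(u(t) − u(s)) × F(t) − u(s) × (F(t) −
F(s)). Products converge in Sobolev norm because N < 2k. -/
lemma td_velo (h : Flow k lam T u) (hk : N < 2 * k) (a : Fin 3) :
    TD k T (fun t => veloW lam (u t) a) (fun t => accW lam (u t) (veloW lam (u t)) a) where
  cont s hs := (h.vconv s hs a).mono_order (by omega)
  zcont s hs :=
    (HConv.crs hk (fun a => ((h.vconv s hs a).mono_order (by omega)).toZConv hk)
      (fun a => (h.conv_field hs a).mono_order (by omega)) a).neg.sub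
    (HConv.crs hk (fun a => (h.zconv s hs a).mono_order (by omega))
      (fun a => h.conv_field_velo hs a) a)
  slope s hs := by
    have h1 := (HConv.crs hk (fun a => ((h.slope s hs a).mono_order (by omega)).toZConv hk)
      (fun a => ((h.conv_field hs a).mono_order (by omega)).mono_filter
        (nhdsWithin_punctured_le T s)) a).neg.sub
      (HConv.crs hk (fun a => ((ZConv.const (l := 𝓝[Icc 0 T \ {s}] s)
        ((h.sphere s hs).zb a).choose_spec)).mono_order (by omega))
        (fun a => h.slope_field hs a) a)
    have e : ∀ t, (t - s)⁻¹ • (veloW lam (u t) a - veloW lam (u s) a) =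
        -crs (fun a => (t - s)⁻¹ • (u t a - u s a)) (fun a => fieldW lam (u t) a) a -
          crs (fun a => u s a)
            (fun a => (t - s)⁻¹ • (fieldW lam (u t) a - fieldW lam (u s) a)) a := fun t => by
      ext x
      fin_cases a <;> simp [veloW, crs] <;> ring
    simp only [e]
    exact h1

/-- The derivative of the energy of order `j + 2` along a flow. -/
def rate (lam : ℝ) (j : ℕ) (u : Fin 3 → Space N → ℝ) : ℝ :=
  ∑ a, hdotPair j (veloW lam u a) (accW lam u (veloW lam u) a) +
    ∑ a, hdotPair j (lapW (u a)) (lapW (veloW lam u a)) +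
    2 * lam * (∑ i, hdotPair j (W [i] (u 0)) (W [i] (veloW lam u 0)) +
      ∑ i, hdotPair j (W [i] (u 2)) (W [i] (veloW lam u 2))) +
    lam ^ 2 * (hdotPair j (u 0) (veloW lam u 0) + hdotPair j (u 2) (veloW lam u 2))

lemma hasDerivWithinAt_energy (h : Flow k lam T u) (hk : N < 2 * k) {j : ℕ} (hj : j ≤ k) {s : ℝ}
    (hs : s ∈ Icc 0 T) :
    HasDerivWithinAt (fun t => (1 / 2) * (∑ a, hdotSq j (veloW lam (u t) a) +
      ∑ a, hdotSq j (lapW (u t a)) + 2 * lam *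
        (∑ i, hdotSq j (W [i] (u t 0)) + ∑ i, hdotSq j (W [i] (u t 2))) +
      lam ^ 2 * (hdotSq j (u t 0) + hdotSq j (u t 2)))) (rate lam j (u s)) (Icc 0 T) s := by
  have h1 : HasDerivWithinAt (fun t => ∑ a, hdotSq j (veloW lam (u t) a)) _ (Icc 0 T) s :=
    HasDerivWithinAt.fun_sum fun a (_ : a ∈ Finset.univ) =>
      (h.td_velo hk a).hasDerivWithinAt_hdotSq hj hs
  have h2 : HasDerivWithinAt (fun t => ∑ a, hdotSq j (lapW (u t a))) _ (Icc 0 T) s :=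
    HasDerivWithinAt.fun_sum fun a (_ : a ∈ Finset.univ) =>
      (h.td_lapW a).hasDerivWithinAt_hdotSq hj hs
  have h3 : ∀ a, a ≠ 1 → HasDerivWithinAt (fun t => ∑ i, hdotSq j (W [i] (u t a)))
      (∑ i, 2 * hdotPair j (W [i] (u s a)) (W [i] (veloW lam (u s) a))) (Icc 0 T) s := fun a ha =>
    HasDerivWithinAt.fun_sum fun i (_ : i ∈ Finset.univ) =>
      (((h.td_comp ha).mono_order (by simp : k + [i].length ≤ k + 2)).word
        (w := [i])).hasDerivWithinAt_hdotSq hj hs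
  have h4 : ∀ a, a ≠ 1 → HasDerivWithinAt (fun t => hdotSq j (u t a))
      (2 * hdotPair j (u s a) (veloW lam (u s) a)) (Icc 0 T) s := fun a ha =>
    (h.td_comp ha).hasDerivWithinAt_hdotSq (by omega) hs
  refine ((((h1.add h2).add (((h3 0 (by decide)).add (h3 2 (by decide))).const_mul
    (2 * lam))).add (((h4 0 (by decide)).add (h4 2 (by decide))).const_mul (lam ^ 2))).const_mul
    (1 / 2)).congr_deriv ?_
  simp only [rate, ← Finset.mul_sum]
  ring

lemma continuousOn_rate (h : Flow k lam T u) (hk : N < 2 * k) {j : ℕ} (hj : j ≤ k) :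
    ContinuousOn (fun t => rate lam j (u t)) (Icc 0 T) := by
  have h3 : ∀ a, a ≠ 1 → ContinuousOn (fun t => ∑ i, hdotPair j (W [i] (u t a))
      (W [i] (veloW lam (u t) a))) (Icc 0 T) := fun a ha =>
    continuousOn_finsetSum _ fun i _ =>
      (((h.td_comp ha).mono_order (by simp : k + [i].length ≤ k + 2)).word
        (w := [i])).continuousOn_hdotPair hj
  have h4 : ∀ a, a ≠ 1 → ContinuousOn (fun t => hdotPair j (u t a) (veloW lam (u t) a))
      (Icc 0 T) := fun a ha => (h.td_comp ha).continuousOn_hdotPair (by omega)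
  exact ((((continuousOn_finsetSum _ fun a _ => (h.td_velo hk a).continuousOn_hdotPair hj).add
    (continuousOn_finsetSum _ fun a _ => (h.td_lapW a).continuousOn_hdotPair hj)).add
    (((h3 0 (by decide)).add (h3 2 (by decide))).const_smul (2 * lam))).add
    (((h4 0 (by decide)).add (h4 2 (by decide))).const_smul (lam ^ 2)))

end Flow

/-- The terms with λ involve only the components of indices 0 and 2. With the projection `pr` they
are summed over all components, so that `SphereMap.rate_eq` applies uniformly. -/
lemma SphereMap.rate_eq_sum {u : Fin 3 → Space N → ℝ} (h : SphereMap (k + 4) u) (hk : N < 2 * k)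
    (lam : ℝ) {j : ℕ} (hj : j ≤ k) : Flow.rate lam j u =
      ∑ α ∈ Finset.piAntidiag (Finset.univ : Finset (Fin N)) j, ∑ a,
        ∫ x, W (wordOf α) (veloW lam u a) x * W (wordOf α) (waveW lam u (veloW lam u) a) x := by
  rw [Finset.sum_comm]
  have key : ∀ a, ∑ α ∈ Finset.piAntidiag (Finset.univ : Finset (Fin N)) j,
      ∫ x, W (wordOf α) (veloW lam u a) x * W (wordOf α) (waveW lam u (veloW lam u) a) x =
      hdotPair j (veloW lam u a) (accW lam u (veloW lam u) a) +
      hdotPair j (lapW (u a)) (lapW (veloW lam u a)) +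
      2 * lam * (∑ i, hdotPair j (W [i] (pr u a)) (W [i] (veloW lam u a))) +
      lam ^ 2 * hdotPair j (pr u a) (veloW lam u a) := by
    intro a
    simp only [hdotPair]
    rw [Finset.sum_comm (s := Finset.univ) (t := Finset.piAntidiag Finset.univ j), Finset.mul_sum,
      Finset.mul_sum, ← Finset.sum_add_distrib, ← Finset.sum_add_distrib, ← Finset.sum_add_distrib]
    refine Finset.sum_congr rfl fun α hα => (h.rate_eq hk lam ?_ a).symm
    have : ∑ i, α i = j := (Finset.mem_piAntidiag.1 hα).1
    rw [length_wordOf]; omega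
  simp only [key, Fin.sum_univ_three]
  have p1 : pr u 1 = 0 := rfl
  have z1 : ∀ i, hdotPair j (W [i] (pr u 1)) (W [i] (veloW lam u 1)) = 0 := fun i => by
    rw [p1, hdotPair_congr (W_zero_ae [i])]
    exact hdotPair_zero j _
  have z2 : hdotPair j (pr u 1) (veloW lam u 1) = 0 := hdotPair_zero j _
  have p0 : pr u 0 = u 0 := rfl
  have p2 : pr u 2 = u 2 := rfl
  simp only [z1, z2, p0, p2, Finset.sum_const_zero, Flow.rate, Fin.sum_univ_three]
  ring

/-- The estimate of the derivative of the energy. -/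
lemma rate_le (N s : ℕ) : ∃ C, 0 ≤ C ∧ ∀ k, N < 2 * k → s ≤ k → ∀ lam : ℝ, 1 ≤ lam →
    ∀ U V : Space N → Fin 3 → ℝ, SphereMap (k + 4) (comp U) →
    (∀ a, comp V a =ᵐ[volume] veloW lam (comp U) a) →
    Flow.rate lam s (comp U) ≤ C * lam *
      (supNorm (comp U 0) ^ 2 + supNorm (comp U 2) ^ 2 + gradSupNorm U ^ 2) *
      (energyOrder lam lam (s + 2) U V + energyOrder lam lam (s + 1) U V) := by
  obtain ⟨C, hC, hest⟩ := weak_estimate N s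
  set c : ℝ := ((Finset.piAntidiag (Finset.univ : Finset (Fin N)) s).card : ℝ) with hc
  -- The factor c counts the multi-indices of order s, and the factor 2 comes from X² being twice
  -- the sum of the energies.
  refine ⟨2 * c * C, by positivity, fun k hk hs lam hlam U V h hV => ?_⟩
  have hE2 := energyOrder_nonneg hlam (s + 2) U V
  have hE1 := energyOrder_nonneg hlam (s + 1) U V
  rw [h.rate_eq_sum hk lam hs]
  refine (Finset.sum_le_card_nsmul _ _
    (C * (lam * ((supNorm (comp U 0) ^ 2 + supNorm (comp U 2) ^ 2 + gradSupNorm U ^ 2) *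
      (2 * energyOrder lam lam (s + 2) U V + 2 * energyOrder lam lam (s + 1) U V))))
    fun α hα => ?_).trans (le_of_eq ?_)
  · have hl : (wordOf α).length = s := by
      rw [length_wordOf]; exact (Finset.mem_piAntidiag.1 hα).1
    have := hest k hk hs lam _ _ (comp U) h (h.ctrlW hk hs hlam V) (wordOf α) hl
      (h.l2le_velo hk hs hlam hV hl)
    rwa [Real.sq_sqrt (by positivity), Real.sq_sqrt (by positivity)] at this
  · rw [nsmul_eq_mul, ← hc]
    ring

/-- The energy is written with the velocity computed from the map, which equals the given time
derivative almost everywhere; the norms only see the class. -/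
lemma energyOrder_eq_velo {U V : Space N → Fin 3 → ℝ} (j : ℕ)
    (hV : ∀ a, comp V a =ᵐ[volume] veloW lam (comp U) a) :
    energyOrder lam lam (j + 2) U V = (1 / 2) * (∑ a, hdotSq j (veloW lam (comp U) a) +
      ∑ a, hdotSq j (lapW (comp U a)) + 2 * lam *
        (∑ i, hdotSq j (W [i] (comp U 0)) + ∑ i, hdotSq j (W [i] (comp U 2))) +
      lam ^ 2 * (hdotSq j (comp U 0) + hdotSq j (comp U 2))) := by
  have := energyOrder_eq lam j U V
  simp only [hdotSq_congr (hV _)] at this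
  linarith

end FlowDerivatives

end LandauLifshitz

end

/-! ### Conclusion. -/

theorem mainTheorem6 (k : ℕ) :
    ∃ C : ℝ, 0 < C ∧
      ∀ N : ℕ, 1 ≤ N → (N : ℝ) / 2 + 1 < k →
      ∀ ε : ℝ, 0 < ε → ε < 1 →
      ∀ T : ℝ, 0 < T →
      ∀ m mt : ℝ → LandauLifshitz.Space N → Fin 3 → ℝ,
        LandauLifshitz.ContinuousInE (k + 4) T m →
        LandauLifshitz.ContinuousInH (k + 2) T mt →
        LandauLifshitz.IsLLSolution (1 / ε) (1 / ε) T m mt →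
      ∀ l : ℕ, 2 ≤ l → l ≤ k + 2 →
        ContDiffOn ℝ 1
          (fun t => LandauLifshitz.energyOrder (1 / ε) (1 / ε) l (m t) (mt t)) (Icc 0 T) ∧
        ∀ t ∈ Icc 0 T,
          derivWithin
              (fun s => LandauLifshitz.energyOrder (1 / ε) (1 / ε) l (m s) (mt s)) (Icc 0 T) t
            ≤ C / ε
              * (LandauLifshitz.supNorm (LandauLifshitz.comp (m t) 0) ^ 2
                + LandauLifshitz.supNorm (LandauLifshitz.comp (m t) 2) ^ 2
                + LandauLifshitz.gradSupNorm (m t) ^ 2)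
              * (LandauLifshitz.energyOrder (1 / ε) (1 / ε) l (m t) (mt t)
                + LandauLifshitz.energyOrder (1 / ε) (1 / ε) (l - 1) (m t) (mt t)) := by
  choose c hc hrate using LandauLifshitz.rate_le
  have hsum : ∀ N s, 0 ≤ ∑ s ∈ Finset.range s, c N s := fun N s =>
    Finset.sum_nonneg fun s _ => hc N s
  have hsum' : 0 ≤ ∑ N ∈ Finset.range (2 * k), ∑ s ∈ Finset.range (k + 1), c N s :=
    Finset.sum_nonneg fun N _ => hsum N _
  -- The constants depend on N and s, but N < 2k and s ≤ k leave finitely many pairs. Their sum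
  -- depends only on k, and the added 1 makes it positive.
  refine ⟨∑ N ∈ Finset.range (2 * k), ∑ s ∈ Finset.range (k + 1), c N s + 1, by linarith,
    fun N _ hNk ε hε hε1 T hT m mt hm hmt hLL l hl2 hlk => ?_⟩
  obtain ⟨s, rfl⟩ : ∃ s, l = s + 2 := ⟨l - 2, by omega⟩
  have hs : s ≤ k := by omega
  have hN : N < 2 * k := by
    have : (N : ℝ) < 2 * k := by linarith
    exact_mod_cast this
  have hlam : 1 ≤ 1 / ε := (one_le_div hε).2 hε1.le
  have hflow := hLL.flow hN hm hmt
  have huniq := uniqueDiffOn_Icc hT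
  have hder : ∀ t ∈ Icc 0 T, HasDerivWithinAt
      (fun t => LandauLifshitz.energyOrder (1 / ε) (1 / ε) (s + 2) (m t) (mt t))
      (LandauLifshitz.Flow.rate (1 / ε) s (LandauLifshitz.comp (m t))) (Icc 0 T) t := fun t ht =>
    (hflow.hasDerivWithinAt_energy hN hs ht).congr
      (fun τ hτ => LandauLifshitz.energyOrder_eq_velo s (hLL.velo hτ))
      (LandauLifshitz.energyOrder_eq_velo s (hLL.velo ht))
  have hdw : ∀ t ∈ Icc 0 T, derivWithin
      (fun t => LandauLifshitz.energyOrder (1 / ε) (1 / ε) (s + 2) (m t) (mt t)) (Icc 0 T) t =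
      LandauLifshitz.Flow.rate (1 / ε) s (LandauLifshitz.comp (m t)) := fun t ht =>
    (hder t ht).derivWithin (huniq t ht)
  -- The derivative within the closed interval exists everywhere and equals the continuous function
  -- `Flow.rate`, which gives class C¹ up to the end points.
  refine ⟨(contDiffOn_one_iff_derivWithin huniq).2
    ⟨fun t ht => (hder t ht).differentiableWithinAt,
      (hflow.continuousOn_rate hN hs).congr hdw⟩, fun t ht => ?_⟩
  rw [hdw t ht]
  refine (hrate N s k hN hs (1 / ε) hlam (m t) (mt t) (hflow.sphere t ht) (hLL.velo ht)).trans ?_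
  have hE2 := LandauLifshitz.energyOrder_nonneg hlam (s + 2) (m t) (mt t)
  have hE1 := LandauLifshitz.energyOrder_nonneg hlam (s + 1) (m t) (mt t)
  have hcle : c N s ≤ ∑ N ∈ Finset.range (2 * k), ∑ s ∈ Finset.range (k + 1), c N s + 1 := by
    have h1 := Finset.single_le_sum (f := fun s => c N s) (fun s _ => hc N s)
      (Finset.mem_range.2 (by omega : s < k + 1))
    have h2 := Finset.single_le_sum (f := fun N => ∑ s ∈ Finset.range (k + 1), c N s)
      (fun N _ => hsum N _) (Finset.mem_range.2 hN)
    linarith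
  rw [mul_one_div, show s + 2 - 1 = s + 1 by omega]
  gcongr
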